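/- Let $\ell$ be a prime number, $K$ a number field containing the $2\ell$-th roots of unity, $\ell^m$ the number of roots of unity of $\ell$-power order in $K$, and $K_\infty=\bigcup_n K_n$ the cyclotomic $\mathbb Z_\ell$-extension of $K$, with layers $K_n=K(\mu_{\ell^{m+n}})$. Let $\gamma$ be the topological generator of $\mathrm{Gal}(K_\infty/K)$ such that $\zeta^\gamma=\zeta^{1+\ell^m}$ for every $\zeta\in\mu_{\ell^\infty}$, and let $\Gamma^*$ be the group topologically generated by $\gamma^*=\gamma/(1+\ell^m)$. For a field $F$ put $\mathfrak R_F=(\mathbb Q_\ell/\mathbb Z_\ell)\otimes_{\mathbb Z}F^\times$ (the universal $\ell$-radical of $F$); in particular $\mathfrak R_{K_n}^{\Gamma^*}$ is the set of elements of $\mathfrak R_{K_n}$ on which $\gamma$ acts as $1+\ell^m$. For an extension $L/K_\infty$ put $$\mathrm{Rad}(L/K_\infty)=\{\ell^{-k}\otimes x\in\mathfrak R_{K_\infty}\;:\;k\ge 0,\ x\in K_\infty^\times,\ K_\infty[\sqrt[\ell^k]{x}]\subset L\}.$$ Let $Z$ be the compositum of all $\mathbb Z_\ell$-extensions of $K$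 in an algebraic closure of $K$, and let $${}_{\ell^m}\mathfrak Z_K=\{\ell^{-m}\otimes x\in\mathfrak R_K\;:\;x\in K^\times,\ K_\infty[\sqrt[\ell^m]{x}]\subset Z\}$$ be the initial radical attached to $Z$. Then: (i) the image of ${}_{\ell^m}\mathfrak Z_K$ in $\mathfrak R_{K_\infty}$ is $\mathrm{Rad}(M/K_\infty)$, where $M$ is the compositum of the extensions $LK_\infty$, for $L$ running through the cyclic extensions of $K$ of exponent dividing $\ell^m$ that are contained in some $\mathbb Z_\ell$-extension of $K$; (ii) in $\mathfrak R_{K_0}=\mathfrak R_K$, the set ${}_{\ell^m}\mathfrak Z_K$ is exactly the set of initial terms $x_0$ of the elements $(x_n)_{n\ge 0}$ of the projective limit $\varprojlim \mathfrak R_{K_n}^{\Gamma^*}$, taken with respect to the maps $\mathfrak R_{K_{n+1}}\to\mathfrak R_{K_n}$ induced by the norms $N_{K_{n+1}/K_n}$. -/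

import Mathlib

open scoped TensorProduct

noncomputable section

namespace RadZ

section Radical

variable (ℓ : ℕ) [Fact ℓ.Prime]

/-- The quotient `ℚ_ℓ / ℤ_ℓ`, as a `ℤ_ℓ`-module. -/
abbrev QmodZ : Type :=
  ℚ_[ℓ] ⧸ LinearMap.range (Algebra.linearMap ℤ_[ℓ] ℚ_[ℓ])

/-- The universal `ℓ`-radical `ℚ_ℓ/ℤ_ℓ ⊗_ℤ Fˣ` of a field `F`; it is a `ℤ_ℓ`-module,
written additively. -/
abbrev Radical (F : Type*) [Field F] : Type _ :=
  QmodZ ℓ ⊗[ℤ] Additive Fˣ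

/-- The element `ℓ^{-k} ⊗ x` of the universal radical. -/
def radMk {F : Type*} [Field F] (k : ℕ) (x : Fˣ) : Radical ℓ F :=
  Submodule.Quotient.mk (((ℓ : ℚ_[ℓ]) ^ k)⁻¹) ⊗ₜ[ℤ] Additive.ofMul x

/-- The map `id ⊗ f` induced on universal radicals by a homomorphism `f : Fˣ → Eˣ`. -/
def radMap {F E : Type*} [Field F] [Field E] (f : Fˣ →* Eˣ) :
    Radical ℓ F →ₗ[ℤ_[ℓ]] Radical ℓ E :=
  TensorProduct.AlgebraTensorModule.lTensor ℤ_[ℓ] (QmodZ ℓ) f.toAdditive.toIntLinearMap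

end Radical

section Tower

variable (ℓ m : ℕ) (K Ω : Type*) [Field K] [Field Ω] [Algebra K Ω]

/-- The field `K_∞ = K(μ_{ℓ^∞})` inside `Ω`. When `K` contains the `2ℓ`-th roots of unity,
this is the cyclotomic `ℤ_ℓ`-extension of `K`. -/
def Kinf : IntermediateField K Ω :=
  IntermediateField.adjoin K {ζ : Ω | ∃ k : ℕ, ζ ^ ℓ ^ k = 1}

/-- The field `K_n = K(μ_{ℓ^{m+n}})` inside `K_∞`. When `ℓ^m` is the number of roots of unity
of `ℓ`-power order in `K`, this is the `n`-th layer of the cyclotomic tower (and `K_0 = K`). -/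
def layer (n : ℕ) : IntermediateField K (Kinf ℓ K Ω) :=
  IntermediateField.adjoin K {ζ : Kinf ℓ K Ω | ζ ^ ℓ ^ (m + n) = 1}

theorem layer_le_succ (n : ℕ) : layer ℓ m K Ω n ≤ layer ℓ m K Ω (n + 1) := by
  apply IntermediateField.adjoin.mono
  intro ζ hζ
  change ζ ^ ℓ ^ (m + n) = 1 at hζ
  change ζ ^ ℓ ^ (m + (n + 1)) = 1
  rw [← add_assoc, pow_succ ℓ, pow_mul, hζ, one_pow]

theorem map_mem_layer (n : ℕ) (γ : Kinf ℓ K Ω ≃ₐ[K] Kinf ℓ K Ω) (x : layer ℓ m K Ω n) :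
    γ (x : Kinf ℓ K Ω) ∈ layer ℓ m K Ω n := by
  have h : layer ℓ m K Ω n ≤ (layer ℓ m K Ω n).comap γ.toAlgHom := by
    refine IntermediateField.adjoin_le_iff.2 fun ζ hζ => ?_
    refine IntermediateField.subset_adjoin K _ ?_
    change γ ζ ^ ℓ ^ (m + n) = 1
    rw [← map_pow, show ζ ^ ℓ ^ (m + n) = 1 from hζ, map_one]
  exact h x.2

/-- The restriction of `γ ∈ Gal(K_∞/K)` to the layer `K_n`. -/
def restrictLayer (n : ℕ) (γ : Kinf ℓ K Ω ≃ₐ[K] Kinf ℓ K Ω) :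
    layer ℓ m K Ω n →ₐ[K] layer ℓ m K Ω n :=
  (γ.toAlgHom.comp (layer ℓ m K Ω n).val).codRestrict (layer ℓ m K Ω n).toSubalgebra
    (map_mem_layer ℓ m K Ω n γ)

variable [Fact ℓ.Prime]

/-- The action of `γ ∈ Gal(K_∞/K)` on the universal radical of `K_n`. -/
def galAct (n : ℕ) (γ : Kinf ℓ K Ω ≃ₐ[K] Kinf ℓ K Ω) :
    Radical ℓ (layer ℓ m K Ω n) →ₗ[ℤ_[ℓ]] Radical ℓ (layer ℓ m K Ω n) :=
  radMap ℓ (Units.map (restrictLayer ℓ m K Ω n γ : layer ℓ m K Ω n →* layer ℓ m K Ω n))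

/-- The `Γ*`-invariants of the universal radical of `K_n`, where `Γ*` is topologically generated
by `γ* = γ / (1 + ℓ^m)`: the elements fixed by `γ*`, that is, those on which `γ` acts as
multiplication by `1 + ℓ^m`. (The radical is a discrete module, so that being fixed by `γ*` and
being fixed by the closed group that it generates are the same.) -/
def gammaStarInvariants (n : ℕ) (γ : Kinf ℓ K Ω ≃ₐ[K] Kinf ℓ K Ω) :
    Submodule ℤ_[ℓ] (Radical ℓ (layer ℓ m K Ω n)) :=
  LinearMap.eqLocus (galAct ℓ m K Ω n γ) ((1 + (ℓ : ℤ_[ℓ]) ^ m) • LinearMap.id)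

/-- The map from the universal radical of `K_{n+1}` to that of `K_n` induced by the norm of the field extension `K_{n+1}/K_n`. -/
def normMap (n : ℕ) :
    Radical ℓ (layer ℓ m K Ω (n + 1)) →ₗ[ℤ_[ℓ]] Radical ℓ (layer ℓ m K Ω n) :=
  letI : Algebra (layer ℓ m K Ω n) (layer ℓ m K Ω (n + 1)) :=
    (IntermediateField.inclusion (layer_le_succ ℓ m K Ω n)).toRingHom.toAlgebra
  radMap ℓ (Units.map (Algebra.norm (layer ℓ m K Ω n) (S := layer ℓ m K Ω (n + 1))))

/-- The projective limit, for the norm maps, of the `Γ*`-invariants of the universal radicals of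
the layers `K_n`, as a submodule of the product. -/
def normLimit (γ : Kinf ℓ K Ω ≃ₐ[K] Kinf ℓ K Ω) :
    Submodule ℤ_[ℓ] (∀ n : ℕ, Radical ℓ (layer ℓ m K Ω n)) where
  carrier := {u | (∀ n, u n ∈ gammaStarInvariants ℓ m K Ω n γ) ∧
    ∀ n, normMap ℓ m K Ω n (u (n + 1)) = u n}
  add_mem' := fun {u v} hu hv =>
    ⟨fun n => add_mem (hu.1 n) (hv.1 n), fun n => by simp [hu.2 n, hv.2 n]⟩
  zero_mem' := ⟨fun n => zero_mem _, fun n => by simp⟩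
  smul_mem' := fun c u hu =>
    ⟨fun n => Submodule.smul_mem _ c (hu.1 n), fun n => by simp [hu.2 n]⟩

end Tower

section Extensions

variable (ℓ m : ℕ) [Fact ℓ.Prime] (K Ω : Type*) [Field K] [Field Ω] [Algebra K Ω]

/-- `L/K` is a `ℤ_ℓ`-extension: Galois, with group topologically isomorphic to `ℤ_ℓ`. -/
def IsZlExtension {K Ω : Type*} [Field K] [Field Ω] [Algebra K Ω]
    (L : IntermediateField K Ω) : Prop :=
  IsGalois K L ∧ Nonempty ((L ≃ₐ[K] L) ≃ₜ* Multiplicative ℤ_[ℓ])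

/-- The compositum `Z` of all `ℤ_ℓ`-extensions of `K` (inside `Ω`). -/
def ZlCompositum : IntermediateField K Ω :=
  sSup {L : IntermediateField K Ω | IsZlExtension ℓ L}

/-- The Kummer extension `K_∞[x^{1/ℓ^k}]` of `K_∞` inside `Ω`, for `x ∈ K_∞ˣ`, seen as an
extension of `K`. -/
def kummerExt (k : ℕ) (x : (Kinf ℓ K Ω)ˣ) : IntermediateField K Ω :=
  (IntermediateField.adjoin (Kinf ℓ K Ω)
    {y : Ω | y ^ ℓ ^ k = algebraMap (Kinf ℓ K Ω) Ω x}).restrictScalars K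

/-- The Kummer radical `Rad(L/K_∞) = {ℓ^{-k} ⊗ x : x ∈ K_∞ˣ, K_∞[x^{1/ℓ^k}] ⊂ L}`,
a subset of the universal radical of `K_∞`. -/
def kummerRadical (L : IntermediateField K Ω) : Set (Radical ℓ (Kinf ℓ K Ω)) :=
  {r | ∃ (k : ℕ) (x : (Kinf ℓ K Ω)ˣ), r = radMk ℓ k x ∧ kummerExt ℓ K Ω k x ≤ L}

/-- The homomorphism `Kˣ → K_∞ˣ`. -/
def unitsToKinf : Kˣ →* (Kinf ℓ K Ω)ˣ :=
  Units.map (algebraMap K (Kinf ℓ K Ω) : K →* Kinf ℓ K Ω)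

/-- The homomorphism `Kˣ → K_0ˣ`. -/
def unitsToLayerZero : Kˣ →* (layer ℓ m K Ω 0)ˣ :=
  Units.map (algebraMap K (layer ℓ m K Ω 0) : K →* layer ℓ m K Ω 0)

/-- The initial radical attached to the compositum `Z` of the `ℤ_ℓ`-extensions of `K`:
`{ℓ^{-m} ⊗ x : x ∈ Kˣ, K_∞[x^{1/ℓ^m}] ⊂ Z}`, a subset of the universal radical of `K`. -/
def initialRadical : Set (Radical ℓ K) :=
  {r | ∃ x : Kˣ, r = radMk ℓ m x ∧
    kummerExt ℓ K Ω m (unitsToKinf ℓ K Ω x) ≤ ZlCompositum ℓ K Ω}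

/-- The compositum of the extensions `L K_∞` of `K_∞`, where `L` runs through the cyclic extensions
of `K` of exponent dividing `ℓ^m` which are contained in some `ℤ_ℓ`-extension of `K`. -/
def embeddableCompositum : IntermediateField K Ω :=
  sSup {M : IntermediateField K Ω | ∃ L : IntermediateField K Ω,
    IsGalois K L ∧ IsCyclic (L ≃ₐ[K] L) ∧ Monoid.exponent (L ≃ₐ[K] L) ∣ ℓ ^ m ∧
    (∃ L' : IntermediateField K Ω, IsZlExtension ℓ L' ∧ L ≤ L') ∧ M = L ⊔ Kinf ℓ K Ω}

end Extensions

end RadZ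

end

/-!
The theorem is Kummer theory over `K_∞`, dualized by characters of the absolute Galois group
`G = Gal(Ω/K)` with values in `ℚ_ℓ/ℤ_ℓ`. Fix a homomorphism `L` from `Ωˣ` to `ℚ_ℓ/ℤ_ℓ` that is
injective on the roots of unity of `ℓ`-power order (`exists_logarithm`), and lift `γ` to `g ∈ G`. An
element `ℓ^{-k} ⊗ x` of the radical of `K_∞` is determined by its Kummer character
`σ ↦ L (σ t / t)`, where `t^(ℓ^k) = x`, on `H = Gal(Ω/K_∞)` (`IsLogarithm.radMk_eq`). It is
invariant under `Γ*` exactly if this character is invariant under conjugation by `g`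
(`CyclotomicGenerator.galInf_radMk`), and then the character extends to `G`, as `G/H` is procyclic
and `ℚ_ℓ/ℤ_ℓ` is divisible (`CyclotomicGenerator.exists_isKummerCharacter`). If `x ∈ K` and `k = m`,
the formula defines a character of `G` itself. On the other side, `ℤ_ℓ`-extensions of `K` are the
fixed fields of the kernels of nonzero continuous homomorphisms `ρ : G → ℤ_ℓ`
(`IsZlExtension.exists_hom`, `exists_isZlExtension`). A compactness argument and the freeness of
finitely generated torsion-free `ℤ_ℓ`-modules show that a root of `x ∈ K` of degree `ℓ^m` lies in
the compositum `Z` if and only if its Kummer character is the reduction of such a `ρ`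
(`exists_padicInt_lift`); it then lies in a single `ℤ_ℓ`-extension.

For (i), this says that the roots in question generate cyclic extensions of `K` that embed into
`ℤ_ℓ`-extensions. Conversely, these cyclic extensions are generated by roots of elements of `K`,
because `K` contains the `ℓ^m`-th roots of unity; so an element of the Kummer radical of their
compositum has a Kummer character that is a combination of finitely many of theirs
(`CyclotomicGenerator.exists_mem_ZlCompositum`).

For (ii), the radical of `K_n` embeds into that of `K_∞`
(`CyclotomicGenerator.radMap_layerUnits_injective`), and on the invariants of `Γ*` the norm of
`K_{n+1}/K_n` becomes multiplication by `∑ (1+ℓ^m)^(ℓ^n i)`, `i < ℓ`, an `ℓ`-adic unit times `ℓ`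
(`CyclotomicGenerator.radMap_layerUnits_normMap`, `exists_theta_eq`). Up to rescaling by units, a
norm-compatible system is therefore a sequence of successive divisions by `ℓ` among the invariants.
Given `ρ` lifting the character of `x`, Hilbert's Theorem 90 over `K_n` yields such a sequence from
the reductions of `ρ` modulo `ℓ^(m+n)` (`IsLogarithm.exists_kummer_generator`). Given the sequence,
extensions of the Kummer characters to `G` can be chosen compatibly, since characters of
`G/H ≅ ℤ_ℓ` are divisible by `ℓ` (`CyclotomicGenerator.exists_division`), and their limit is `ρ`
(`exists_padicInt_of_compatible`).
-/

open scoped TensorProduct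

noncomputable section

namespace RadZ

/-! ### The group `ℚ_ℓ / ℤ_ℓ` and the universal radical -/

section QmodZ

variable (ℓ : ℕ) [Fact ℓ.Prime]

/-- The class of `ℓ^{-k}` in `ℚ_ℓ / ℤ_ℓ`. -/
def frac (k : ℕ) : QmodZ ℓ := Submodule.Quotient.mk (((ℓ : ℚ_[ℓ]) ^ k)⁻¹)

variable {ℓ}

theorem prime_cast_ne_zero : (ℓ : ℚ_[ℓ]) ≠ 0 :=
  Nat.cast_ne_zero.2 (Fact.out : ℓ.Prime).ne_zero

theorem smul_frac (a : ℤ_[ℓ]) (k : ℕ) :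
    a • frac ℓ k = Submodule.Quotient.mk ((a : ℚ_[ℓ]) * ((ℓ : ℚ_[ℓ]) ^ k)⁻¹) := by
  rw [frac, ← Submodule.Quotient.mk_smul]
  rfl

theorem smul_frac_eq_zero_iff (a : ℤ_[ℓ]) (k : ℕ) :
    a • frac ℓ k = 0 ↔ (ℓ : ℤ_[ℓ]) ^ k ∣ a := by
  have hne : (ℓ : ℚ_[ℓ]) ^ k ≠ 0 := pow_ne_zero _ prime_cast_ne_zero
  rw [smul_frac, Submodule.Quotient.mk_eq_zero]
  constructor
  · rintro ⟨b, hb⟩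
    refine ⟨b, ?_⟩
    have : (a : ℚ_[ℓ]) = (ℓ : ℚ_[ℓ]) ^ k * b := by
      change (b : ℚ_[ℓ]) = _ at hb
      rw [hb]; field_simp
    exact Subtype.ext (by push_cast; exact this)
  · rintro ⟨b, rfl⟩
    refine ⟨b, ?_⟩
    change (b : ℚ_[ℓ]) = _
    push_cast
    field_simp

theorem pow_smul_frac_add (j k : ℕ) : (ℓ : ℤ_[ℓ]) ^ j • frac ℓ (j + k) = frac ℓ k := by
  have hne : (ℓ : ℚ_[ℓ]) ≠ 0 := prime_cast_ne_zero
  rw [smul_frac, frac]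
  congr 1
  push_cast
  field_simp
  ring

theorem smul_frac_succ (k : ℕ) : (ℓ : ℤ_[ℓ]) • frac ℓ (k + 1) = frac ℓ k := by
  have := pow_smul_frac_add (ℓ := ℓ) 1 k
  rwa [pow_one, add_comm] at this

theorem pow_smul_frac_self (k : ℕ) : (ℓ : ℤ_[ℓ]) ^ k • frac ℓ k = 0 :=
  (smul_frac_eq_zero_iff _ _).2 dvd_rfl

/-- Every element of `ℚ_ℓ / ℤ_ℓ` is a multiple of some `ℓ^{-k}`, with `k` as large as wanted. -/
theorem exists_eq_smul_frac (c : QmodZ ℓ) : ∃ K : ℕ, ∀ k ≥ K, ∃ a : ℤ_[ℓ], c = a • frac ℓ k := by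
  obtain ⟨q, rfl⟩ := Submodule.Quotient.mk_surjective _ c
  have hne : (ℓ : ℚ_[ℓ]) ≠ 0 := prime_cast_ne_zero
  obtain ⟨K, hK⟩ : ∃ K : ℕ, ‖q‖ ≤ (ℓ : ℝ) ^ K :=
    ((tendsto_pow_atTop_atTop_of_one_lt
      (by exact_mod_cast (Fact.out : ℓ.Prime).one_lt)).eventually_ge_atTop ‖q‖).exists
  refine ⟨K, fun k hk => ?_⟩
  have hint : ‖q * (ℓ : ℚ_[ℓ]) ^ k‖ ≤ 1 := by
    rw [norm_mul, norm_pow, Padic.norm_p, inv_pow]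
    have h0 : (0 : ℝ) < (ℓ : ℝ) ^ k := pow_pos (by exact_mod_cast (Fact.out : ℓ.Prime).pos) _
    rw [← div_eq_mul_inv, div_le_one h0]
    exact hK.trans (pow_le_pow_right₀
      (by exact_mod_cast (Fact.out : ℓ.Prime).one_lt.le) hk)
  obtain ⟨a, ha⟩ : ∃ a : ℤ_[ℓ], (a : ℚ_[ℓ]) = q * (ℓ : ℚ_[ℓ]) ^ k := ⟨⟨_, hint⟩, rfl⟩
  refine ⟨a, ?_⟩
  rw [smul_frac, ha]
  congr 1
  field_simp

theorem exists_nat_dvd_sub (a : ℤ_[ℓ]) (k : ℕ) : ∃ n : ℕ, (ℓ : ℤ_[ℓ]) ^ k ∣ a - n := by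
  refine ⟨a.appr k, ?_⟩
  have := PadicInt.appr_spec k a
  rwa [Ideal.mem_span_singleton] at this

theorem exists_eq_nsmul_frac (c : QmodZ ℓ) : ∃ K : ℕ, ∀ k ≥ K, ∃ n : ℕ, c = n • frac ℓ k := by
  obtain ⟨K, hK⟩ := exists_eq_smul_frac c
  refine ⟨K, fun k hk => ?_⟩
  obtain ⟨a, ha⟩ := hK k hk
  obtain ⟨n, hn⟩ := exists_nat_dvd_sub a k
  refine ⟨n, ?_⟩
  rw [ha, ← Nat.cast_smul_eq_nsmul ℤ_[ℓ], ← sub_eq_zero, ← sub_smul]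
  exact (smul_frac_eq_zero_iff _ _).2 hn

/-- The `ℓ^k`-torsion of `ℚ_ℓ / ℤ_ℓ` is cyclic, generated by `ℓ^{-k}`. -/
theorem exists_smul_frac_of_pow_smul_eq_zero {c : QmodZ ℓ} {k : ℕ}
    (h : (ℓ : ℤ_[ℓ]) ^ k • c = 0) : ∃ n : ℕ, c = n • frac ℓ k := by
  obtain ⟨K, hK⟩ := exists_eq_smul_frac c
  obtain ⟨a, ha⟩ := hK (K + k) (by omega)
  rw [ha, smul_smul, smul_frac_eq_zero_iff, pow_add, mul_comm,
    mul_dvd_mul_iff_left (pow_ne_zero _ (Nat.cast_ne_zero.2 (Fact.out : ℓ.Prime).ne_zero))] at h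
  obtain ⟨b, rfl⟩ := h
  obtain ⟨n, hn⟩ := exists_nat_dvd_sub b k
  refine ⟨n, ?_⟩
  rw [ha, mul_comm, mul_smul, pow_smul_frac_add, ← Nat.cast_smul_eq_nsmul ℤ_[ℓ], ← sub_eq_zero,
    ← sub_smul]
  exact (smul_frac_eq_zero_iff _ _).2 hn

/-- `ℚ_ℓ / ℤ_ℓ` is divisible. -/
theorem QmodZ.exists_nsmul_eq (n : ℕ) (hn : n ≠ 0) (c : QmodZ ℓ) : ∃ e : QmodZ ℓ, n • e = c := by
  obtain ⟨q, rfl⟩ := Submodule.Quotient.mk_surjective _ c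
  refine ⟨Submodule.Quotient.mk (q / n), ?_⟩
  rw [← Submodule.Quotient.mk_smul]
  congr 1
  rw [nsmul_eq_mul]
  have : (n : ℚ_[ℓ]) ≠ 0 := Nat.cast_ne_zero.2 hn
  field_simp

instance : DivisibleBy (QmodZ ℓ) ℤ :=
  divisibleByOfSMulRightSurj _ _ fun {n} hn c => by
    obtain ⟨e, he⟩ := QmodZ.exists_nsmul_eq n.natAbs (by simpa using hn) c
    rcases Int.natAbs_eq n with h | h
    · exact ⟨e, by beta_reduce; rw [h, natCast_zsmul, he]⟩
    · exact ⟨-e, by beta_reduce; rw [h, neg_smul, smul_neg, neg_neg, natCast_zsmul, he]⟩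

/-- Homomorphisms to `ℚ_ℓ / ℤ_ℓ` extend from subgroups, as `ℚ_ℓ / ℤ_ℓ` is divisible. -/
theorem QmodZ.exists_extension {A B : Type*} [AddCommGroup A] [AddCommGroup B] (f : A →+ B)
    (hf : Function.Injective f) (g : A →+ QmodZ ℓ) : ∃ h : B →+ QmodZ ℓ, ∀ a, h (f a) = g a := by
  obtain ⟨h, hh⟩ := (Module.Baer.of_divisible (QmodZ ℓ)).extension_property_addMonoidHom f hf g
  exact ⟨h, fun a => DFunLike.congr_fun hh a⟩

theorem eq_of_forall_smul_frac_eq {a b : ℤ_[ℓ]} (m : ℕ)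
    (h : ∀ n, a • frac ℓ (m + n) = b • frac ℓ (m + n)) : a = b := by
  have h' : ∀ n : ℕ, ‖a - b‖ ≤ (ℓ : ℝ) ^ (-(n : ℤ)) := by
    intro n
    rw [PadicInt.norm_le_pow_iff_mem_span_pow, Ideal.mem_span_singleton]
    refine (pow_dvd_pow _ (Nat.le_add_left n m)).trans ((smul_frac_eq_zero_iff _ _).1 ?_)
    rw [sub_smul, h, sub_self]
  have h0 : ‖a - b‖ ≤ 0 := by
    refine ge_of_tendsto' (x := Filter.atTop) (f := fun n : ℕ => (ℓ : ℝ) ^ (-(n : ℤ))) ?_ h'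
    simp only [zpow_neg, zpow_natCast, ← inv_pow]
    exact tendsto_pow_atTop_nhds_zero_of_lt_one (by positivity)
      (inv_lt_one_of_one_lt₀ (by exact_mod_cast (Fact.out : ℓ.Prime).one_lt))
  exact sub_eq_zero.1 (norm_le_zero_iff.1 h0)

/-- The Tate module of `ℚ_ℓ / ℤ_ℓ` is `ℤ_ℓ`: a sequence of compatible `ℓ`-divisions, beginning
in the `ℓ^m`-torsion, is given by an `ℓ`-adic integer. -/
theorem exists_padicInt_of_compatible (m : ℕ) (c : ℕ → QmodZ ℓ)
    (h0 : (ℓ : ℤ_[ℓ]) ^ m • c 0 = 0) (hc : ∀ n, (ℓ : ℤ_[ℓ]) • c (n + 1) = c n) :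
    ∃ a : ℤ_[ℓ], ∀ n, c n = a • frac ℓ (m + n) := by
  have htors : ∀ n, (ℓ : ℤ_[ℓ]) ^ (m + n) • c n = 0 := by
    intro n
    induction n with
    | zero => exact h0
    | succ n ih => rw [← add_assoc, pow_succ, mul_smul, hc, ih]
  choose a ha using fun n => exists_smul_frac_of_pow_smul_eq_zero (htors n)
  have hstep : ∀ n, (ℓ : ℤ_[ℓ]) ^ (m + n) ∣ (a (n + 1) : ℤ_[ℓ]) - a n := by
    intro n
    rw [← smul_frac_eq_zero_iff, sub_smul, Nat.cast_smul_eq_nsmul, Nat.cast_smul_eq_nsmul, ← ha,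
      ← hc n, ha (n + 1), ← add_assoc, smul_comm, smul_frac_succ, sub_self]
  have hdvd : ∀ n k, (ℓ : ℤ_[ℓ]) ^ (m + n) ∣ (a (n + k) : ℤ_[ℓ]) - a n := by
    intro n k
    induction k with
    | zero => simp
    | succ k ih =>
      have := dvd_add ((pow_dvd_pow _ (by omega : m + n ≤ m + (n + k))).trans (hstep (n + k))) ih
      simpa [add_assoc] using this
  have hcauchy : ∀ {i j : ℕ}, i ≤ j →
      (a i : ℤ_[ℓ]) ≡ a j [SMOD (Ideal.span {(ℓ : ℤ_[ℓ])} ^ i • ⊤ : Submodule ℤ_[ℓ] ℤ_[ℓ])] := by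
    intro i j hij
    obtain ⟨k, rfl⟩ := Nat.exists_eq_add_of_le hij
    rw [SModEq.comm, SModEq.sub_mem, smul_eq_mul, Ideal.mul_top, Ideal.span_singleton_pow,
      Ideal.mem_span_singleton]
    exact (pow_dvd_pow _ (by omega)).trans (hdvd i k)
  have hcomplete : IsPrecomplete (Ideal.span {(ℓ : ℤ_[ℓ])}) ℤ_[ℓ] := by
    rw [← PadicInt.maximalIdeal_eq_span_p]; infer_instance
  obtain ⟨L, hL⟩ := hcomplete.prec hcauchy
  refine ⟨L, fun n => ?_⟩
  have h1 := (hL (m + n)).symm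
  rw [SModEq.sub_mem, smul_eq_mul, Ideal.mul_top, Ideal.span_singleton_pow,
    Ideal.mem_span_singleton] at h1
  have h2 := hdvd n m
  rw [add_comm n m] at h2
  have h3 := dvd_add h1 h2
  rw [sub_add_sub_cancel] at h3
  rw [ha n, ← Nat.cast_smul_eq_nsmul ℤ_[ℓ], eq_comm, ← sub_eq_zero, ← sub_smul]
  exact (smul_frac_eq_zero_iff _ _).2 h3

end QmodZ

section Radical

variable {ℓ : ℕ} [Fact ℓ.Prime]

theorem radMk_eq {F : Type*} [Field F] (k : ℕ) (x : Fˣ) :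
    radMk ℓ k x = frac ℓ k ⊗ₜ[ℤ] Additive.ofMul x := rfl

variable {F E : Type*} [Field F] [Field E]

theorem radMap_radMk (f : Fˣ →* Eˣ) (k : ℕ) (x : Fˣ) :
    radMap ℓ f (radMk ℓ k x) = radMk ℓ k (f x) := rfl

theorem radMk_mul (k : ℕ) (x y : Fˣ) : radMk ℓ k (x * y) = radMk ℓ k x + radMk ℓ k y := by
  rw [radMk_eq, ofMul_mul, TensorProduct.tmul_add]; rfl

theorem radMk_one (k : ℕ) : radMk ℓ k (1 : Fˣ) = 0 := by
  rw [radMk_eq, ofMul_one, TensorProduct.tmul_zero]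

theorem radMk_pow (k n : ℕ) (x : Fˣ) : radMk ℓ k (x ^ n) = n • radMk ℓ k x := by
  induction n with
  | zero => simp [radMk_one]
  | succ n ih => rw [pow_succ, radMk_mul, ih, succ_nsmul]

theorem radMk_inv (k : ℕ) (x : Fˣ) : radMk ℓ k x⁻¹ = - radMk ℓ k x := by
  rw [eq_neg_iff_add_eq_zero, ← radMk_mul, inv_mul_cancel, radMk_one]

theorem radMk_div (k : ℕ) (x y : Fˣ) : radMk ℓ k (x / y) = radMk ℓ k x - radMk ℓ k y := by
  rw [div_eq_mul_inv, radMk_mul, radMk_inv, sub_eq_add_neg]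

theorem smul_radMk (a : ℤ_[ℓ]) (k : ℕ) (x : Fˣ) :
    a • radMk ℓ k x = (a • frac ℓ k) ⊗ₜ[ℤ] Additive.ofMul x := rfl

theorem pow_smul_radMk_add (j k : ℕ) (x : Fˣ) :
    (ℓ : ℤ_[ℓ]) ^ j • radMk ℓ (j + k) x = radMk ℓ k x := by
  rw [smul_radMk, pow_smul_frac_add]; rfl

theorem pow_smul_radMk (k : ℕ) (x : Fˣ) : (ℓ : ℤ_[ℓ]) ^ k • radMk ℓ k x = 0 := by
  rw [smul_radMk, pow_smul_frac_self, TensorProduct.zero_tmul]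

theorem radMk_add_pow (j k : ℕ) (x : Fˣ) : radMk ℓ (j + k) (x ^ ℓ ^ j) = radMk ℓ k x := by
  rw [radMk_pow, ← Nat.cast_smul_eq_nsmul ℤ_[ℓ], Nat.cast_pow, pow_smul_radMk_add]

theorem radMk_pow_self (k : ℕ) (x : Fˣ) : radMk ℓ k (x ^ ℓ ^ k) = 0 := by
  rw [radMk_pow, ← Nat.cast_smul_eq_nsmul ℤ_[ℓ], Nat.cast_pow, pow_smul_radMk]

theorem radMk_eq_zero_of_pow_eq_one (k : ℕ) {j : ℕ} {x : Fˣ} (hx : x ^ ℓ ^ j = 1) :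
    radMk ℓ k x = 0 := by
  rw [← radMk_add_pow j, hx, radMk_one]

theorem tmul_ofMul_pow {M : Type*} [AddCommGroup M] (c : M) (x : Fˣ) (n : ℕ) :
    c ⊗ₜ[ℤ] Additive.ofMul (x ^ n) = (n • c) ⊗ₜ[ℤ] Additive.ofMul x := by
  induction n with
  | zero => rw [pow_zero, ofMul_one, TensorProduct.tmul_zero, zero_smul, TensorProduct.zero_tmul]
  | succ n ih => rw [pow_succ, ofMul_mul, TensorProduct.tmul_add, ih, succ_nsmul,
      TensorProduct.add_tmul]

/-- Every element of the universal radical is a single `ℓ^{-k} ⊗ x`, with `k` as large as wanted. -/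
theorem exists_eq_radMk (r : Radical ℓ F) : ∃ N : ℕ, ∀ k ≥ N, ∃ x : Fˣ, r = radMk ℓ k x := by
  induction r using TensorProduct.induction_on with
  | zero => exact ⟨0, fun k _ => ⟨1, (radMk_one k).symm⟩⟩
  | tmul c x =>
    obtain ⟨N, hN⟩ := exists_eq_nsmul_frac c
    refine ⟨N, fun k hk => ?_⟩
    obtain ⟨n, rfl⟩ := hN k hk
    refine ⟨x.toMul ^ n, ?_⟩
    rw [radMk_pow, radMk_eq, ofMul_toMul, TensorProduct.smul_tmul']
  | add r s hr hs =>
    obtain ⟨N, hN⟩ := hr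
    obtain ⟨M, hM⟩ := hs
    refine ⟨max N M, fun k hk => ?_⟩
    obtain ⟨x, rfl⟩ := hN k (le_trans (le_max_left _ _) hk)
    obtain ⟨y, rfl⟩ := hM k (le_trans (le_max_right _ _) hk)
    exact ⟨x * y, (radMk_mul k x y).symm⟩

/-- `ℓ^{-k} ⊗ x` vanishes only if `x` is, up to a root of unity of `ℓ`-power order, an
`ℓ^k`-th power. -/
theorem exists_pow_eq_of_radMk_eq_zero {k : ℕ} {x : Fˣ} (h : radMk ℓ k x = 0) :
    ∃ (j : ℕ) (z : Fˣ), x ^ ℓ ^ j = (z ^ ℓ ^ k) ^ ℓ ^ j := by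
  have hmem : frac ℓ k ∈ Submodule.span ℤ {frac ℓ k} := Submodule.mem_span_singleton_self _
  obtain ⟨Q, hPQ, hQ, h0⟩ := TensorProduct.eq_zero_of_fg_of_subtype_eq_zero
    (R := ℤ) (N := Additive Fˣ) (Submodule.fg_span_singleton (frac ℓ k))
    (t := (⟨frac ℓ k, hmem⟩ : Submodule.span ℤ {frac ℓ k}) ⊗ₜ[ℤ] Additive.ofMul x) h
  obtain ⟨j, hj⟩ : ∃ j, Q ≤ Submodule.span ℤ {frac ℓ (j + k)} := by
    obtain ⟨s, rfl⟩ := hQ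
    choose N hN using fun c : QmodZ ℓ => exists_eq_nsmul_frac c
    refine ⟨s.sup N, Submodule.span_le.2 fun c hc => ?_⟩
    obtain ⟨n, hn⟩ := hN c (s.sup N + k) ((Finset.le_sup (f := N) hc).trans (Nat.le_add_right _ _))
    rw [hn]
    exact Submodule.smul_of_tower_mem _ n (Submodule.mem_span_singleton_self _)
  have hmem' : frac ℓ (j + k) ∈ Submodule.span ℤ {frac ℓ (j + k)} :=
    Submodule.mem_span_singleton_self _
  have hfk : ℓ ^ j • frac ℓ (j + k) = frac ℓ k := by
    rw [← Nat.cast_smul_eq_nsmul ℤ_[ℓ], Nat.cast_pow, pow_smul_frac_add]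
  have h1 : (⟨frac ℓ (j + k), hmem'⟩ : Submodule.span ℤ {frac ℓ (j + k)}) ⊗ₜ[ℤ]
      Additive.ofMul (x ^ ℓ ^ j) = 0 := by
    have h2 := congrArg (LinearMap.rTensor (Additive Fˣ) (Submodule.inclusion hj)) h0
    rw [LinearMap.rTensor_tmul, LinearMap.rTensor_tmul, map_zero] at h2
    rw [tmul_ofMul_pow, ← h2]
    congr 1
    exact Subtype.ext hfk
  obtain ⟨r, a, y, hay, ham⟩ := TensorProduct.vanishesTrivially_of_sum_tmul_eq_zero (R := ℤ)
    (ι := Unit) (m := fun _ => (⟨frac ℓ (j + k), hmem'⟩ : Submodule.span ℤ {frac ℓ (j + k)}))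
    (n := fun _ => Additive.ofMul (x ^ ℓ ^ j)) (by
      rw [Set.range_const, eq_top_iff]
      rintro ⟨c, hc⟩ -
      obtain ⟨n, rfl⟩ := Submodule.mem_span_singleton.1 hc
      exact Submodule.mem_span_singleton.2 ⟨n, rfl⟩) (by
        rw [Fintype.sum_unique]; exact h1)
  have hdvd : ∀ i, ∃ b : ℤ, a () i = (ℓ : ℤ) ^ (j + k) * b := by
    intro i
    have h3 := ham i
    rw [Fintype.sum_unique] at h3
    have h4 : a () i • frac ℓ (j + k) = 0 := congrArg Subtype.val h3
    rw [← Int.cast_smul_eq_zsmul ℤ_[ℓ], smul_frac_eq_zero_iff] at h4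
    exact (PadicInt.pow_p_dvd_int_iff (p := ℓ) (j + k) (a () i)).1 (by exact_mod_cast h4)
  choose b hb using hdvd
  refine ⟨j, (∑ i, b i • y i).toMul, ?_⟩
  have h5 := hay ()
  simp only [hb] at h5
  apply Additive.ofMul.injective
  rw [← pow_mul, ← pow_add, add_comm k j, h5]
  refine (Finset.sum_congr rfl fun i _ => ?_).trans (Finset.sum_nsmul _ (ℓ ^ (j + k)) _)
  rw [mul_smul, ← natCast_zsmul, Nat.cast_pow]

end Radical

/-! ### Powers of `1 + ℓ^m` and logarithms of roots of unity -/

section Arithmetic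

variable {ℓ : ℕ} [Fact ℓ.Prime] {m : ℕ}

/-- Lifting the exponent: the valuation of `(1 + ℓ^m)^i - 1` is `m` plus the valuation of `i`. The
condition `m ≥ 2` for `ℓ = 2` is needed: `(1 + 2)^2 - 1 = 8`. -/
theorem pow_dvd_one_add_pow_sub_one_iff (hm : 0 < m) (hm2 : ℓ = 2 → 2 ≤ m) (n i : ℕ) :
    (ℓ : ℤ) ^ (m + n) ∣ (1 + (ℓ : ℤ) ^ m) ^ i - 1 ↔ ℓ ^ n ∣ i := by
  have hℓ : ℓ.Prime := Fact.out
  have hdvd : (ℓ : ℤ) ∣ (ℓ : ℤ) ^ m := dvd_pow_self _ hm.ne'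
  have hx : ¬ (ℓ : ℤ) ∣ 1 + (ℓ : ℤ) ^ m := by
    rw [dvd_add_left hdvd]
    intro h
    exact hℓ.one_lt.ne' (by exact_mod_cast Int.eq_one_of_dvd_one (by positivity) h)
  have hsub : (1 + (ℓ : ℤ) ^ m) - 1 = (ℓ : ℤ) ^ m := by ring
  have hself : emultiplicity (ℓ : ℤ) ((ℓ : ℤ) ^ m) = m :=
    emultiplicity_pow_self_of_prime (Nat.prime_iff_prime_int.1 hℓ) m
  have key : emultiplicity (ℓ : ℤ) ((1 + (ℓ : ℤ) ^ m) ^ i - 1) = m + emultiplicity ℓ i := by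
    rcases hℓ.eq_two_or_odd' with h2 | hodd
    · have h4 : (4 : ℤ) ∣ (1 + (ℓ : ℤ) ^ m) - 1 := by
        rw [hsub, h2]
        exact pow_dvd_pow 2 (hm2 h2)
      subst h2
      have := Int.two_pow_sub_pow' i h4 hx
      rw [one_pow, hsub] at this
      rw [Nat.cast_ofNat] at this hself ⊢
      rw [this, hself, ← Int.natCast_emultiplicity]
      rfl
    · have := Int.emultiplicity_pow_sub_pow hℓ hodd (x := 1 + (ℓ : ℤ) ^ m) (y := 1)
        (by rw [hsub]; exact hdvd) hx i
      rw [one_pow, hsub, hself] at this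
      exact this
  rw [pow_dvd_iff_le_emultiplicity, key, pow_dvd_iff_le_emultiplicity, Nat.cast_add,
    ENat.add_le_add_iff_left (ENat.natCast_ne_top m)]

theorem exists_one_add_pow_eq {R : Type*} [CommRing R] (t : R) (c : ℕ) :
    ∃ s, (1 + t) ^ c = 1 + c * t + t ^ 2 * s := by
  induction c with
  | zero => exact ⟨0, by simp⟩
  | succ c ih =>
    obtain ⟨s, hs⟩ := ih
    exact ⟨c + s + t * s, by rw [pow_succ, hs]; push_cast; ring⟩

theorem exists_one_add_pow_prime_pow (hm : 0 < m) (hm2 : ℓ = 2 → 2 ≤ m) (n : ℕ) :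
    ∃ u : ℤ, (1 + (ℓ : ℤ) ^ m) ^ ℓ ^ n = 1 + (ℓ : ℤ) ^ (m + n) * u ∧ ¬ (ℓ : ℤ) ∣ u := by
  obtain ⟨u, hu⟩ := (pow_dvd_one_add_pow_sub_one_iff hm hm2 n (ℓ ^ n)).2 dvd_rfl
  refine ⟨u, by rw [← hu]; ring, ?_⟩
  rintro ⟨v, rfl⟩
  have := (pow_dvd_one_add_pow_sub_one_iff hm hm2 (n + 1) (ℓ ^ n)).1
    ⟨v, by rw [hu]; ring⟩
  exact absurd ((Nat.pow_dvd_pow_iff_le_right (Fact.out : ℓ.Prime).one_lt).1 this) (by omega)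

/-- Modulo `ℓ^(m+n)`, the powers of `1 + ℓ^m` are the classes that are `1` modulo `ℓ^m`. -/
theorem exists_pow_dvd_sub_one_add_pow (hm : 0 < m) (hm2 : ℓ = 2 → 2 ≤ m) (n : ℕ) (a : ℤ)
    (ha : (ℓ : ℤ) ^ m ∣ a - 1) : ∃ i : ℕ, (ℓ : ℤ) ^ (m + n) ∣ a - (1 + (ℓ : ℤ) ^ m) ^ i := by
  have hℓ : ℓ.Prime := Fact.out
  induction n with
  | zero => exact ⟨0, by simpa using ha⟩
  | succ n ih =>
    obtain ⟨i, b, hb⟩ := ih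
    obtain ⟨u, hu, hu'⟩ := exists_one_add_pow_prime_pow hm hm2 n
    have hcop : IsCoprime (ℓ : ℤ) u :=
      ((Nat.prime_iff_prime_int.1 hℓ).coprime_iff_not_dvd).2 hu'
    obtain ⟨s, t, hst⟩ := hcop
    -- the exponent `i + ℓ^n c` is right as soon as `c u ≡ b` modulo `ℓ`
    obtain ⟨c, hc⟩ : ∃ c : ℕ, (ℓ : ℤ) ∣ b - c * u := by
      refine ⟨(b * t % ℓ).toNat, ?_⟩
      rw [Int.toNat_of_nonneg (Int.emod_nonneg _ (by exact_mod_cast hℓ.ne_zero)), Int.emod_def]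
      exact ⟨b * s + u * (b * t / ℓ), by linear_combination (-b) * hst⟩
    obtain ⟨r, hr⟩ := exists_one_add_pow_eq ((ℓ : ℤ) ^ (m + n) * u) c
    obtain ⟨w, hw⟩ : (ℓ : ℤ) ∣ (1 + (ℓ : ℤ) ^ m) ^ i - 1 := by
      have := sub_dvd_pow_sub_pow (1 + (ℓ : ℤ) ^ m) 1 i
      rw [one_pow, add_sub_cancel_left] at this
      exact (dvd_pow_self _ hm.ne').trans this
    obtain ⟨d, hd⟩ := hc
    obtain ⟨k, hk⟩ : ∃ k, m + n = k + 1 := ⟨m + n - 1, by omega⟩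
    refine ⟨i + ℓ ^ n * c, ?_⟩
    have hexp : (1 + (ℓ : ℤ) ^ m) ^ (i + ℓ ^ n * c) = (1 + (ℓ : ℤ) ^ m) ^ i *
        (1 + c * ((ℓ : ℤ) ^ (m + n) * u) + ((ℓ : ℤ) ^ (m + n) * u) ^ 2 * r) := by
      rw [pow_add, pow_mul, hu, hr]
    rw [hexp, ← add_assoc, pow_succ _ (m + n)]
    refine ⟨d - w * c * u - (1 + (ℓ : ℤ) ^ m) ^ i * ((ℓ : ℤ) ^ k * u ^ 2 * r), ?_⟩
    have hk' : (ℓ : ℤ) ^ (m + n) = (ℓ : ℤ) ^ k * ℓ := by rw [hk, pow_succ]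
    rw [hk'] at hb ⊢
    generalize (1 + (ℓ : ℤ) ^ m) ^ i = B at *
    linear_combination hb + ((ℓ : ℤ) ^ k * ℓ) * hd - ((ℓ : ℤ) ^ k * ℓ * c * u) * hw

theorem isUnit_intCast_of_not_dvd {u : ℤ} (hu : ¬ (ℓ : ℤ) ∣ u) : IsUnit (u : ℤ_[ℓ]) := by
  rw [PadicInt.isUnit_iff]
  refine le_antisymm (PadicInt.norm_le_one _) (not_lt.1 fun h => hu ?_)
  exact (PadicInt.norm_int_lt_one_iff_dvd u).1 h

/-- The integer `∑ (1 + ℓ^m)^(ℓ^n i)`, for `i < ℓ`, by which the norm of `K_{n+1}/K_n` acts on the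
invariants of `Γ*`. -/
def theta (ℓ m n : ℕ) : ℕ := ∑ i ∈ Finset.range ℓ, (1 + ℓ ^ m) ^ (ℓ ^ n * i)

/-- `theta ℓ m n` is `((1 + ℓ^m)^(ℓ^(n+1)) - 1) / ((1 + ℓ^m)^(ℓ^n) - 1)`, which has `ℓ`-adic
valuation `1`. So the norm acts, up to a unit, as multiplication by `ℓ`. -/
theorem exists_theta_eq (hm : 0 < m) (hm2 : ℓ = 2 → 2 ≤ m) (n : ℕ) :
    ∃ ε : ℤ_[ℓ]ˣ, (theta ℓ m n : ℤ_[ℓ]) = ℓ * ε := by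
  obtain ⟨u, hu, hu'⟩ := exists_one_add_pow_prime_pow hm hm2 n
  obtain ⟨v, hv, hv'⟩ := exists_one_add_pow_prime_pow hm hm2 (n + 1)
  obtain ⟨a, ha⟩ := isUnit_intCast_of_not_dvd hu'
  obtain ⟨b, hb⟩ := isUnit_intCast_of_not_dvd hv'
  have hgeom := geom_sum_mul ((1 + (ℓ : ℤ) ^ m) ^ ℓ ^ n) ℓ
  have hθ : ((theta ℓ m n : ℕ) : ℤ) = ∑ i ∈ Finset.range ℓ, ((1 + (ℓ : ℤ) ^ m) ^ ℓ ^ n) ^ i := by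
    rw [theta]; push_cast; simp_rw [pow_mul]
  rw [← hθ, ← pow_mul, ← pow_succ, hu, hv, add_sub_cancel_left, add_sub_cancel_left] at hgeom
  have hmul : ((theta ℓ m n : ℕ) : ℤ) * u = ℓ * v := by
    have hne : (ℓ : ℤ) ^ (m + n) ≠ 0 :=
      pow_ne_zero _ (by exact_mod_cast (Fact.out : ℓ.Prime).ne_zero)
    apply mul_left_cancel₀ hne
    rw [← add_assoc, pow_succ] at hgeom
    linear_combination hgeom
  refine ⟨b * a⁻¹, ?_⟩
  have h' : ((theta ℓ m n : ℕ) : ℤ_[ℓ]) * a = ℓ * b := by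
    rw [ha, hb]; exact_mod_cast hmul
  rw [Units.val_mul, ← mul_assoc, ← h', mul_assoc, Units.mul_inv, mul_one]

end Arithmetic

section Logarithm

variable {ℓ : ℕ} [Fact ℓ.Prime] {Ω : Type*} [Field Ω]

/-- `L` is a logarithm on the roots of unity of `ℓ`-power order: a homomorphism to `ℚ_ℓ / ℤ_ℓ` that
is injective on them. It is defined on all of `Ωˣ`, where only its values at these roots of unity
matter. -/
def IsLogarithm (L : Additive Ωˣ →+ QmodZ ℓ) : Prop :=
  ∀ (n : ℕ) (ξ : Ωˣ), ξ ^ ℓ ^ n = 1 → L (.ofMul ξ) = 0 → ξ = 1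

/-- A homomorphism on the roots of unity of order dividing `ℓ` extends to `Ωˣ`, as `ℚ_ℓ / ℤ_ℓ` is
divisible, and is injective on `μ_{ℓ^∞}` if it is injective on `μ_ℓ`. -/
theorem exists_logarithm {ζ : Ω} (hζ : IsPrimitiveRoot ζ ℓ) :
    ∃ L : Additive Ωˣ →+ QmodZ ℓ, IsLogarithm L := by
  have hℓ : ℓ.Prime := Fact.out
  obtain ⟨z, rfl⟩ := hζ.isUnit hℓ.ne_zero
  have hz : IsPrimitiveRoot z ℓ := IsPrimitiveRoot.coe_units_iff.1 hζ
  have e1 : zmultiplesHom (Additive Ωˣ) (.ofMul z) (ℓ : ℤ) = 0 := by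
    rw [zmultiplesHom_apply, natCast_zsmul, ← ofMul_pow, hz.pow_eq_one, ofMul_one]
  have e2 : zmultiplesHom (QmodZ ℓ) (frac ℓ 1) (ℓ : ℤ) = 0 := by
    rw [zmultiplesHom_apply, natCast_zsmul, ← Nat.cast_smul_eq_nsmul ℤ_[ℓ], smul_frac_eq_zero_iff,
      pow_one]
  let f : ZMod ℓ →+ Additive Ωˣ := ZMod.lift ℓ ⟨_, e1⟩
  let g : ZMod ℓ →+ QmodZ ℓ := ZMod.lift ℓ ⟨_, e2⟩
  have hf : ∀ k : ℕ, f k = .ofMul (z ^ k) := fun k => by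
    have := ZMod.lift_coe ℓ ⟨_, e1⟩ (k : ℤ)
    rw [Int.cast_natCast] at this
    rw [this, zmultiplesHom_apply, natCast_zsmul, ofMul_pow]
  have hg : ∀ k : ℕ, g k = k • frac ℓ 1 := fun k => by
    have := ZMod.lift_coe ℓ ⟨_, e2⟩ (k : ℤ)
    rw [Int.cast_natCast] at this
    rw [this, zmultiplesHom_apply, natCast_zsmul]
  have hinj : Function.Injective f := by
    rw [injective_iff_map_eq_zero]
    intro a ha
    rw [← ZMod.natCast_zmod_val a, hf, ofMul_eq_zero, hz.pow_eq_one_iff_dvd] at ha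
    rw [← ZMod.natCast_zmod_val a, ZMod.natCast_eq_zero_iff]
    exact ha
  obtain ⟨L, hL⟩ := QmodZ.exists_extension f hinj g
  refine ⟨L, fun n => ?_⟩
  induction n with
  | zero => intro ξ h _; simpa using h
  | succ n ih =>
    intro ξ hξ h0
    have h1 : ξ ^ ℓ = 1 := by
      refine ih _ (by rw [← pow_mul, ← pow_succ', hξ]) ?_
      rw [ofMul_pow, map_nsmul, h0, smul_zero]
    obtain ⟨k, -, hk⟩ := hζ.eq_pow_of_pow_eq_one (ξ := (ξ : Ω))
      (by rw [← Units.val_pow_eq_pow_val, h1, Units.val_one])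
    obtain rfl : z ^ k = ξ := Units.ext (by exact_mod_cast hk)
    have h2 := hL (k : ZMod ℓ)
    rw [hf, hg, h0, ← Nat.cast_smul_eq_nsmul ℤ_[ℓ], eq_comm, smul_frac_eq_zero_iff, pow_one] at h2
    have h3 : ℓ ∣ k := by
      have := (PadicInt.pow_p_dvd_int_iff (p := ℓ) 1 (k : ℤ)).1 (by simpa using h2)
      exact_mod_cast (pow_one (ℓ : ℤ)) ▸ this
    exact (hz.pow_eq_one_iff_dvd k).2 h3

theorem nsmul_frac_eq_zero_iff (a k : ℕ) : a • frac ℓ k = 0 ↔ ℓ ^ k ∣ a := by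
  rw [← Nat.cast_smul_eq_nsmul ℤ_[ℓ], smul_frac_eq_zero_iff]
  have := PadicInt.pow_p_dvd_int_iff (p := ℓ) k (a : ℤ)
  rw [Int.cast_natCast] at this
  rw [this]
  exact_mod_cast Iff.rfl

/-- A logarithm maps the `ℓ^n`-th roots of unity onto the `ℓ^n`-torsion of `ℚ_ℓ / ℤ_ℓ`. -/
theorem IsLogarithm.exists_root_of_unity {L : Additive Ωˣ →+ QmodZ ℓ} (hL : IsLogarithm L)
    {n : ℕ} {ζ : Ω} (hζ : IsPrimitiveRoot ζ (ℓ ^ n)) {c : QmodZ ℓ}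
    (hc : (ℓ : ℤ_[ℓ]) ^ n • c = 0) : ∃ ξ : Ωˣ, ξ ^ ℓ ^ n = 1 ∧ L (.ofMul ξ) = c := by
  have hℓ : ℓ.Prime := Fact.out
  obtain ⟨z, rfl⟩ := hζ.isUnit (pow_ne_zero _ hℓ.ne_zero)
  have hz : IsPrimitiveRoot z (ℓ ^ n) := IsPrimitiveRoot.coe_units_iff.1 hζ
  have htors : (ℓ : ℤ_[ℓ]) ^ n • L (.ofMul z) = 0 := by
    rw [← Nat.cast_pow, Nat.cast_smul_eq_nsmul, ← map_nsmul, ← ofMul_pow, hz.pow_eq_one, ofMul_one,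
      map_zero]
  obtain ⟨a, ha⟩ := exists_smul_frac_of_pow_smul_eq_zero htors
  obtain ⟨k, rfl⟩ := exists_smul_frac_of_pow_smul_eq_zero hc
  obtain ⟨b, hb⟩ : ∃ b : ℕ, a * b ≡ 1 [MOD ℓ ^ n] := by
    rcases Nat.eq_zero_or_pos n with rfl | hn
    · exact ⟨0, by simp [Nat.modEq_one]⟩
    have hcop : Nat.Coprime a (ℓ ^ n) := by
      refine Nat.Coprime.pow_right _ ((hℓ.coprime_iff_not_dvd.2 ?_).symm)
      rintro ⟨a', rfl⟩
      obtain ⟨n, rfl⟩ := Nat.exists_eq_add_of_lt hn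
      rw [zero_add] at *
      have h1 := hL (n + 1) (z ^ ℓ ^ n)
        (by rw [← pow_mul, mul_comm, pow_mul, hz.pow_eq_one, one_pow])
        (by
          rw [ofMul_pow, map_nsmul, ha, smul_smul, nsmul_frac_eq_zero_iff]
          exact ⟨a', by ring⟩)
      rw [hz.pow_eq_one_iff_dvd, Nat.pow_dvd_pow_iff_le_right hℓ.one_lt] at h1
      omega
    have h1 : 1 < ℓ ^ n := Nat.one_lt_pow hn.ne' hℓ.one_lt
    obtain ⟨b, -, hb⟩ := Nat.exists_mul_mod_eq_one_of_coprime hcop h1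
    exact ⟨b, by rw [Nat.ModEq, hb, Nat.mod_eq_of_lt h1]⟩
  refine ⟨z ^ (b * k), by rw [← pow_mul, mul_comm, pow_mul, hz.pow_eq_one, one_pow], ?_⟩
  rw [ofMul_pow, map_nsmul, ha, smul_smul]
  have h2 : b * k * a ≡ k [MOD ℓ ^ n] := by
    have := hb.mul_left k
    rw [mul_one] at this
    convert this using 1; ring
  have h4 := Nat.modEq_iff_dvd.1 h2
  rw [eq_comm, ← sub_eq_zero, ← Nat.cast_smul_eq_nsmul ℤ_[ℓ] k,
    ← Nat.cast_smul_eq_nsmul ℤ_[ℓ] (b * k * a), ← sub_smul, smul_frac_eq_zero_iff]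
  have h5 := (PadicInt.pow_p_dvd_int_iff (p := ℓ) n ((k : ℤ) - ((b * k * a : ℕ) : ℤ))).2
    (by exact_mod_cast h4)
  push_cast at h5 ⊢
  exact h5

end Logarithm

/-! ### Hilbert's Theorem 90, extension of characters, and lifts to `ℤ_ℓ` -/

section Kummer

variable {F Ω : Type*} [Field F] [Field Ω] [Algebra F Ω] [IsGalois F Ω]

/-- **Hilbert's theorem 90** for a character of an absolute Galois group, with values in the
base field: `χ` is `σ ↦ σ y / y` for some `y`. That `χ` is trivial on the stabilizer of some
element `s` says that `χ` is continuous. -/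
theorem exists_apply_eq_character_mul (χ : (Ω ≃ₐ[F] Ω) →* Fˣ) (s : Ω)
    (hs : ∀ σ : Ω ≃ₐ[F] Ω, σ s = s → χ σ = 1) :
    ∃ y : Ωˣ, ∀ σ : Ω ≃ₐ[F] Ω, σ (y : Ω) = algebraMap F Ω (χ σ) * y := by
  have hint : IsIntegral F s := Algebra.IsIntegral.isIntegral s
  have hfin : FiniteDimensional F (IntermediateField.adjoin F {s}) :=
    IntermediateField.adjoin.finiteDimensional hint
  let E := IntermediateField.normalClosure F (IntermediateField.adjoin F {s}) Ω
  have hE : Normal F E := normalClosure.normal F _ Ω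
  have hEfin : FiniteDimensional F E := normalClosure.is_finiteDimensional F _ Ω
  have hsE : s ∈ E := IntermediateField.le_normalClosure _
    (IntermediateField.mem_adjoin_simple_self F s)
  have hχ : ∀ σ τ : Ω ≃ₐ[F] Ω,
      AlgEquiv.restrictNormalHom E σ = AlgEquiv.restrictNormalHom E τ → χ σ = χ τ := by
    intro σ τ h
    rw [← inv_mul_eq_one, ← map_inv, ← map_mul]
    have h1 : σ⁻¹ * τ ∈ (AlgEquiv.restrictNormalHom E : (Ω ≃ₐ[F] Ω) →* _).ker := by
      rw [MonoidHom.mem_ker, map_mul, map_inv, h, inv_mul_cancel]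
    rw [IntermediateField.restrictNormalHom_ker] at h1
    exact hs _ (h1 ⟨s, hsE⟩)
  have hsurj := AlgEquiv.restrictNormalHom_surjective (F := F) (K₁ := E) Ω
  choose lift hlift using hsurj
  let f : (E ≃ₐ[F] E) → Eˣ := fun τ => Units.map (algebraMap F E : F →* E) (χ (lift τ))
  have hf : groupCohomology.IsMulCocycle₁ f := by
    intro g h
    have h1 : χ (lift (g * h)) = χ (lift g) * χ (lift h) := by
      rw [← map_mul]
      exact hχ _ _ (by rw [hlift, map_mul, hlift, hlift])
    apply Units.ext
    change algebraMap F E (χ (lift (g * h))) =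
      g (algebraMap F E (χ (lift h))) * algebraMap F E (χ (lift g))
    rw [h1, AlgEquiv.commutes, Units.val_mul, map_mul, mul_comm]
  obtain ⟨x, hx⟩ := groupCohomology.isMulCoboundary₁_of_isMulCocycle₁_of_aut_to_units f hf
  refine ⟨Units.map (algebraMap E Ω : E →* Ω) x, fun σ => ?_⟩
  have h1 := hx (AlgEquiv.restrictNormalHom E σ)
  rw [div_eq_iff_eq_mul] at h1
  have h2 : AlgEquiv.restrictNormalHom E σ (x : E) =
      algebraMap F E (χ (lift (AlgEquiv.restrictNormalHom E σ))) * x := congrArg Units.val h1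
  rw [hχ _ σ (hlift _)] at h2
  change σ (algebraMap E Ω x) = _ * algebraMap E Ω x
  rw [← AlgEquiv.restrictNormal_commutes]
  change algebraMap E Ω (AlgEquiv.restrictNormalHom E σ x) = _
  rw [h2, map_mul, ← IsScalarTower.algebraMap_apply]

end Kummer

section Extension

/-- An invariant character of a normal subgroup `P` with values in a divisible group extends to
the whole group if the quotient by `P` is finite cyclic. -/
theorem exists_character_extension {G Q : Type*} [Group G] [AddCommGroup Q] (P : Subgroup G)
    [P.Normal] (ψ : G → Q) (hψ : ∀ σ ∈ P, ∀ τ ∈ P, ψ (σ * τ) = ψ σ + ψ τ) (g : G)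
    (hinv : ∀ σ ∈ P, ψ (g * σ * g⁻¹) = ψ σ)
    (n : ℕ) (hn : ∀ i : ℕ, g ^ i ∈ P ↔ n ∣ i) (hg : ∀ h : G, ∃ i : ℕ, (g ^ i)⁻¹ * h ∈ P)
    (e : Q) (he : n • e = ψ (g ^ n)) :
    ∃ d : Additive G →+ Q, ∀ σ ∈ P, d (.ofMul σ) = ψ σ := by
  have hψ1 : ψ 1 = 0 := by
    have := hψ 1 P.one_mem 1 P.one_mem
    rwa [mul_one, left_eq_add] at this
  have hgn : g ^ n ∈ P := (hn n).2 dvd_rfl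
  have hpow : ∀ k : ℕ, ψ ((g ^ n) ^ k) = k • n • e := by
    intro k
    induction k with
    | zero => simp [hψ1]
    | succ k ih => rw [pow_succ, hψ _ (P.pow_mem hgn k) _ hgn, ih, succ_nsmul, he]
  have hconj : ∀ (i : ℕ), ∀ σ ∈ P, ψ ((g ^ i)⁻¹ * σ * g ^ i) = ψ σ := by
    intro i
    induction i with
    | zero => simp
    | succ i ih =>
      intro σ hσ
      have h1 : (g ^ i)⁻¹ * σ * g ^ i ∈ P := by
        simpa using ‹P.Normal›.conj_mem σ hσ (g ^ i)⁻¹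
      have h2 : g⁻¹ * ((g ^ i)⁻¹ * σ * g ^ i) * g ∈ P := by
        simpa using ‹P.Normal›.conj_mem _ h1 g⁻¹
      rw [← ih σ hσ, ← hinv _ ?_]
      · congr 1; group
      · convert h2 using 1; group
  -- the value `i • e + ψ (g⁻ⁱ h)` does not depend on the choice of `i`
  have hindep : ∀ (h : G) (i j : ℕ), i ≤ j → (g ^ i)⁻¹ * h ∈ P → (g ^ j)⁻¹ * h ∈ P →
      i • e + ψ ((g ^ i)⁻¹ * h) = j • e + ψ ((g ^ j)⁻¹ * h) := by
    intro h i j hij hi hj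
    obtain ⟨t, rfl⟩ := Nat.exists_eq_add_of_le hij
    have ht : g ^ t ∈ P := by
      have := P.mul_mem hi (P.inv_mem hj)
      have h2 : (g ^ i)⁻¹ * h * ((g ^ (i + t))⁻¹ * h)⁻¹ = g ^ t := by
        rw [pow_add]; group
      rwa [h2] at this
    obtain ⟨k, rfl⟩ := (hn t).1 ht
    have h3 : (g ^ i)⁻¹ * h = (g ^ n) ^ k * ((g ^ (i + n * k))⁻¹ * h) := by
      rw [pow_add, pow_mul]; group
    rw [h3, hψ _ (P.pow_mem hgn k) _ hj, hpow, ← add_assoc, add_nsmul, mul_comm n k, mul_nsmul']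
  have hindep' : ∀ (h : G) (i j : ℕ), (g ^ i)⁻¹ * h ∈ P → (g ^ j)⁻¹ * h ∈ P →
      i • e + ψ ((g ^ i)⁻¹ * h) = j • e + ψ ((g ^ j)⁻¹ * h) := by
    intro h i j hi hj
    rcases le_total i j with hij | hij
    · exact hindep h i j hij hi hj
    · exact (hindep h j i hij hj hi).symm
  choose i hi using hg
  refine ⟨AddMonoidHom.mk' (fun h => i h.toMul • e + ψ ((g ^ i h.toMul)⁻¹ * h.toMul))
    fun a b => ?_, fun σ hσ => ?_⟩
  · obtain ⟨a, rfl⟩ := Additive.ofMul.surjective a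
    obtain ⟨b, rfl⟩ := Additive.ofMul.surjective b
    simp only [← ofMul_mul, toMul_ofMul]
    have h1 : (g ^ (i a + i b))⁻¹ * (a * b) =
        ((g ^ i b)⁻¹ * ((g ^ i a)⁻¹ * a) * g ^ i b) * ((g ^ i b)⁻¹ * b) := by
      rw [pow_add]; group
    have h2 : (g ^ i b)⁻¹ * ((g ^ i a)⁻¹ * a) * g ^ i b ∈ P := by
      simpa using ‹P.Normal›.conj_mem _ (hi a) (g ^ i b)⁻¹
    rw [hindep' (a * b) (i (a * b)) (i a + i b) (hi _) (by rw [h1]; exact P.mul_mem h2 (hi b)), h1,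
      hψ _ h2 _ (hi b), hconj _ _ (hi a), add_nsmul]
    abel
  · have := hindep' σ (i σ) 0 (hi σ) (by simpa using hσ)
    simpa using this

end Extension

section Lifting

variable {ℓ : ℕ} [Fact ℓ.Prime]

/-- An additive map that kills `ℓ^m` is automatically `ℤ_ℓ`-linear. -/
theorem map_padicInt_smul {M N : Type*} [AddCommGroup M] [AddCommGroup N] [Module ℤ_[ℓ] M]
    [Module ℤ_[ℓ] N] (f : M →+ N) (m : ℕ) (hf : ∀ x, (ℓ : ℤ_[ℓ]) ^ m • f x = 0) (a : ℤ_[ℓ])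
    (x : M) :
    f (a • x) = a • f x := by
  obtain ⟨n, c, hc⟩ := exists_nat_dvd_sub a m
  have ha : a = n + (ℓ ^ m : ℕ) * c := by push_cast; rw [← hc]; ring
  have h0 : ∀ y, ℓ ^ m • f y = 0 := fun y => by
    rw [← Nat.cast_smul_eq_nsmul ℤ_[ℓ], Nat.cast_pow, hf]
  rw [ha, add_smul, add_smul, map_add, Nat.cast_smul_eq_nsmul, Nat.cast_smul_eq_nsmul, map_nsmul,
    mul_smul, mul_comm _ c, mul_smul, Nat.cast_smul_eq_nsmul, Nat.cast_smul_eq_nsmul, map_nsmul, h0,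
    h0, smul_zero]

/-- A linear form on a finitely generated submodule of `ℤ_ℓ^I` is continuous. -/
theorem continuous_linearForm {I : Type*} [Finite I] (B : Submodule ℤ_[ℓ] (I → ℤ_[ℓ]))
    (f : B →ₗ[ℤ_[ℓ]] ℤ_[ℓ]) : Continuous f := by
  let b := Module.Free.chooseBasis ℤ_[ℓ] B
  let φ := b.equivFun.symm
  have hφ : Continuous φ := by
    change Continuous fun c => b.equivFun.symm c
    simp only [Module.Basis.equivFun_symm_apply]
    fun_prop
  have hφ' : Continuous φ.toEquiv.symm := hφ.continuous_symm_of_equiv_compact_to_t2 (f := φ.toEquiv)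
  have hfφ : Continuous fun c => f (φ c) := by
    simp only [φ, Module.Basis.equivFun_symm_apply, map_sum, map_smul]
    fun_prop
  have := hfφ.comp hφ'
  convert this using 1
  ext x
  exact congrArg f (φ.apply_symm_apply x).symm

/-- A continuous character of order dividing `ℓ^m` of a compact group that is trivial wherever all
continuous homomorphisms to `ℤ_ℓ` are trivial is the reduction of such a homomorphism. -/
theorem exists_padicInt_lift {G : Type*} [Group G] [TopologicalSpace G] [CompactSpace G]
    (d : Additive G →+ QmodZ ℓ) (hopen : IsOpen {g : G | d (.ofMul g) = 0})
    (m : ℕ) (htors : ∀ g, (ℓ : ℤ_[ℓ]) ^ m • d g = 0)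
    (hd : ∀ g : G, (∀ ρ : Additive G →+ ℤ_[ℓ], Continuous (fun g : G => ρ (.ofMul g)) →
      ρ (.ofMul g) = 0) → d (.ofMul g) = 0) :
    ∃ ρ : Additive G →+ ℤ_[ℓ], Continuous (fun g : G => ρ (.ofMul g)) ∧
      ∀ g, d g = ρ g • frac ℓ m := by
  let T := {ρ : Additive G →+ ℤ_[ℓ] // Continuous (fun g : G => ρ (.ofMul g))}
  -- finitely many homomorphisms to `ℤ_ℓ` suffice, by compactness
  obtain ⟨s, hs⟩ := hopen.isClosed_compl.isCompact.elim_finite_subfamily_closed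
    (fun ρ : T => {g : G | ρ.1 (.ofMul g) = 0})
    (fun ρ => isClosed_eq ρ.2 continuous_const) (by
      rw [Set.eq_empty_iff_forall_notMem]
      rintro g ⟨hg, hg'⟩
      exact hg (hd g fun ρ hρ => Set.mem_iInter.1 hg' ⟨ρ, hρ⟩))
  let R : Additive G →+ (s → ℤ_[ℓ]) := AddMonoidHom.mk' (fun g ρ => ρ.1.1 g)
    (fun a b => by ext ρ; exact map_add _ _ _)
  have hRcont : Continuous fun g : G => R (.ofMul g) := continuous_pi fun ρ => ρ.1.2
  have hker : ∀ g, R g = 0 → d g = 0 := by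
    intro g hg
    by_contra hne
    rw [Set.eq_empty_iff_forall_notMem] at hs
    exact hs g.toMul ⟨hne, Set.mem_iInter₂.2 fun ρ hρ => congrFun hg ⟨ρ, hρ⟩⟩
  -- the image of `G` in `ℤ_ℓ^s` is closed, hence a `ℤ_ℓ`-submodule
  have hclosed : IsClosed (Set.range R) := by
    have h1 : IsCompact (Set.range fun g : G => R (.ofMul g)) := isCompact_range hRcont
    exact h1.isClosed
  let B : Submodule ℤ_[ℓ] (s → ℤ_[ℓ]) :=
    { carrier := Set.range R
      add_mem' := by
        rintro _ _ ⟨a, rfl⟩ ⟨b, rfl⟩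
        exact ⟨a + b, map_add _ _ _⟩
      zero_mem' := ⟨0, map_zero _⟩
      smul_mem' := by
        rintro a _ ⟨g, rfl⟩
        refine PadicInt.denseRange_natCast.induction_on
          (p := fun a : ℤ_[ℓ] => a • R g ∈ Set.range R) a
          (hclosed.preimage (f := fun a : ℤ_[ℓ] => a • R g) (by fun_prop)) fun n => ?_
        exact ⟨n • g, by rw [map_nsmul, Nat.cast_smul_eq_nsmul]⟩ }
  have hmem : ∀ x : B, ∃ g, R g = x := fun x => x.2
  choose lift hlift using hmem
  have hdeq : ∀ g h, R g = R h → d g = d h := fun g h hgh => by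
    rw [← sub_eq_zero, ← map_sub]
    exact hker _ (by rw [map_sub, hgh, sub_self])
  let D : B →+ QmodZ ℓ := AddMonoidHom.mk' (fun x => d (lift x)) fun x y => by
    rw [← map_add]
    exact hdeq _ _ (by rw [hlift, map_add, hlift, hlift]; rfl)
  let b := Module.Free.chooseBasis ℤ_[ℓ] B
  choose n hn using fun i => exists_smul_frac_of_pow_smul_eq_zero (htors (lift (b i)))
  let f : B →ₗ[ℤ_[ℓ]] ℤ_[ℓ] := b.constr ℤ_[ℓ] fun i => (n i : ℤ_[ℓ])
  have hDf : ∀ x, D x = f x • frac ℓ m := by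
    let D' : B →ₗ[ℤ_[ℓ]] QmodZ ℓ :=
      { D with map_smul' := fun a x => map_padicInt_smul D m (fun x => htors _) a x }
    have : D' = (LinearMap.toSpanSingleton ℤ_[ℓ] _ (frac ℓ m)).comp f := by
      refine b.ext fun i => ?_
      change d (lift (b i)) = f (b i) • frac ℓ m
      rw [hn, Module.Basis.constr_basis, Nat.cast_smul_eq_nsmul]
    exact fun x => LinearMap.congr_fun this x
  let RB : Additive G →+ B := AddMonoidHom.mk' (fun g => ⟨R g, g, rfl⟩)
    fun a b => Subtype.ext (map_add R a b)
  refine ⟨f.toAddMonoidHom.comp RB, ?_, fun g => ?_⟩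
  · exact (continuous_linearForm B f).comp (hRcont.subtype_mk _)
  · change d g = f (RB g) • frac ℓ m
    rw [← hDf]
    exact hdeq _ _ (hlift (RB g)).symm

end Lifting

/-! ### `ℤ_ℓ`-extensions and homomorphisms to `ℤ_ℓ` -/

section ZlExtension

/-- A `ℤ_ℓ`-extension is cut out by a continuous homomorphism to `ℤ_ℓ`. -/
theorem IsZlExtension.exists_hom {ℓ : ℕ} [Fact ℓ.Prime] {K Ω : Type*} [Field K] [Field Ω]
    [Algebra K Ω] [Normal K Ω] {L : IntermediateField K Ω} (hL : IsZlExtension ℓ L) :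
    ∃ ρ : Additive (Ω ≃ₐ[K] Ω) →+ ℤ_[ℓ], Continuous (fun g : Ω ≃ₐ[K] Ω => ρ (.ofMul g)) ∧
      ∀ σ : Ω ≃ₐ[K] Ω, ρ (.ofMul σ) = 0 → ∀ y ∈ L, σ y = y := by
  obtain ⟨_, ⟨e⟩⟩ := hL
  let r : (Ω ≃ₐ[K] Ω) →* (L ≃ₐ[K] L) := AlgEquiv.restrictNormalHom L
  refine ⟨MonoidHom.toAdditiveLeft (e.toMulEquiv.toMonoidHom.comp r), ?_, fun σ hσ y hy => ?_⟩
  · exact e.continuous_toFun.comp (InfiniteGalois.restrictNormalHom_continuous L)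
  · have h1 : e (r σ) = 1 := hσ
    have h2 : σ ∈ r.ker := (map_eq_one_iff e e.injective).1 h1
    rw [IntermediateField.restrictNormalHom_ker] at h2
    exact h2 ⟨y, hy⟩

variable {ℓ : ℕ} [Fact ℓ.Prime] {K Ω : Type*} [Field K] [Field Ω] [Algebra K Ω] [IsGalois K Ω]

/-- Dividing a nonzero continuous homomorphism to `ℤ_ℓ` of a compact group by a power of `ℓ` makes
it surjective. -/
theorem exists_surjective_of_ne_zero {G : Type*} [Group G] [TopologicalSpace G] [CompactSpace G]
    (ρ : Additive G →+ ℤ_[ℓ]) (hρ : Continuous fun g : G => ρ (.ofMul g)) (hne : ρ ≠ 0) :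
    ∃ ρ' : Additive G →+ ℤ_[ℓ], Continuous (fun g : G => ρ' (.ofMul g)) ∧
      Function.Surjective ρ' ∧ ∀ g, ρ' g = 0 ↔ ρ g = 0 := by
  have hclosed : IsClosed (Set.range ρ) := by
    have h1 : IsCompact (Set.range fun g : G => ρ (.ofMul g)) := isCompact_range hρ
    exact h1.isClosed
  let S : Ideal ℤ_[ℓ] :=
    { carrier := Set.range ρ
      add_mem' := by
        rintro _ _ ⟨a, rfl⟩ ⟨b, rfl⟩
        exact ⟨a + b, map_add _ _ _⟩
      zero_mem' := ⟨0, map_zero _⟩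
      smul_mem' := by
        rintro a _ ⟨g, rfl⟩
        refine PadicInt.denseRange_natCast.induction_on
          (p := fun a : ℤ_[ℓ] => a • ρ g ∈ Set.range ρ) a
          (hclosed.preimage (f := fun a : ℤ_[ℓ] => a • ρ g) (by fun_prop)) fun n => ?_
        exact ⟨n • g, by rw [map_nsmul, Nat.cast_smul_eq_nsmul]⟩ }
  have hS : S ≠ ⊥ := by
    intro h
    apply hne
    ext g
    have : ρ g ∈ S := ⟨g, rfl⟩
    rw [h] at this
    exact this
  obtain ⟨c, hc⟩ := PadicInt.ideal_eq_span_pow_p hS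
  have hdiv : ∀ g, ∃ a, ρ g = (ℓ : ℤ_[ℓ]) ^ c * a := by
    intro g
    have : ρ g ∈ S := ⟨g, rfl⟩
    rwa [hc, Ideal.mem_span_singleton] at this
  have hℓ : (ℓ : ℤ_[ℓ]) ^ c ≠ 0 :=
    pow_ne_zero _ (Nat.cast_ne_zero.2 (Fact.out : ℓ.Prime).ne_zero)
  choose a ha using hdiv
  refine ⟨AddMonoidHom.mk' a fun g h => ?_, ?_, fun x => ?_, fun g => ?_⟩
  · apply mul_left_cancel₀ hℓ
    rw [mul_add, ← ha, ← ha, ← ha, map_add]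
  · have hemb : Topology.IsClosedEmbedding fun x : ℤ_[ℓ] => (ℓ : ℤ_[ℓ]) ^ c * x :=
      (by fun_prop : Continuous fun x : ℤ_[ℓ] => (ℓ : ℤ_[ℓ]) ^ c * x).isClosedEmbedding
        (mul_right_injective₀ hℓ)
    rw [hemb.isInducing.continuous_iff]
    convert hρ using 1
    ext g
    exact (ha (.ofMul g)).symm
  · have : (ℓ : ℤ_[ℓ]) ^ c * x ∈ S := by
      rw [hc, Ideal.mem_span_singleton]; exact dvd_mul_right _ _
    obtain ⟨g, hg⟩ := this
    exact ⟨g, mul_left_cancel₀ hℓ ((ha g).symm.trans hg)⟩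
  · change a g = 0 ↔ _
    rw [ha, mul_eq_zero, or_iff_right hℓ]

/-- The fixed field of the kernel of a nonzero continuous homomorphism to `ℤ_ℓ` is a
`ℤ_ℓ`-extension. -/
theorem exists_isZlExtension (ρ : Additive (Ω ≃ₐ[K] Ω) →+ ℤ_[ℓ])
    (hρ : Continuous fun g : Ω ≃ₐ[K] Ω => ρ (.ofMul g)) (hne : ρ ≠ 0) :
    ∃ L : IntermediateField K Ω, IsZlExtension ℓ L ∧
      ∀ y : Ω, y ∈ L ↔ ∀ σ : Ω ≃ₐ[K] Ω, ρ (.ofMul σ) = 0 → σ y = y := by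
  obtain ⟨ρ', hρ', hsurj, hker⟩ := exists_surjective_of_ne_zero ρ hρ hne
  let φ : (Ω ≃ₐ[K] Ω) →* Multiplicative ℤ_[ℓ] := AddMonoidHom.toMultiplicativeRight ρ'
  have hφ : Continuous φ := hρ'
  have hφker : ∀ σ : Ω ≃ₐ[K] Ω, σ ∈ φ.ker ↔ ρ (.ofMul σ) = 0 := fun σ => hker (.ofMul σ)
  let N : ClosedSubgroup (Ω ≃ₐ[K] Ω) :=
    { φ.ker with
      isClosed' := isClosed_singleton.preimage hφ }
  have hNfix := InfiniteGalois.fixingSubgroup_fixedField N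
  let L := IntermediateField.fixedField (N : Subgroup (Ω ≃ₐ[K] Ω))
  have hNker : (N : Subgroup (Ω ≃ₐ[K] Ω)) = φ.ker := rfl
  have hL : IsGalois K L := by
    rw [← InfiniteGalois.normal_iff_isGalois]
    rw [hNfix, hNker]
    infer_instance
  refine ⟨L, ⟨hL, ?_⟩, fun y => ?_⟩
  · let r : (Ω ≃ₐ[K] Ω) →* (L ≃ₐ[K] L) := AlgEquiv.restrictNormalHom L
    have hr : Function.Surjective r := AlgEquiv.restrictNormalHom_surjective Ω
    have hrc : Continuous r := InfiniteGalois.restrictNormalHom_continuous L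
    have hrker : r.ker = φ.ker := by
      rw [IntermediateField.restrictNormalHom_ker]
      exact hNfix
    let ψ : (L ≃ₐ[K] L) →* Multiplicative ℤ_[ℓ] := r.liftOfSurjective hr ⟨φ, hrker.le⟩
    have hψr : ∀ σ, ψ (r σ) = φ σ := fun σ => r.liftOfRightInverse_comp_apply _ _ ⟨φ, hrker.le⟩ σ
    have hψ : Continuous ψ := by
      have hq : Topology.IsQuotientMap r := hrc.isClosedMap.isQuotientMap hrc hr
      rw [hq.continuous_iff]
      convert hφ using 1
      ext σ
      exact congrArg _ (hψr σ)
    have hbij : Function.Bijective ψ := by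
      constructor
      · rw [injective_iff_map_eq_one]
        intro τ hτ
        obtain ⟨σ, rfl⟩ := hr τ
        rw [hψr] at hτ
        have : σ ∈ r.ker := by rw [hrker]; exact hτ
        exact this
      · intro x
        obtain ⟨g, hg⟩ := hsurj x.toAdd
        exact ⟨r g.toMul, by rw [hψr]; exact hg⟩
    let e : (L ≃ₐ[K] L) ≃* Multiplicative ℤ_[ℓ] := MulEquiv.ofBijective ψ hbij
    have he : Continuous e := hψ
    exact ⟨{ e with
      continuous_toFun := he
      continuous_invFun := Continuous.continuous_symm_of_equiv_compact_to_t2 (f := e.toEquiv) he }⟩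
  · rw [IntermediateField.mem_fixedField_iff]
    exact forall_congr' fun σ => by rw [← hφker, hNker]

/-- An open neighbourhood of `1` in the Galois group contains the stabilizer of some element. -/
theorem exists_stabilizer_subset {A : Set (Ω ≃ₐ[K] Ω)} (hA : IsOpen A) (h1 : 1 ∈ A) :
    ∃ s : Ω, ∀ σ : Ω ≃ₐ[K] Ω, σ s = s → σ ∈ A := by
  obtain ⟨E, hE, hEA⟩ := (krullTopology_mem_nhds_one_iff K Ω A).1 (hA.mem_nhds h1)
  obtain ⟨α, hα⟩ := Field.exists_primitive_element K E
  refine ⟨α, fun σ hσ => hEA ?_⟩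
  have h2 : IntermediateField.adjoin K {(α : Ω)} = E := by
    have := congrArg IntermediateField.lift hα
    rwa [IntermediateField.lift_adjoin_simple, IntermediateField.lift_top] at this
  intro x
  have h3 : E ≤ IntermediateField.fixedField (Subgroup.zpowers σ) := by
    rw [← h2, IntermediateField.adjoin_simple_le_iff, IntermediateField.mem_fixedField_iff]
    intro f hf
    exact (Subgroup.zpowers_le (H := MulAction.stabilizer (Ω ≃ₐ[K] Ω) (α : Ω))).2 hσ hf
  exact (IntermediateField.mem_fixedField_iff _ _).1 (h3 x.2) σ (Subgroup.mem_zpowers σ)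

/-- A homomorphism on the Galois group that is trivial on the stabilizer of some element has an
open kernel. -/
theorem isOpen_ker_of_stabilizer {Q : Type*} [AddCommGroup Q] (d : Additive (Ω ≃ₐ[K] Ω) →+ Q)
    (s : Ω) (hs : ∀ σ : Ω ≃ₐ[K] Ω, σ s = s → d (.ofMul σ) = 0) :
    IsOpen {σ : Ω ≃ₐ[K] Ω | d (.ofMul σ) = 0} := by
  let φ : (Ω ≃ₐ[K] Ω) →* Multiplicative Q := AddMonoidHom.toMultiplicativeRight d
  exact Subgroup.isOpen_mono (H₁ := MulAction.stabilizer (Ω ≃ₐ[K] Ω) s) (H₂ := φ.ker)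
    (fun σ hσ => hs σ hσ) (stabilizer_isOpen_of_isIntegral s)

end ZlExtension

/-! ### The cyclotomic tower: Galois action on roots of unity -/

section Cyclotomic

theorem intCast_smul_frac_eq_zero {ℓ : ℕ} [Fact ℓ.Prime] {z : ℤ} {n : ℕ} (h : (ℓ : ℤ) ^ n ∣ z) :
    (z : ℤ_[ℓ]) • frac ℓ n = 0 := by
  rw [smul_frac_eq_zero_iff]
  exact (PadicInt.pow_p_dvd_int_iff (p := ℓ) n z).2 h

variable {ℓ : ℕ} {m : ℕ} {K Ω : Type*} [Field K] [Field Ω] [Algebra K Ω]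

/-- The arithmetic of the cyclotomic tower that is used: `K` contains the `ℓ^m`-th roots of unity
(and `m ≥ 2` if `ℓ = 2`), and `g` is an automorphism of the algebraic closure `Ω` that acts on the
roots of unity of `ℓ`-power order as `ζ ↦ ζ^(1+ℓ^m)`. -/
structure CyclotomicGenerator (ℓ m : ℕ) (g : Ω ≃ₐ[K] Ω) : Prop where
  pos : 0 < m
  two_le : ℓ = 2 → 2 ≤ m
  exists_root : ∃ ζ : K, IsPrimitiveRoot ζ (ℓ ^ m)
  apply_root : ∀ (ζ : Ω) (k : ℕ), ζ ^ ℓ ^ k = 1 → g ζ = ζ ^ (1 + ℓ ^ m)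

variable (ℓ K Ω) in
/-- The group of automorphisms of `Ω` fixing the `ℓ^n`-th roots of unity. -/
def rootFixer (n : ℕ) : Subgroup (Ω ≃ₐ[K] Ω) where
  carrier := {σ | ∀ ζ : Ω, ζ ^ ℓ ^ n = 1 → σ ζ = ζ}
  mul_mem' := fun {σ τ} hσ hτ ζ hζ => by rw [AlgEquiv.mul_apply, hτ ζ hζ, hσ ζ hζ]
  one_mem' := fun _ _ => rfl
  inv_mem' := fun {σ} hσ ζ hζ => by
    conv_lhs => rw [← hσ ζ hζ]
    exact σ.symm_apply_apply ζ

instance (n : ℕ) : (rootFixer ℓ K Ω n).Normal where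
  conj_mem σ hσ τ ζ hζ := by
    have h1 : (τ⁻¹ ζ) ^ ℓ ^ n = 1 := by rw [← map_pow, hζ, map_one]
    rw [AlgEquiv.mul_apply, AlgEquiv.mul_apply, hσ _ h1]
    exact τ.apply_symm_apply ζ

theorem rootFixer_anti {n k : ℕ} (h : n ≤ k) : rootFixer ℓ K Ω k ≤ rootFixer ℓ K Ω n := by
  intro σ hσ ζ hζ
  refine hσ ζ ?_
  obtain ⟨t, rfl⟩ := Nat.exists_eq_add_of_le h
  rw [pow_add, pow_mul, hζ, one_pow]

theorem mem_rootFixer_of_primitive {n : ℕ} [NeZero (ℓ ^ n)] {ζ : Ω} (hζ : IsPrimitiveRoot ζ (ℓ ^ n))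
    {σ : Ω ≃ₐ[K] Ω} (h : σ ζ = ζ) : σ ∈ rootFixer ℓ K Ω n := by
  intro ξ hξ
  obtain ⟨i, -, rfl⟩ := hζ.eq_pow_of_pow_eq_one hξ
  rw [map_pow, h]

variable [Fact ℓ.Prime]

instance (n : ℕ) : NeZero (ℓ ^ n) := ⟨pow_ne_zero _ (Fact.out : ℓ.Prime).ne_zero⟩

theorem exists_primitiveRoot_pow [IsAlgClosed Ω] [CharZero Ω] (n : ℕ) :
    ∃ ζ : Ω, IsPrimitiveRoot ζ (ℓ ^ n) :=
  have : NeZero ((ℓ ^ n : ℕ) : Ω) := NeZero.charZero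
  HasEnoughRootsOfUnity.exists_primitiveRoot Ω (ℓ ^ n)

namespace CyclotomicGenerator

variable {g : Ω ≃ₐ[K] Ω}

theorem rootFixer_eq_top (D : CyclotomicGenerator ℓ m g) : rootFixer ℓ K Ω m = ⊤ := by
  obtain ⟨ζ, hζ⟩ := D.exists_root
  rw [eq_top_iff]
  intro σ _
  exact mem_rootFixer_of_primitive (hζ.map_of_injective (algebraMap K Ω).injective)
    (σ.commutes ζ)

theorem pow_apply_root (D : CyclotomicGenerator ℓ m g) (i : ℕ) {ζ : Ω} {k : ℕ}
    (hζ : ζ ^ ℓ ^ k = 1) : (g ^ i) ζ = ζ ^ (1 + ℓ ^ m) ^ i := by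
  induction i with
  | zero => simp
  | succ i ih =>
    rw [pow_succ', AlgEquiv.mul_apply, ih, map_pow, D.apply_root ζ k hζ, ← pow_mul, pow_succ',
      mul_comm]

variable [IsAlgClosed Ω] [CharZero Ω]

theorem pow_mem_rootFixer_iff (D : CyclotomicGenerator ℓ m g) (n i : ℕ) :
    g ^ i ∈ rootFixer ℓ K Ω (m + n) ↔ ℓ ^ n ∣ i := by
  have hℓ : ℓ.Prime := Fact.out
  obtain ⟨ζ, hζ⟩ := exists_primitiveRoot_pow (ℓ := ℓ) (Ω := Ω) (m + n)
  have h1 : g ^ i ∈ rootFixer ℓ K Ω (m + n) ↔ (g ^ i) ζ = ζ :=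
    ⟨fun h => h ζ hζ.pow_eq_one, mem_rootFixer_of_primitive hζ⟩
  rw [h1, D.pow_apply_root i hζ.pow_eq_one, ← pow_dvd_one_add_pow_sub_one_iff D.pos D.two_le n i]
  have h2 : 1 ≤ (1 + ℓ ^ m) ^ i := Nat.one_le_pow _ _ (by omega)
  have h3 : ζ ^ (1 + ℓ ^ m) ^ i = ζ ↔ ζ ^ ((1 + ℓ ^ m) ^ i - 1) = 1 := by
    conv_lhs => rw [← Nat.sub_add_cancel h2, pow_succ]
    exact mul_eq_right₀ (hζ.ne_zero (pow_ne_zero _ hℓ.ne_zero))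
  rw [h3, hζ.pow_eq_one_iff_dvd, ← Int.natCast_dvd_natCast, Nat.cast_sub h2]
  push_cast
  rfl

/-- The powers of `g` represent all classes modulo the automorphisms that fix the `ℓ^(m+n)`-th roots
of unity, since the action on them is by units that are `1` modulo `ℓ^m`. -/
theorem exists_pow_inv_mul_mem (D : CyclotomicGenerator ℓ m g) (n : ℕ) (σ : Ω ≃ₐ[K] Ω) :
    ∃ i : ℕ, (g ^ i)⁻¹ * σ ∈ rootFixer ℓ K Ω (m + n) := by
  have hℓ : ℓ.Prime := Fact.out
  obtain ⟨ζ, hζ⟩ := exists_primitiveRoot_pow (ℓ := ℓ) (Ω := Ω) (m + n)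
  obtain ⟨a, -, ha⟩ := hζ.eq_pow_of_pow_eq_one (ξ := σ ζ)
    (by rw [← map_pow, hζ.pow_eq_one, map_one])
  have hζ' : IsPrimitiveRoot (ζ ^ ℓ ^ n) (ℓ ^ m) := by
    refine hζ.pow (pow_pos hℓ.pos _) ?_
    rw [pow_add, mul_comm]
  have h1 : σ (ζ ^ ℓ ^ n) = ζ ^ ℓ ^ n := by
    have : σ ∈ rootFixer ℓ K Ω m := by rw [D.rootFixer_eq_top]; trivial
    exact this _ hζ'.pow_eq_one
  have ha1 : (ℓ : ℤ) ^ m ∣ a - 1 := by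
    rw [map_pow, ← ha, ← pow_mul, mul_comm, pow_mul] at h1
    have h2 := hζ'.zpow_eq_one_iff_dvd ((a : ℤ) - 1)
    rw [zpow_sub₀ (hζ'.ne_zero (pow_ne_zero _ hℓ.ne_zero)), zpow_natCast, h1, zpow_one,
      div_self (hζ'.ne_zero (pow_ne_zero _ hℓ.ne_zero))] at h2
    exact_mod_cast h2.1 rfl
  obtain ⟨i, hi⟩ := exists_pow_dvd_sub_one_add_pow D.pos D.two_le n a ha1
  refine ⟨i, mem_rootFixer_of_primitive hζ ?_⟩
  have h3 : (g ^ i) ζ = σ ζ := by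
    rw [D.pow_apply_root i hζ.pow_eq_one, ← ha, ← zpow_natCast, ← zpow_natCast, eq_comm,
      ← div_eq_one_iff_eq (zpow_ne_zero _ (hζ.ne_zero (pow_ne_zero _ hℓ.ne_zero))),
      ← zpow_sub₀ (hζ.ne_zero (pow_ne_zero _ hℓ.ne_zero)), hζ.zpow_eq_one_iff_dvd]
    push_cast
    exact hi
  rw [AlgEquiv.mul_apply, ← h3]
  exact (g ^ i).symm_apply_apply ζ

theorem dvd_sub_of_mem (D : CyclotomicGenerator ℓ m g) {n i j : ℕ} {σ : Ω ≃ₐ[K] Ω}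
    (hi : (g ^ i)⁻¹ * σ ∈ rootFixer ℓ K Ω (m + n))
    (hj : (g ^ j)⁻¹ * σ ∈ rootFixer ℓ K Ω (m + n)) : (ℓ : ℤ) ^ n ∣ i - j := by
  wlog hij : i ≤ j generalizing i j
  · rw [← dvd_neg, neg_sub]
    exact this hj hi (le_of_not_ge hij)
  obtain ⟨t, rfl⟩ := Nat.exists_eq_add_of_le hij
  have h1 : g ^ t ∈ rootFixer ℓ K Ω (m + n) := by
    have := mul_mem hi (inv_mem hj)
    have h2 : (g ^ i)⁻¹ * σ * ((g ^ (i + t))⁻¹ * σ)⁻¹ = g ^ t := by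
      rw [pow_add]; group
    rwa [h2] at this
  rw [D.pow_mem_rootFixer_iff] at h1
  rw [← dvd_neg]
  push_cast
  rw [show -((i : ℤ) - (i + t)) = t by ring]
  exact_mod_cast h1

end CyclotomicGenerator

end Cyclotomic

theorem isOpen_rootFixer {ℓ : ℕ} [Fact ℓ.Prime] {K Ω : Type*} [Field K] [Field Ω] [Algebra K Ω]
    [IsAlgClosed Ω] [CharZero Ω] [IsGalois K Ω] (n : ℕ) :
    IsOpen (rootFixer ℓ K Ω n : Set (Ω ≃ₐ[K] Ω)) := by
  obtain ⟨ζ, hζ⟩ := exists_primitiveRoot_pow (ℓ := ℓ) (Ω := Ω) n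
  exact Subgroup.isOpen_mono (H₁ := MulAction.stabilizer (Ω ≃ₐ[K] Ω) ζ)
    (fun σ hσ => mem_rootFixer_of_primitive hζ hσ) (stabilizer_isOpen_of_isIntegral ζ)

/-- A homomorphism from a Galois group to `ℤ_ℓ` is continuous if its reductions are. -/
theorem continuous_of_smul_frac {ℓ : ℕ} [Fact ℓ.Prime] {K Ω : Type*} [Field K] [Field Ω]
    [Algebra K Ω] [IsGalois K Ω] (ρ : Additive (Ω ≃ₐ[K] Ω) →+ ℤ_[ℓ])
    (h : ∀ n, ∃ N ≥ n, IsOpen {σ : Ω ≃ₐ[K] Ω | ρ (.ofMul σ) • frac ℓ N = 0}) :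
    Continuous fun σ : Ω ≃ₐ[K] Ω => ρ (.ofMul σ) := by
  let φ : (Ω ≃ₐ[K] Ω) →* Multiplicative ℤ_[ℓ] := AddMonoidHom.toMultiplicativeRight ρ
  suffices hφ : Continuous φ from hφ
  refine continuous_of_continuousAt_one φ ?_
  rw [ContinuousAt, map_one]
  change Filter.Tendsto (fun σ : Ω ≃ₐ[K] Ω => ρ (.ofMul σ)) (nhds 1) (nhds (0 : ℤ_[ℓ]))
  rw [Metric.tendsto_nhds]
  intro ε hε
  obtain ⟨n, hn⟩ := PadicInt.exists_pow_neg_lt ℓ hε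
  obtain ⟨N, hN, hopen⟩ := h n
  filter_upwards [hopen.mem_nhds (by simp)] with σ hσ
  have h1 : (ℓ : ℤ_[ℓ]) ^ n ∣ ρ (.ofMul σ) :=
    (pow_dvd_pow _ hN).trans ((smul_frac_eq_zero_iff _ _).1 hσ)
  rw [dist_zero_right]
  refine lt_of_le_of_lt ?_ hn
  rw [PadicInt.norm_le_pow_iff_mem_span_pow, Ideal.mem_span_singleton]
  exact h1

namespace CyclotomicGenerator

variable {ℓ : ℕ} {m : ℕ} {K Ω : Type*} [Field K] [Field Ω] [Algebra K Ω] [Fact ℓ.Prime]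
  {g : Ω ≃ₐ[K] Ω}
  [IsAlgClosed Ω] [CharZero Ω] [IsGalois K Ω]

/-- The projection of the absolute Galois group onto `Gal(K_∞/K) ≅ ℤ_ℓ`: `σ` acts on the
`ℓ^(m+n)`-th roots of unity as `g^i`, where `i` approximates the image of `σ` modulo `ℓ^n`. -/
theorem exists_cyclotomic_hom (D : CyclotomicGenerator ℓ m g) : ∃ ρ : Additive (Ω ≃ₐ[K] Ω) →+ ℤ_[ℓ],
    Continuous (fun σ : Ω ≃ₐ[K] Ω => ρ (.ofMul σ)) ∧
    ∀ (σ : Ω ≃ₐ[K] Ω) (n i : ℕ), (g ^ i)⁻¹ * σ ∈ rootFixer ℓ K Ω (m + n) ↔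
      ρ (.ofMul σ) • frac ℓ n = i • frac ℓ n := by
  choose i hi using fun n σ => D.exists_pow_inv_mul_mem n σ
  have hind : ∀ {n a b : ℕ} {σ : Ω ≃ₐ[K] Ω}, (g ^ a)⁻¹ * σ ∈ rootFixer ℓ K Ω (m + n) →
      (g ^ b)⁻¹ * σ ∈ rootFixer ℓ K Ω (m + n) → a • frac ℓ n = b • frac ℓ n := by
    intro n a b σ ha hb
    have := intCast_smul_frac_eq_zero (ℓ := ℓ) (D.dvd_sub_of_mem ha hb)
    push_cast at this
    rwa [sub_smul, sub_eq_zero, Nat.cast_smul_eq_nsmul, Nat.cast_smul_eq_nsmul] at this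
  have hex : ∀ σ : Ω ≃ₐ[K] Ω, ∃ a : ℤ_[ℓ], ∀ n, i n σ • frac ℓ n = a • frac ℓ (0 + n) := by
    intro σ
    refine exists_padicInt_of_compatible 0 (fun n => i n σ • frac ℓ n) ?_ fun n => ?_
    · rw [pow_zero, one_smul, nsmul_frac_eq_zero_iff]
      exact one_dvd _
    · rw [smul_comm, smul_frac_succ]
      exact hind (rootFixer_anti (by omega) (hi (n + 1) σ)) (hi n σ)
  choose ρ hρ using hex
  simp only [zero_add] at hρ
  have hρ' : ∀ (σ : Ω ≃ₐ[K] Ω) (n a : ℕ), (g ^ a)⁻¹ * σ ∈ rootFixer ℓ K Ω (m + n) →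
      ρ σ • frac ℓ n = a • frac ℓ n := fun σ n a ha => by
    rw [← hρ]; exact hind (hi n σ) ha
  have hadd : ∀ σ τ, ρ (σ * τ) = ρ σ + ρ τ := by
    intro σ τ
    refine eq_of_forall_smul_frac_eq 0 fun n => ?_
    rw [zero_add, add_smul, ← hρ σ, ← hρ τ, hρ' (σ * τ) n (i n σ + i n τ), add_smul]
    have h1 : (g ^ (i n σ + i n τ))⁻¹ * (σ * τ) =
        ((g ^ i n τ)⁻¹ * ((g ^ i n σ)⁻¹ * σ) * g ^ i n τ) * ((g ^ i n τ)⁻¹ * τ) := by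
      rw [pow_add]; group
    rw [h1]
    refine mul_mem ?_ (hi n τ)
    simpa using (inferInstance : (rootFixer ℓ K Ω (m + n)).Normal).conj_mem _ (hi n σ) (g ^ i n τ)⁻¹
  have key : ∀ (σ : Ω ≃ₐ[K] Ω) (n a : ℕ), (g ^ a)⁻¹ * σ ∈ rootFixer ℓ K Ω (m + n) ↔
      ρ σ • frac ℓ n = a • frac ℓ n := by
    intro σ n a
    refine ⟨hρ' σ n a, fun h => ?_⟩
    have h1 : (ℓ : ℤ) ^ n ∣ (i n σ : ℤ) - a := by
      rw [← hρ, ← sub_eq_zero, ← Nat.cast_smul_eq_nsmul ℤ_[ℓ], ← Nat.cast_smul_eq_nsmul ℤ_[ℓ],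
        ← sub_smul, smul_frac_eq_zero_iff] at h
      exact (PadicInt.pow_p_dvd_int_iff (p := ℓ) n _).1 (by push_cast; exact h)
    have h2 : ∀ {a b : ℕ}, a ≤ b → (ℓ : ℤ) ^ n ∣ (b : ℤ) - a →
        (g ^ a)⁻¹ * g ^ b ∈ rootFixer ℓ K Ω (m + n) := by
      intro a b hab hdvd
      obtain ⟨t, rfl⟩ := Nat.exists_eq_add_of_le hab
      rw [pow_add, inv_mul_cancel_left, D.pow_mem_rootFixer_iff]
      push_cast at hdvd
      rw [add_sub_cancel_left] at hdvd
      exact_mod_cast hdvd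
    have h3 : (g ^ a)⁻¹ * g ^ i n σ ∈ rootFixer ℓ K Ω (m + n) := by
      rcases le_total a (i n σ) with hle | hle
      · exact h2 hle h1
      · have := inv_mem (h2 hle (by rw [← dvd_neg, neg_sub]; exact h1))
        simpa using this
    have := mul_mem h3 (hi n σ)
    rwa [mul_assoc, mul_inv_cancel_left] at this
  refine ⟨AddMonoidHom.mk' (fun σ => ρ σ.toMul) fun σ τ => hadd _ _, ?_, key⟩
  refine continuous_of_smul_frac _ fun n => ⟨n, le_rfl, ?_⟩
  convert isOpen_rootFixer (ℓ := ℓ) (K := K) (Ω := Ω) (m + n) using 1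
  ext σ
  have := key σ n 0
  rw [pow_zero, inv_one, one_mul, zero_smul] at this
  exact this.symm

end CyclotomicGenerator

/-! ### The cyclotomic tower: layers and norms -/

section Layers

variable {ℓ : ℕ} {m : ℕ} {K Ω : Type*} [Field K] [Field Ω] [Algebra K Ω] [IsGalois K Ω]

theorem mem_adjoin_iff_fixed (S : Set Ω) (x : Ω) :
    x ∈ IntermediateField.adjoin K S ↔
      ∀ σ : Ω ≃ₐ[K] Ω, (∀ s ∈ S, σ s = s) → σ x = x := by
  constructor
  · intro hx σ hσ
    have h1 : IntermediateField.adjoin K S ≤ IntermediateField.fixedField (Subgroup.zpowers σ) := by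
      rw [IntermediateField.adjoin_le_iff]
      intro s hs
      rw [SetLike.mem_coe, IntermediateField.mem_fixedField_iff]
      intro f hf
      exact (Subgroup.zpowers_le (H := MulAction.stabilizer (Ω ≃ₐ[K] Ω) s)).2 (hσ s hs) hf
    exact (IntermediateField.mem_fixedField_iff _ _).1 (h1 hx) σ (Subgroup.mem_zpowers σ)
  · intro h
    rw [← InfiniteGalois.fixedField_fixingSubgroup (IntermediateField.adjoin K S),
      IntermediateField.mem_fixedField_iff]
    intro σ hσ
    exact h σ fun s hs => hσ ⟨s, IntermediateField.subset_adjoin K S hs⟩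

theorem mem_Kinf_iff (x : Ω) :
    x ∈ Kinf ℓ K Ω ↔ ∀ σ : Ω ≃ₐ[K] Ω, (∀ n, σ ∈ rootFixer ℓ K Ω n) → σ x = x := by
  rw [Kinf, mem_adjoin_iff_fixed]
  refine forall_congr' fun σ => ?_
  have : (∀ s ∈ {ζ : Ω | ∃ k : ℕ, ζ ^ ℓ ^ k = 1}, σ s = s) ↔ ∀ n, σ ∈ rootFixer ℓ K Ω n :=
    ⟨fun h n ζ hζ => h ζ ⟨n, hζ⟩, fun h s ⟨n, hn⟩ => h n s hn⟩
  rw [this]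

theorem root_mem_Kinf {ζ : Ω} {k : ℕ} (h : ζ ^ ℓ ^ k = 1) : ζ ∈ Kinf ℓ K Ω :=
  IntermediateField.subset_adjoin K _ ⟨k, h⟩

theorem mem_layer_iff (n : ℕ) (x : Kinf ℓ K Ω) :
    x ∈ layer ℓ m K Ω n ↔ ∀ σ ∈ rootFixer ℓ K Ω (m + n), σ (x : Ω) = x := by
  have h1 : x ∈ layer ℓ m K Ω n ↔ (x : Ω) ∈ IntermediateField.lift (layer ℓ m K Ω n) :=
    (IntermediateField.mem_lift x).symm
  rw [h1, layer, IntermediateField.lift_adjoin, mem_adjoin_iff_fixed]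
  refine forall_congr' fun σ => ?_
  have : (∀ s ∈ Subtype.val '' {ζ : Kinf ℓ K Ω | ζ ^ ℓ ^ (m + n) = 1}, σ s = s) ↔
      σ ∈ rootFixer ℓ K Ω (m + n) := by
    constructor
    · intro h ζ hζ
      exact h ζ ⟨⟨ζ, root_mem_Kinf hζ⟩, Subtype.ext hζ, rfl⟩
    · rintro h _ ⟨ζ, hζ, rfl⟩
      exact h ζ (congrArg Subtype.val hζ)
  exact imp_congr_left this

/-- Every element of `K_∞` lies in a finite layer. -/
theorem exists_rootFixer_fixes {x : Ω} (hx : x ∈ Kinf ℓ K Ω) :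
    ∃ n, ∀ k ≥ n, ∀ σ ∈ rootFixer ℓ K Ω k, σ x = x := by
  suffices h : ∃ n, ∀ σ ∈ rootFixer ℓ K Ω n, σ x = x by
    obtain ⟨n, hn⟩ := h
    exact ⟨n, fun k hk σ hσ => hn σ (rootFixer_anti hk hσ)⟩
  induction hx using IntermediateField.adjoin_induction with
  | mem ζ hζ =>
    obtain ⟨k, hk⟩ := hζ
    exact ⟨k, fun σ hσ => hσ ζ hk⟩
  | algebraMap x => exact ⟨0, fun σ _ => σ.commutes x⟩
  | add x y _ _ hx hy =>
    obtain ⟨a, ha⟩ := hx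
    obtain ⟨b, hb⟩ := hy
    exact ⟨max a b, fun σ hσ => by
      rw [map_add, ha σ (rootFixer_anti (le_max_left _ _) hσ),
        hb σ (rootFixer_anti (le_max_right _ _) hσ)]⟩
  | inv x _ hx =>
    obtain ⟨a, ha⟩ := hx
    exact ⟨a, fun σ hσ => by rw [map_inv₀, ha σ hσ]⟩
  | mul x y _ _ hx hy =>
    obtain ⟨a, ha⟩ := hx
    obtain ⟨b, hb⟩ := hy
    exact ⟨max a b, fun σ hσ => by
      rw [map_mul, ha σ (rootFixer_anti (le_max_left _ _) hσ),
        hb σ (rootFixer_anti (le_max_right _ _) hσ)]⟩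

variable [Fact ℓ.Prime] [IsAlgClosed Ω] [CharZero Ω] {g : Ω ≃ₐ[K] Ω}

/-- An element of `K_∞` fixed by `g^(ℓ^n)` belongs to `K_n`. -/
theorem CyclotomicGenerator.apply_eq_of_pow_apply_eq (D : CyclotomicGenerator ℓ m g) {n : ℕ} {x : Ω}
    (hx : x ∈ Kinf ℓ K Ω) (hg : (g ^ ℓ ^ n) x = x) :
    ∀ σ ∈ rootFixer ℓ K Ω (m + n), σ x = x := by
  intro σ hσ
  obtain ⟨M, hM⟩ := exists_rootFixer_fixes hx
  obtain ⟨i, hi⟩ := D.exists_pow_inv_mul_mem (n + M) σ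
  have h1 := hM (m + (n + M)) (by omega) _ hi
  have h2 : σ x = (g ^ i) x := by
    conv_rhs => rw [← h1]
    exact ((g ^ i).apply_symm_apply (σ x)).symm
  have h3 : g ^ i ∈ rootFixer ℓ K Ω (m + n) := by
    have := mul_mem hσ (inv_mem (rootFixer_anti (by omega : m + n ≤ _) hi))
    simpa using this
  obtain ⟨c, rfl⟩ := (D.pow_mem_rootFixer_iff n i).1 h3
  rw [h2, pow_mul]
  exact Subgroup.pow_mem (MulAction.stabilizer (Ω ≃ₐ[K] Ω) x) hg c

/-- The layer `K_0` is `K`. -/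
theorem CyclotomicGenerator.mem_range_of_mem_layer_zero (D : CyclotomicGenerator ℓ m g)
    (x : layer ℓ m K Ω 0) : ∃ a : K, algebraMap K (layer ℓ m K Ω 0) a = x := by
  have h1 := (mem_layer_iff 0 (x : Kinf ℓ K Ω)).1 x.2
  rw [add_zero, D.rootFixer_eq_top] at h1
  obtain ⟨a, ha⟩ := (InfiniteGalois.mem_range_algebraMap_iff_fixed ((x : Kinf ℓ K Ω) : Ω)).2
    fun σ => h1 σ trivial
  exact ⟨a, Subtype.ext (Subtype.ext ha)⟩

/-- `K_∞` is contained in a `ℤ_ℓ`-extension (it is one). -/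
theorem CyclotomicGenerator.exists_isZlExtension_Kinf_le (D : CyclotomicGenerator ℓ m g) :
    ∃ L : IntermediateField K Ω, IsZlExtension ℓ L ∧ Kinf ℓ K Ω ≤ L := by
  obtain ⟨ρ, hρ, hρ'⟩ := D.exists_cyclotomic_hom
  have hne : ρ ≠ 0 := by
    rintro rfl
    have h1 := (hρ' g 1 0).2 (by simp)
    rw [pow_zero, inv_one, one_mul] at h1
    have h2 := (D.pow_mem_rootFixer_iff 1 1).1 (by rwa [pow_one])
    rw [pow_one] at h2
    exact (Fact.out : ℓ.Prime).one_lt.ne' (Nat.dvd_one.1 h2)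
  obtain ⟨L, hL, hmem⟩ := exists_isZlExtension ρ hρ hne
  refine ⟨L, hL, fun x hx => (hmem x).2 fun σ hσ => (mem_Kinf_iff x).1 hx σ fun n => ?_⟩
  have h1 := (hρ' σ n 0).2 (by rw [hσ, zero_smul, zero_smul])
  rw [pow_zero, inv_one, one_mul] at h1
  exact rootFixer_anti (by omega) h1

variable (ℓ m K Ω) in
/-- The inclusion `K_nˣ → K_∞ˣ`. -/
def layerUnits (n : ℕ) : (layer ℓ m K Ω n)ˣ →* (Kinf ℓ K Ω)ˣ :=
  Units.map (algebraMap (layer ℓ m K Ω n) (Kinf ℓ K Ω) : layer ℓ m K Ω n →* Kinf ℓ K Ω)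

theorem finiteDimensional_layer (n : ℕ) : FiniteDimensional K (layer ℓ m K Ω n) := by
  classical
  have : Finite {ζ : Kinf ℓ K Ω | ζ ^ ℓ ^ (m + n) = 1} := by
    have h := (Polynomial.nthRoots (ℓ ^ (m + n)) (1 : Kinf ℓ K Ω)).toFinset.finite_toSet
    refine (h.subset fun ζ hζ => ?_).to_subtype
    simpa [Polynomial.mem_nthRoots (NeZero.pos (ℓ ^ (m + n)))] using hζ
  exact IntermediateField.finiteDimensional_adjoin fun x _ => Algebra.IsIntegral.isIntegral x

end Layers

/-- The norm of `E/F` as a product over automorphisms of an algebraically closed field `Ω` that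
represent the embeddings of `E` over `F`. -/
theorem norm_eq_prod_of_representatives {K F E Ω : Type*} [Field K] [Field F] [Field E] [Field Ω]
    [Algebra K F] [Algebra K E] [Algebra F E] [Algebra K Ω] [CharZero K] [FiniteDimensional K E]
    [IsAlgClosed Ω] [Normal K Ω]
    (hKFE : ∀ a : K, algebraMap F E (algebraMap K F a) = algebraMap K E a)
    (iF : F →ₐ[K] Ω) (iE : E →ₐ[K] Ω) (hFE : ∀ y, iE (algebraMap F E y) = iF y)
    {d : ℕ} (s : Fin d → (Ω ≃ₐ[K] Ω)) (hfix : ∀ i y, s i (iF y) = iF y)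
    (hinj : ∀ i j, (∀ y, s i (iE y) = s j (iE y)) → i = j)
    (hsurj : ∀ σ : Ω ≃ₐ[K] Ω, (∀ y, σ (iF y) = iF y) → ∃ i, ∀ y, s i (iE y) = σ (iE y)) (x : E) :
    iF (Algebra.norm F x) = ∏ i, s i (iE x) := by
  have tower : IsScalarTower K F E := IsScalarTower.of_algebraMap_eq fun a => (hKFE a).symm
  have fin : FiniteDimensional F E := FiniteDimensional.right K F E
  have charF : CharZero F := charZero_of_injective_algebraMap (algebraMap K F).injective
  let algFΩ : Algebra F Ω := iF.toRingHom.toAlgebra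
  have towerΩ : IsScalarTower K F Ω := IsScalarTower.of_algebraMap_eq fun a => (iF.commutes a).symm
  let algEΩ : Algebra E Ω := iE.toRingHom.toAlgebra
  have towerEΩ : IsScalarTower K E Ω := IsScalarTower.of_algebraMap_eq fun a => (iE.commutes a).symm
  let f : Fin d → (E →ₐ[F] Ω) := fun i =>
    { (s i : Ω →+* Ω).comp (iE : E →+* Ω) with
      commutes' := fun y => (congrArg (s i) (hFE y)).trans (hfix i y) }
  have hbij : Function.Bijective f := by
    refine ⟨fun i j hij => hinj i j fun y => DFunLike.congr_fun hij y, fun φ => ?_⟩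
    let lft := (φ.restrictScalars K).liftNormal Ω
    let σ : Ω ≃ₐ[K] Ω := AlgEquiv.ofBijective lft (Algebra.IsAlgebraic.algHom_bijective lft)
    have hσ : ∀ y : E, σ (iE y) = φ y := fun y => (φ.restrictScalars K).liftNormal_commutes Ω y
    obtain ⟨i, hi⟩ := hsurj σ fun y => by
      rw [← hFE, hσ, hFE]
      exact φ.commutes y
    exact ⟨i, AlgHom.ext fun y => (hi y).trans (hσ y)⟩
  refine (Algebra.norm_eq_prod_embeddings F Ω x).trans ?_
  exact (Fintype.prod_bijective f hbij (fun i => f i x) (fun φ => φ x) fun _ => rfl).symm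

section Norm

variable {ℓ : ℕ} {m : ℕ} {K Ω : Type*} [Field K] [Field Ω] [Algebra K Ω] [IsGalois K Ω]
  [Fact ℓ.Prime] [IsAlgClosed Ω] [CharZero Ω] {g : Ω ≃ₐ[K] Ω}

/-- The norm of `K_{n+1}/K_n` is the product of the conjugates under `g^(ℓ^n i)`, `i < ℓ`. -/
theorem CyclotomicGenerator.coe_norm_layer (D : CyclotomicGenerator ℓ m g) (n : ℕ)
    (x : layer ℓ m K Ω (n + 1)) :
    letI : Algebra (layer ℓ m K Ω n) (layer ℓ m K Ω (n + 1)) :=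
      (IntermediateField.inclusion (layer_le_succ ℓ m K Ω n)).toRingHom.toAlgebra
    (((Algebra.norm (layer ℓ m K Ω n) x : layer ℓ m K Ω n) : Kinf ℓ K Ω) : Ω) =
      ∏ i ∈ Finset.range ℓ, (g ^ (ℓ ^ n * i)) ((x : Kinf ℓ K Ω) : Ω) := by
  let algFE : Algebra (layer ℓ m K Ω n) (layer ℓ m K Ω (n + 1)) :=
    (IntermediateField.inclusion (layer_le_succ ℓ m K Ω n)).toRingHom.toAlgebra
  have charK : CharZero K := (algebraMap K Ω).charZero_iff (algebraMap K Ω).injective |>.2 ‹_›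
  have finK : FiniteDimensional K (layer ℓ m K Ω (n + 1)) := finiteDimensional_layer (n + 1)
  obtain ⟨ζ, hζ⟩ := exists_primitiveRoot_pow (ℓ := ℓ) (Ω := Ω) (m + (n + 1))
  let z : layer ℓ m K Ω (n + 1) := ⟨⟨ζ, root_mem_Kinf hζ.pow_eq_one⟩,
    (mem_layer_iff (n + 1) _).2 fun σ hσ => hσ ζ hζ.pow_eq_one⟩
  rw [← Fin.prod_univ_eq_prod_range (fun i => (g ^ (ℓ ^ n * i)) ((x : Kinf ℓ K Ω) : Ω)) ℓ]
  refine norm_eq_prod_of_representatives (K := K) (F := layer ℓ m K Ω n)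
    (E := layer ℓ m K Ω (n + 1)) (Ω := Ω) (fun _ => rfl)
    ((Kinf ℓ K Ω).val.comp (layer ℓ m K Ω n).val)
    ((Kinf ℓ K Ω).val.comp (layer ℓ m K Ω (n + 1)).val) (fun _ => rfl)
    (fun i : Fin ℓ => g ^ (ℓ ^ n * (i : ℕ))) (fun i y => ?_) (fun i j hij => ?_) (fun σ hσ => ?_) x
  · exact (mem_layer_iff n (y : Kinf ℓ K Ω)).1 y.2 _
      ((D.pow_mem_rootFixer_iff n _).2 (dvd_mul_right _ _))
  · have h1 : (g ^ (ℓ ^ n * (i : ℕ))) ζ = (g ^ (ℓ ^ n * (j : ℕ))) ζ := hij z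
    have h2 : (g ^ (ℓ ^ n * (j : ℕ)))⁻¹ * g ^ (ℓ ^ n * (i : ℕ)) ∈
        rootFixer ℓ K Ω (m + (n + 1)) := by
      refine mem_rootFixer_of_primitive hζ ?_
      rw [AlgEquiv.mul_apply, h1]
      exact (g ^ (ℓ ^ n * (j : ℕ))).symm_apply_apply ζ
    have h3 := D.dvd_sub_of_mem (i := ℓ ^ n * j) (j := ℓ ^ n * i) h2
      (by rw [inv_mul_cancel]; exact one_mem _)
    push_cast at h3
    rw [← mul_sub, pow_succ, mul_dvd_mul_iff_left
      (pow_ne_zero _ (by exact_mod_cast (Fact.out : ℓ.Prime).ne_zero))] at h3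
    have h4 : (j : ℤ) - (i : ℤ) = 0 := by
      refine Int.eq_zero_of_abs_lt_dvd h3 ?_
      have := i.2
      have := j.2
      rw [abs_lt]
      constructor <;> omega
    exact Fin.ext (by omega)
  · obtain ⟨i, hi⟩ := D.exists_pow_inv_mul_mem (n + 1) σ
    have hσF : σ ∈ rootFixer ℓ K Ω (m + n) := fun ξ hξ =>
      hσ ⟨⟨ξ, root_mem_Kinf hξ⟩, (mem_layer_iff n _).2 fun τ hτ => hτ ξ hξ⟩
    have hgi : g ^ i ∈ rootFixer ℓ K Ω (m + n) := by
      have := mul_mem hσF (inv_mem (rootFixer_anti (by omega : m + n ≤ _) hi))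
      simpa using this
    obtain ⟨c, rfl⟩ := (D.pow_mem_rootFixer_iff n i).1 hgi
    refine ⟨⟨c % ℓ, Nat.mod_lt _ (Fact.out : ℓ.Prime).pos⟩, fun y => ?_⟩
    have hy := (mem_layer_iff (n + 1) (y : Kinf ℓ K Ω)).1 y.2
    change (g ^ (ℓ ^ n * (c % ℓ))) ((y : Kinf ℓ K Ω) : Ω) = σ ((y : Kinf ℓ K Ω) : Ω)
    have h1 : (g ^ (ℓ ^ n * c)) ((y : Kinf ℓ K Ω) : Ω) = σ ((y : Kinf ℓ K Ω) : Ω) := by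
      conv_lhs => rw [← hy _ hi]
      exact (g ^ (ℓ ^ n * c)).apply_symm_apply _
    rw [← h1]
    conv_rhs => rw [← Nat.mod_add_div c ℓ, mul_add, pow_add, AlgEquiv.mul_apply, ← mul_assoc,
      ← pow_succ]
    rw [hy _ ((D.pow_mem_rootFixer_iff (n + 1) _).2 (dvd_mul_right _ _))]

end Norm

/-! ### The radical of `K_∞` -/

section RadicalFunctor

variable {ℓ : ℕ} [Fact ℓ.Prime] {F E E' : Type*} [Field F] [Field E] [Field E']

theorem radMap_radMap (f : Fˣ →* Eˣ) (f' : Eˣ →* E'ˣ) (r : Radical ℓ F) :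
    radMap ℓ f' (radMap ℓ f r) = radMap ℓ (f'.comp f) r := by
  obtain ⟨N, hN⟩ := exists_eq_radMk r
  obtain ⟨x, rfl⟩ := hN N le_rfl
  rfl

end RadicalFunctor

section RadicalTower

variable {ℓ : ℕ} {m : ℕ} {K Ω : Type*} [Field K] [Field Ω] [Algebra K Ω] [IsGalois K Ω]
  [Fact ℓ.Prime] [IsAlgClosed Ω] [CharZero Ω] {g : Ω ≃ₐ[K] Ω}

theorem mem_fixingSubgroup_Kinf {σ : Ω ≃ₐ[K] Ω} :
    σ ∈ (Kinf ℓ K Ω).fixingSubgroup ↔ ∀ n, σ ∈ rootFixer ℓ K Ω n := by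
  rw [IntermediateField.mem_fixingSubgroup_iff]
  exact ⟨fun h n ζ hζ => h ζ (root_mem_Kinf hζ), fun h x hx => (mem_Kinf_iff x).1 hx σ h⟩

theorem mem_Kinf_of_pow_eq {t z : Ω} {k : ℕ} (hz : z ∈ Kinf ℓ K Ω) (h0 : z ≠ 0)
    (h : t ^ ℓ ^ k = z ^ ℓ ^ k) : t ∈ Kinf ℓ K Ω := by
  have h1 : t / z ∈ Kinf ℓ K Ω := root_mem_Kinf (k := k)
    (by rw [div_pow, h, div_self (pow_ne_zero _ h0)])
  have := mul_mem h1 hz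
  rwa [div_mul_cancel₀ _ h0] at this

/-- In the radical of `K_∞`, which contains all roots of unity of `ℓ`-power order, `ℓ^{-k} ⊗ x`
vanishes only if `x` is an `ℓ^k`-th power. -/
theorem exists_eq_pow_of_radMk_Kinf {k : ℕ} {x : (Kinf ℓ K Ω)ˣ} (h : radMk ℓ k x = 0) :
    ∃ z : (Kinf ℓ K Ω)ˣ, x = z ^ ℓ ^ k := by
  obtain ⟨j, z, hz⟩ := exists_pow_eq_of_radMk_eq_zero h
  have hz' : ((x : Kinf ℓ K Ω) : Ω) ^ ℓ ^ j = (((z : Kinf ℓ K Ω) : Ω) ^ ℓ ^ k) ^ ℓ ^ j := by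
    exact_mod_cast congrArg (fun u : (Kinf ℓ K Ω)ˣ => ((u : Kinf ℓ K Ω) : Ω)) hz
  obtain ⟨t, ht⟩ := IsAlgClosed.exists_pow_nat_eq ((x : Kinf ℓ K Ω) : Ω) (NeZero.pos (ℓ ^ k))
  have hz0 : ((z : Kinf ℓ K Ω) : Ω) ≠ 0 := by simp
  have htmem : t ∈ Kinf ℓ K Ω := by
    refine mem_Kinf_of_pow_eq (k := k + j) (SetLike.coe_mem (z : Kinf ℓ K Ω)) hz0 ?_
    rw [pow_add, pow_mul, ht, hz', pow_mul]
  have ht0 : (⟨t, htmem⟩ : Kinf ℓ K Ω) ≠ 0 := by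
    intro h0
    have : t = 0 := congrArg Subtype.val h0
    rw [this, zero_pow (NeZero.ne _)] at ht
    exact (by simp : ((x : Kinf ℓ K Ω) : Ω) ≠ 0) ht.symm
  exact ⟨Units.mk0 _ ht0, Units.ext (Subtype.ext ht.symm)⟩

/-- Conversely to `radMk_eq_of_div_mem`, the quotient of two roots attached to the same element of
the radical of `K_∞` lies in `K_∞`; so the Kummer character of an element of the radical is well
defined. -/
theorem apply_div_eq_of_radMk_eq {k j : ℕ} {x y : (Kinf ℓ K Ω)ˣ} (h : radMk ℓ k x = radMk ℓ j y)
    {t s : Ωˣ} (ht : (t : Ω) ^ ℓ ^ k = (x : Kinf ℓ K Ω)) (hs : (s : Ω) ^ ℓ ^ j = (y : Kinf ℓ K Ω)) :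
    (t : Ω) / s ∈ Kinf ℓ K Ω := by
  have h1 : radMk ℓ (k + j) (x ^ ℓ ^ j / y ^ ℓ ^ k) = 0 := by
    rw [radMk_div, radMk_add_pow, sub_eq_zero, add_comm, radMk_add_pow, h]
  obtain ⟨z, hz⟩ := exists_eq_pow_of_radMk_Kinf h1
  have hz' : ((x : Kinf ℓ K Ω) : Ω) ^ ℓ ^ j / ((y : Kinf ℓ K Ω) : Ω) ^ ℓ ^ k =
      ((z : Kinf ℓ K Ω) : Ω) ^ ℓ ^ (k + j) := by
    have := congrArg (fun u : (Kinf ℓ K Ω)ˣ => ((u : Kinf ℓ K Ω) : Ω)) hz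
    simpa using this
  refine mem_Kinf_of_pow_eq (k := k + j) (SetLike.coe_mem (z : Kinf ℓ K Ω)) (by simp) ?_
  rw [← hz', ← ht, ← hs, div_pow, ← pow_mul, ← pow_mul, ← pow_add, ← pow_add, add_comm j k]

/-- Elements `ℓ^{-k} ⊗ x` and `ℓ^{-j} ⊗ y` of the radical of `K_∞` are equal if the quotient of a
root of `x` by a root of `y` lies in `K_∞`. -/
theorem radMk_eq_of_div_mem {k j : ℕ} {x y : (Kinf ℓ K Ω)ˣ} {t s : Ωˣ}
    (ht : (t : Ω) ^ ℓ ^ k = (x : Kinf ℓ K Ω)) (hs : (s : Ω) ^ ℓ ^ j = (y : Kinf ℓ K Ω))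
    (h : (t : Ω) / s ∈ Kinf ℓ K Ω) : radMk ℓ k x = radMk ℓ j y := by
  have hz0 : (⟨_, h⟩ : Kinf ℓ K Ω) ≠ 0 := by
    intro h0
    exact (by simp : (t : Ω) / s ≠ 0) (congrArg Subtype.val h0)
  have h1 : x ^ ℓ ^ j / y ^ ℓ ^ k = Units.mk0 _ hz0 ^ ℓ ^ (k + j) := by
    apply Units.ext
    apply Subtype.ext
    simp only [Units.val_div_eq_div_val, Units.val_pow_eq_pow_val, Units.val_mk0,
      IntermediateField.coe_div, IntermediateField.coe_pow]
    rw [← ht, ← hs, div_pow, ← pow_mul, ← pow_mul, ← pow_add, ← pow_add, add_comm j k]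
  have h2 : radMk ℓ (k + j) (x ^ ℓ ^ j / y ^ ℓ ^ k) = 0 := by rw [h1, radMk_pow_self]
  rwa [radMk_div, radMk_add_pow, sub_eq_zero, add_comm, radMk_add_pow, eq_comm, eq_comm] at h2

/-- Every `ℓ^k`-th root of unity has the form `g^(ℓ^n) ξ / ξ`. -/
theorem CyclotomicGenerator.exists_apply_div_eq (D : CyclotomicGenerator ℓ m g) (n k : ℕ) {η : Ω}
    (hη : η ^ ℓ ^ k = 1) :
    ∃ ξ : Ω, ξ ^ ℓ ^ (m + n + k) = 1 ∧ (g ^ ℓ ^ n) ξ = η * ξ := by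
  have hℓ : ℓ.Prime := Fact.out
  obtain ⟨u, hu, hu'⟩ := exists_one_add_pow_prime_pow D.pos D.two_le n
  obtain ⟨ξ, hξ⟩ := exists_primitiveRoot_pow (ℓ := ℓ) (Ω := Ω) (m + n + k)
  have hξ0 : ξ ≠ 0 := hξ.ne_zero (NeZero.ne _)
  have h1 : (g ^ ℓ ^ n) ξ = (ξ ^ ℓ ^ (m + n)) ^ u * ξ := by
    rw [D.pow_apply_root _ hξ.pow_eq_one, ← zpow_natCast, ← zpow_natCast, ← zpow_mul]
    push_cast
    rw [hu, zpow_add₀ hξ0, zpow_one, mul_comm]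
  have h2 : IsPrimitiveRoot (ξ ^ ℓ ^ (m + n)) (ℓ ^ k) :=
    hξ.pow (NeZero.pos _) (by rw [pow_add])
  have hcop : u.gcd ((ℓ ^ k : ℕ) : ℤ) = 1 := by
    rw [← Int.isCoprime_iff_gcd_eq_one, Nat.cast_pow]
    exact (((Nat.prime_iff_prime_int.1 hℓ).coprime_iff_not_dvd).2 hu').symm.pow_right
  have h3 := h2.zpow_of_gcd_eq_one u hcop
  obtain ⟨i, -, hi⟩ := h3.eq_pow_of_pow_eq_one hη
  refine ⟨ξ ^ i, by rw [← pow_mul, mul_comm, pow_mul, hξ.pow_eq_one, one_pow], ?_⟩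
  rw [map_pow, h1, mul_pow, hi]

/-- The radical of `K_n` embeds into the radical of `K_∞`. -/
theorem CyclotomicGenerator.radMap_layerUnits_injective (D : CyclotomicGenerator ℓ m g) (n : ℕ) :
    Function.Injective (radMap ℓ (layerUnits ℓ m K Ω n)) := by
  rw [injective_iff_map_eq_zero]
  intro r hr
  obtain ⟨k, hk⟩ := exists_eq_radMk r
  obtain ⟨x, rfl⟩ := hk k le_rfl
  rw [radMap_radMk] at hr
  obtain ⟨z, hz⟩ := exists_eq_pow_of_radMk_Kinf hr
  have hz' : (((x : layer ℓ m K Ω n) : Kinf ℓ K Ω) : Ω) = ((z : Kinf ℓ K Ω) : Ω) ^ ℓ ^ k := by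
    have := congrArg (fun u : (Kinf ℓ K Ω)ˣ => ((u : Kinf ℓ K Ω) : Ω)) hz
    exact this.trans (by simp)
  have hz0 : ((z : Kinf ℓ K Ω) : Ω) ≠ 0 := by simp
  set h := g ^ ℓ ^ n with hh
  have hmem : h ∈ rootFixer ℓ K Ω (m + n) := (D.pow_mem_rootFixer_iff n _).2 dvd_rfl
  have hx := (mem_layer_iff n ((x : layer ℓ m K Ω n) : Kinf ℓ K Ω)).1 (SetLike.coe_mem _) h hmem
  -- correct the root `z` of `x` by a root of unity to make it invariant
  obtain ⟨ξ, hξ, hξ'⟩ := D.exists_apply_div_eq n k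
    (η := h ((z : Kinf ℓ K Ω) : Ω) / ((z : Kinf ℓ K Ω) : Ω))
    (by rw [div_pow, ← map_pow, ← hz', hx, div_self (by simp)])
  have hξ0 : ξ ≠ 0 := by
    rintro rfl
    rw [zero_pow (NeZero.ne _)] at hξ
    exact zero_ne_one hξ
  have hw : ((z : Kinf ℓ K Ω) : Ω) / ξ ∈ Kinf ℓ K Ω :=
    div_mem (SetLike.coe_mem _) (root_mem_Kinf hξ)
  have hwfix : h (((z : Kinf ℓ K Ω) : Ω) / ξ) = ((z : Kinf ℓ K Ω) : Ω) / ξ := by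
    have hhz : h ((z : Kinf ℓ K Ω) : Ω) ≠ 0 := by simp
    rw [map_div₀, hξ']
    field_simp
  have hwlayer : (⟨_, hw⟩ : Kinf ℓ K Ω) ∈ layer ℓ m K Ω n :=
    (mem_layer_iff n _).2 (D.apply_eq_of_pow_apply_eq hw hwfix)
  have hw0 : (⟨_, hwlayer⟩ : layer ℓ m K Ω n) ≠ 0 := by
    intro h0
    have h1 : ((z : Kinf ℓ K Ω) : Ω) / ξ = 0 :=
      congrArg (fun u : layer ℓ m K Ω n => ((u : Kinf ℓ K Ω) : Ω)) h0
    exact div_ne_zero hz0 hξ0 h1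
  have htors : (x / Units.mk0 _ hw0 ^ ℓ ^ k) ^ ℓ ^ (m + n + k) = 1 := by
    apply Units.ext
    apply Subtype.ext
    apply Subtype.ext
    simp only [Units.val_div_eq_div_val, Units.val_pow_eq_pow_val, Units.val_mk0,
      IntermediateField.coe_div, IntermediateField.coe_pow, Units.val_one,
      IntermediateField.coe_one]
    rw [hz', div_pow _ _ (ℓ ^ k), div_div_eq_mul_div, mul_div_cancel_left₀ _ (pow_ne_zero _ hz0),
      ← pow_mul, mul_comm, pow_mul, hξ, one_pow]
  have h1 := radMk_eq_zero_of_pow_eq_one (ℓ := ℓ) k htors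
  rwa [radMk_div, radMk_pow_self, sub_zero] at h1

variable (γ : Kinf ℓ K Ω ≃ₐ[K] Kinf ℓ K Ω)

/-- The action of an automorphism of `K_∞` on the radical of `K_∞`. -/
def galInf : Radical ℓ (Kinf ℓ K Ω) →ₗ[ℤ_[ℓ]] Radical ℓ (Kinf ℓ K Ω) :=
  radMap ℓ (Units.map (γ : Kinf ℓ K Ω →* Kinf ℓ K Ω))

theorem radMap_layerUnits_galAct (n : ℕ) (r : Radical ℓ (layer ℓ m K Ω n)) :
    radMap ℓ (layerUnits ℓ m K Ω n) (galAct ℓ m K Ω n γ r) =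
      galInf γ (radMap ℓ (layerUnits ℓ m K Ω n) r) := by
  rw [galAct, galInf, radMap_radMap, radMap_radMap]
  rfl

theorem mem_gammaStarInvariants (n : ℕ) (r : Radical ℓ (layer ℓ m K Ω n)) :
    r ∈ gammaStarInvariants ℓ m K Ω n γ ↔
      galAct ℓ m K Ω n γ r = (1 + (ℓ : ℤ_[ℓ]) ^ m) • r := Iff.rfl

variable {γ}

theorem galInf_layerUnits {n : ℕ} {r : Radical ℓ (layer ℓ m K Ω n)}
    (hr : r ∈ gammaStarInvariants ℓ m K Ω n γ) :
    galInf γ (radMap ℓ (layerUnits ℓ m K Ω n) r) =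
      (1 + (ℓ : ℤ_[ℓ]) ^ m) • radMap ℓ (layerUnits ℓ m K Ω n) r := by
  rw [← radMap_layerUnits_galAct, (mem_gammaStarInvariants γ n r).1 hr, map_smul]

/-- On the invariants of `Γ*` the norm of `K_{n+1}/K_n` is the multiplication by an integer,
inside the radical of `K_∞`. -/
theorem CyclotomicGenerator.radMap_layerUnits_normMap (D : CyclotomicGenerator ℓ m g)
    (hg : ∀ x : Kinf ℓ K Ω, g (x : Ω) = γ x) {n : ℕ} {r : Radical ℓ (layer ℓ m K Ω (n + 1))}
    (hr : r ∈ gammaStarInvariants ℓ m K Ω (n + 1) γ) :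
    radMap ℓ (layerUnits ℓ m K Ω n) (normMap ℓ m K Ω n r) =
      (theta ℓ m n : ℤ_[ℓ]) • radMap ℓ (layerUnits ℓ m K Ω (n + 1)) r := by
  have hiter : ∀ i : ℕ, (galInf γ)^[i] (radMap ℓ (layerUnits ℓ m K Ω (n + 1)) r) =
      (1 + (ℓ : ℤ_[ℓ]) ^ m) ^ i • radMap ℓ (layerUnits ℓ m K Ω (n + 1)) r := by
    intro i
    induction i with
    | zero => simp
    | succ i ih =>
      rw [Function.iterate_succ_apply', ih, map_smul, galInf_layerUnits hr, smul_smul, pow_succ]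
  have hgpow : ∀ (i : ℕ) (x : Kinf ℓ K Ω), (g ^ i) (x : Ω) = ((γ ^ i) x : Kinf ℓ K Ω) := by
    intro i
    induction i with
    | zero => intro x; rfl
    | succ i ih => intro x; rw [pow_succ', pow_succ', AlgEquiv.mul_apply, ih, hg]; rfl
  have hθ : (theta ℓ m n : ℤ_[ℓ]) = ∑ i ∈ Finset.range ℓ, (1 + (ℓ : ℤ_[ℓ]) ^ m) ^ (ℓ ^ n * i) := by
    rw [theta]; push_cast; rfl
  rw [hθ, Finset.sum_smul]
  simp_rw [← hiter]
  obtain ⟨k, hk⟩ := exists_eq_radMk r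
  obtain ⟨x, rfl⟩ := hk k le_rfl
  have hgal : ∀ (i : ℕ) (y : (Kinf ℓ K Ω)ˣ), (galInf γ)^[i] (radMk ℓ k y) =
      radMk ℓ k (Units.map
        ((γ ^ i : Kinf ℓ K Ω ≃ₐ[K] Kinf ℓ K Ω) : Kinf ℓ K Ω →* Kinf ℓ K Ω) y) := by
    intro i y
    induction i with
    | zero => rfl
    | succ i ih =>
      rw [Function.iterate_succ_apply', ih, galInf, radMap_radMk]
      congr 1
      apply Units.ext
      change γ ((γ ^ i) y) = (γ ^ (i + 1)) y
      rw [pow_succ', AlgEquiv.mul_apply]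
  have hsum : ∀ (s : Finset ℕ) (f : ℕ → (Kinf ℓ K Ω)ˣ),
      radMk ℓ k (∏ i ∈ s, f i) = ∑ i ∈ s, radMk ℓ k (f i) := by
    intro s f
    induction s using Finset.induction_on with
    | empty => simp [radMk_one]
    | insert a s ha ih => rw [Finset.prod_insert ha, Finset.sum_insert ha, radMk_mul, ih]
  simp only [radMap_radMk, hgal]
  rw [← hsum, normMap, radMap_radMk, radMap_radMk]
  congr 1
  apply Units.ext
  apply Subtype.ext
  refine (D.coe_norm_layer n (x : layer ℓ m K Ω (n + 1))).trans ?_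
  rw [Units.coe_prod]
  refine Eq.trans ?_ (map_prod (Kinf ℓ K Ω).val _ _).symm
  exact Finset.prod_congr rfl fun i _ => hgpow _ _

end RadicalTower

/-! ### Kummer characters -/

section KummerCharacter

variable {ℓ : ℕ} {m : ℕ} {K Ω : Type*} [Field K] [Field Ω] [Algebra K Ω] [IsGalois K Ω]
  [Fact ℓ.Prime] [IsAlgClosed Ω] [CharZero Ω] {g : Ω ≃ₐ[K] Ω}

theorem coe_smul_units (σ : Ω ≃ₐ[K] Ω) (t : Ωˣ) : ((σ • t : Ωˣ) : Ω) = σ t := rfl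

theorem smul_units_eq_iff {σ : Ω ≃ₐ[K] Ω} {t : Ωˣ} : σ • t = t ↔ σ (t : Ω) = t := by
  rw [Units.ext_iff, coe_smul_units]

theorem IsLogarithm.injOn {L : Additive Ωˣ →+ QmodZ ℓ} (hL : IsLogarithm L) {n k : ℕ} {ξ η : Ωˣ}
    (hξ : ξ ^ ℓ ^ n = 1) (hη : η ^ ℓ ^ k = 1) (h : L (.ofMul ξ) = L (.ofMul η)) : ξ = η := by
  rw [← div_eq_one]
  refine hL (n + k) _ ?_ ?_
  · rw [div_pow, pow_add, pow_mul, hξ, one_pow, mul_comm, pow_mul, hη, one_pow, div_one]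
  · rw [ofMul_div, map_sub, h, sub_self]

theorem smul_div_pow_eq_one {σ : Ω ≃ₐ[K] Ω} {t : Ωˣ} {k : ℕ} {x : Ω} (ht : (t : Ω) ^ k = x)
    (hx : σ x = x) : (σ • t / t) ^ k = 1 := by
  rw [div_pow, div_eq_one, Units.ext_iff, Units.val_pow_eq_pow_val, Units.val_pow_eq_pow_val,
    coe_smul_units, ← map_pow, ht, hx]

theorem smul_root_eq {k : ℕ} {ξ : Ωˣ} (hξ : ξ ^ ℓ ^ k = 1) {σ : Ω ≃ₐ[K] Ω}
    (hσ : σ ∈ rootFixer ℓ K Ω k) : σ • ξ = ξ :=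
  smul_units_eq_iff.2 (hσ ξ (by rw [← Units.val_pow_eq_pow_val, hξ, Units.val_one]))

/-- `σ ↦ σ t / t` is multiplicative where its values are fixed. -/
theorem smul_mul_div (σ τ : Ω ≃ₐ[K] Ω) (t : Ωˣ) (h : σ • (τ • t / t) = τ • t / t) :
    (σ * τ) • t / t = (σ • t / t) * (τ • t / t) := by
  rw [smul_div', ← mul_smul] at h
  rw [← h, mul_comm, div_mul_div_cancel]

theorem apply_Kinf {σ : Ω ≃ₐ[K] Ω} (hσ : σ ∈ (Kinf ℓ K Ω).fixingSubgroup) (x : Kinf ℓ K Ω) :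
    σ (x : Ω) = x := (IntermediateField.mem_fixingSubgroup_iff _ _).1 hσ x x.2

/-- Elements of the radical of `K_∞` with the same Kummer character are equal. -/
theorem IsLogarithm.radMk_eq {L : Additive Ωˣ →+ QmodZ ℓ} (hL : IsLogarithm L) {k j : ℕ}
    {x y : (Kinf ℓ K Ω)ˣ} {t s : Ωˣ} (ht : (t : Ω) ^ ℓ ^ k = (x : Kinf ℓ K Ω))
    (hs : (s : Ω) ^ ℓ ^ j = (y : Kinf ℓ K Ω))
    (h : ∀ σ ∈ (Kinf ℓ K Ω).fixingSubgroup,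
      L (.ofMul (σ • t / t)) = L (.ofMul (σ • s / s))) : radMk ℓ k x = radMk ℓ j y := by
  refine radMk_eq_of_div_mem ht hs ((mem_Kinf_iff _).2 fun σ hσ => ?_)
  have hσ' := mem_fixingSubgroup_Kinf.2 hσ
  have h1 := hL.injOn (smul_div_pow_eq_one ht (apply_Kinf hσ' _))
    (smul_div_pow_eq_one hs (apply_Kinf hσ' _)) (h σ hσ')
  have h2 : σ • (t / s) = t / s := by
    rw [smul_div', div_eq_div_iff_mul_eq_mul]
    rw [div_eq_div_iff_mul_eq_mul] at h1
    rw [h1, mul_comm]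
  have h3 := smul_units_eq_iff.1 h2
  rwa [Units.val_div_eq_div_val] at h3

/-- The homomorphism `d` restricts on `Gal(Ω/K_∞)` to the Kummer character `σ ↦ L (σ t / t)` of the
element `v = ℓ^{-k} ⊗ t^(ℓ^k)` of the radical of `K_∞`, whatever the representation of `v`. -/
def IsKummerCharacter (L : Additive Ωˣ →+ QmodZ ℓ) (d : Additive (Ω ≃ₐ[K] Ω) →+ QmodZ ℓ)
    (v : Radical ℓ (Kinf ℓ K Ω)) : Prop :=
  ∀ (k : ℕ) (x : (Kinf ℓ K Ω)ˣ) (t : Ωˣ), (t : Ω) ^ ℓ ^ k = (x : Kinf ℓ K Ω) → v = radMk ℓ k x →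
    ∀ σ ∈ (Kinf ℓ K Ω).fixingSubgroup, d (.ofMul σ) = L (.ofMul (σ • t / t))

theorem IsKummerCharacter.of_root {L : Additive Ωˣ →+ QmodZ ℓ} {d : Additive (Ω ≃ₐ[K] Ω) →+ QmodZ ℓ}
    {k : ℕ} {x : (Kinf ℓ K Ω)ˣ} {t : Ωˣ} (ht : (t : Ω) ^ ℓ ^ k = (x : Kinf ℓ K Ω))
    (h : ∀ σ ∈ (Kinf ℓ K Ω).fixingSubgroup, d (.ofMul σ) = L (.ofMul (σ • t / t))) :
    IsKummerCharacter L d (radMk ℓ k x) := by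
  intro j y s hs hv σ hσ
  rw [h σ hσ]
  have h1 : σ ((t / s : Ωˣ) : Ω) = (t / s : Ωˣ) := by
    have := apply_div_eq_of_radMk_eq hv ht hs
    rw [← Units.val_div_eq_div_val] at this
    exact apply_Kinf hσ ⟨_, this⟩
  have h2 := smul_units_eq_iff.2 h1
  rw [smul_div', div_eq_div_iff_mul_eq_mul] at h2
  congr 2
  rw [div_eq_div_iff_mul_eq_mul, h2, mul_comm]

/-- Roots are taken in `Ωˣ`, so that the quotients `σ • t / t` live in a group. -/
theorem exists_units_pow_eq (k : ℕ) (x : Ω) (hx : x ≠ 0) : ∃ t : Ωˣ, (t : Ω) ^ ℓ ^ k = x := by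
  obtain ⟨t, ht⟩ := IsAlgClosed.exists_pow_nat_eq x (NeZero.pos (ℓ ^ k))
  have ht0 : t ≠ 0 := by
    rintro rfl
    rw [zero_pow (NeZero.ne _)] at ht
    exact hx ht.symm
  exact ⟨Units.mk0 t ht0, ht⟩

/-- The Kummer character of `ℓ^{-m} ⊗ x`, for `x ∈ Kˣ`, is defined on the whole Galois group. -/
theorem CyclotomicGenerator.exists_kummer_character (D : CyclotomicGenerator ℓ m g)
    {L : Additive Ωˣ →+ QmodZ ℓ} {a : K} {y : Ωˣ} (hy : (y : Ω) ^ ℓ ^ m = algebraMap K Ω a) :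
    ∃ d : Additive (Ω ≃ₐ[K] Ω) →+ QmodZ ℓ, (∀ σ, d (.ofMul σ) = L (.ofMul (σ • y / y))) ∧
      IsOpen {σ : Ω ≃ₐ[K] Ω | d (.ofMul σ) = 0} ∧ ∀ σ, (ℓ : ℤ_[ℓ]) ^ m • d σ = 0 := by
  have hroot : ∀ σ : Ω ≃ₐ[K] Ω, (σ • y / y) ^ ℓ ^ m = 1 := fun σ =>
    smul_div_pow_eq_one hy (σ.commutes a)
  let d : Additive (Ω ≃ₐ[K] Ω) →+ QmodZ ℓ :=
    AddMonoidHom.mk' (fun σ => L (.ofMul (σ.toMul • y / y))) fun σ τ => by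
      rw [toMul_add, smul_mul_div _ _ _ (smul_root_eq (hroot _)
        (by rw [D.rootFixer_eq_top]; trivial)), ofMul_mul, map_add]
  refine ⟨d, fun σ => rfl, isOpen_ker_of_stabilizer d (y : Ω) fun σ hσ => ?_, fun σ => ?_⟩
  · change L (.ofMul (σ • y / y)) = 0
    rw [smul_units_eq_iff.2 hσ, div_self', ofMul_one, map_zero]
  · change (ℓ : ℤ_[ℓ]) ^ m • L (.ofMul (σ.toMul • y / y)) = 0
    rw [← Nat.cast_pow, Nat.cast_smul_eq_nsmul, ← map_nsmul, ← ofMul_pow, hroot, ofMul_one,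
      map_zero]

/-- An automorphism that fixes all the fields of a family fixes their compositum. -/
theorem apply_eq_of_mem_sSup {S : Set (IntermediateField K Ω)} {σ : Ω ≃ₐ[K] Ω}
    (h : ∀ E ∈ S, ∀ y ∈ E, σ y = y) {y : Ω} (hy : y ∈ sSup S) : σ y = y := by
  have h1 : sSup S ≤ IntermediateField.fixedField (Subgroup.zpowers σ) := by
    refine sSup_le fun E hE x hx => ?_
    rw [IntermediateField.mem_fixedField_iff]
    intro f hf
    exact (Subgroup.zpowers_le (H := MulAction.stabilizer (Ω ≃ₐ[K] Ω) x)).2 (h E hE x hx) hf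
  exact (IntermediateField.mem_fixedField_iff _ _).1 (h1 hy) σ (Subgroup.mem_zpowers σ)

/-- If an `ℓ^m`-th root of an element of `K` lies in the compositum of the `ℤ_ℓ`-extensions, its
Kummer character lifts to `ℤ_ℓ`. -/
theorem CyclotomicGenerator.exists_lift_of_mem_ZlCompositum (D : CyclotomicGenerator ℓ m g)
    {L : Additive Ωˣ →+ QmodZ ℓ} {a : K} {y : Ωˣ}
    (hy : (y : Ω) ^ ℓ ^ m = algebraMap K Ω a) (hZ : (y : Ω) ∈ ZlCompositum ℓ K Ω) :
    ∃ ρ : Additive (Ω ≃ₐ[K] Ω) →+ ℤ_[ℓ], Continuous (fun σ : Ω ≃ₐ[K] Ω => ρ (.ofMul σ)) ∧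
      ∀ σ, L (.ofMul (σ • y / y)) = ρ (.ofMul σ) • frac ℓ m := by
  obtain ⟨d, hd, hopen, htors⟩ := D.exists_kummer_character (L := L) hy
  obtain ⟨ρ, hρ, hdρ⟩ := exists_padicInt_lift d hopen m htors fun σ hσ => by
    have h1 : σ (y : Ω) = y := by
      refine apply_eq_of_mem_sSup (fun E hE z hz => ?_) hZ
      obtain ⟨ρ, hρ, hρ'⟩ := IsZlExtension.exists_hom hE
      exact hρ' σ (hσ ρ hρ) z hz
    rw [hd, smul_units_eq_iff.2 h1, div_self', ofMul_one, map_zero]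
  exact ⟨ρ, hρ, fun σ => by rw [← hd, hdρ]⟩

/-- An element fixed by the kernel of a continuous homomorphism to `ℤ_ℓ`, possibly trivial, lies in
a `ℤ_ℓ`-extension. -/
theorem CyclotomicGenerator.exists_isZlExtension_mem (D : CyclotomicGenerator ℓ m g)
    (ρ : Additive (Ω ≃ₐ[K] Ω) →+ ℤ_[ℓ]) (hρ : Continuous fun σ : Ω ≃ₐ[K] Ω => ρ (.ofMul σ))
    {y : Ω} (hy : ∀ σ : Ω ≃ₐ[K] Ω, ρ (.ofMul σ) = 0 → σ y = y) :
    ∃ E : IntermediateField K Ω, IsZlExtension ℓ E ∧ y ∈ E := by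
  by_cases hne : ρ = 0
  · obtain ⟨E, hE, -⟩ := D.exists_isZlExtension_Kinf_le
    obtain ⟨a, rfl⟩ := (InfiniteGalois.mem_range_algebraMap_iff_fixed y).2 fun σ =>
      hy σ (by rw [hne]; rfl)
    exact ⟨E, hE, E.algebraMap_mem a⟩
  · obtain ⟨E, hE, hmem⟩ := exists_isZlExtension ρ hρ hne
    exact ⟨E, hE, (hmem y).2 hy⟩

theorem kummerExt_le_iff {k : ℕ} {x : (Kinf ℓ K Ω)ˣ} {t : Ωˣ}
    (ht : (t : Ω) ^ ℓ ^ k = (x : Kinf ℓ K Ω)) (E : IntermediateField K Ω) :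
    kummerExt ℓ K Ω k x ≤ E ↔ Kinf ℓ K Ω ≤ E ∧ (t : Ω) ∈ E := by
  constructor
  · intro h
    refine ⟨fun z hz => h ?_, h ?_⟩
    · rw [kummerExt, IntermediateField.mem_restrictScalars]
      exact IntermediateField.algebraMap_mem _ (⟨z, hz⟩ : Kinf ℓ K Ω)
    · rw [kummerExt, IntermediateField.mem_restrictScalars]
      exact IntermediateField.subset_adjoin _ _ ht
  · rintro ⟨h, htE⟩
    have h1 : IntermediateField.adjoin (Kinf ℓ K Ω)
        {y : Ω | y ^ ℓ ^ k = algebraMap (Kinf ℓ K Ω) Ω x} ≤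
          IntermediateField.extendScalars h := by
      rw [IntermediateField.adjoin_le_iff]
      intro y hy
      rw [SetLike.mem_coe, IntermediateField.mem_extendScalars]
      have h2 : y / t ∈ Kinf ℓ K Ω := by
        refine root_mem_Kinf (k := k) ?_
        rw [div_pow, show y ^ ℓ ^ k = (t : Ω) ^ ℓ ^ k from hy.trans ht.symm,
          div_self (pow_ne_zero _ t.ne_zero)]
      have h3 := mul_mem (h h2) htE
      rwa [div_mul_cancel₀ _ t.ne_zero] at h3
    intro y hy
    rw [kummerExt, IntermediateField.mem_restrictScalars] at hy
    exact IntermediateField.mem_extendScalars h |>.1 (h1 hy)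

end KummerCharacter

/-! ### The radical of the compositum of the embeddable cyclic extensions -/

section EmbeddableExtensions

variable {ℓ : ℕ} {m : ℕ} {K Ω : Type*} [Field K] [Field Ω] [Algebra K Ω] [IsGalois K Ω]
  [Fact ℓ.Prime] [IsAlgClosed Ω] [CharZero Ω] {g : Ω ≃ₐ[K] Ω}

/-- The extension generated by an `ℓ^m`-th root of an element of `K`, which contains the `ℓ^m`-th
roots of unity, is cyclic of exponent dividing `ℓ^m`. -/
theorem CyclotomicGenerator.isCyclic_adjoin_root (D : CyclotomicGenerator ℓ m g) {a : K} {y : Ωˣ}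
    (hy : (y : Ω) ^ ℓ ^ m = algebraMap K Ω a) :
    IsGalois K (IntermediateField.adjoin K {(y : Ω)}) ∧
      IsCyclic (IntermediateField.adjoin K {(y : Ω)} ≃ₐ[K] IntermediateField.adjoin K {(y : Ω)}) ∧
      Monoid.exponent (IntermediateField.adjoin K {(y : Ω)} ≃ₐ[K]
        IntermediateField.adjoin K {(y : Ω)}) ∣ ℓ ^ m := by
  set E := IntermediateField.adjoin K {(y : Ω)} with hE
  have hroot : ∀ σ : Ω ≃ₐ[K] Ω, (σ • y / y) ^ ℓ ^ m = 1 := fun σ =>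
    smul_div_pow_eq_one hy (σ.commutes a)
  have hfixed : ∀ σ τ : Ω ≃ₐ[K] Ω, σ • (τ • y / y) = τ • y / y := fun σ τ =>
    smul_root_eq (hroot τ) (by rw [D.rootFixer_eq_top]; trivial)
  have hmem : ∀ σ : Ω ≃ₐ[K] Ω, σ ∈ E.fixingSubgroup ↔ σ • y / y = 1 := by
    intro σ
    rw [div_eq_one, smul_units_eq_iff, IntermediateField.mem_fixingSubgroup_iff]
    refine ⟨fun h => h y (IntermediateField.mem_adjoin_simple_self K _), fun h z hz => ?_⟩
    exact (mem_adjoin_iff_fixed _ z).1 hz σ (by rintro _ rfl; exact h)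
  let χ : (Ω ≃ₐ[K] Ω) →* Ωˣ := MonoidHom.mk' (fun σ => σ • y / y)
    fun σ τ => smul_mul_div _ _ _ (hfixed _ _)
  have hker : E.fixingSubgroup = χ.ker := by
    ext σ; exact hmem σ
  have hGal : IsGalois K E := by
    rw [← InfiniteGalois.normal_iff_isGalois, hker]
    infer_instance
  have hfin : FiniteDimensional K E :=
    IntermediateField.adjoin.finiteDimensional (Algebra.IsIntegral.isIntegral _)
  have hsurj := AlgEquiv.restrictNormalHom_surjective (F := K) (K₁ := E) Ω
  have hkerr : (AlgEquiv.restrictNormalHom E : (Ω ≃ₐ[K] Ω) →* _).ker = χ.ker := by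
    rw [IntermediateField.restrictNormalHom_ker, hker]
  let χ' : (E ≃ₐ[K] E) →* Ωˣ :=
    (AlgEquiv.restrictNormalHom E : (Ω ≃ₐ[K] Ω) →* _).liftOfSurjective hsurj ⟨χ, hkerr.le⟩
  have hχ' : ∀ σ, χ' (AlgEquiv.restrictNormalHom E σ) = χ σ := fun σ =>
    (AlgEquiv.restrictNormalHom E : (Ω ≃ₐ[K] Ω) →* _).liftOfRightInverse_comp_apply _ _
      ⟨χ, hkerr.le⟩ σ
  have hinj : Function.Injective χ' := by
    rw [injective_iff_map_eq_one]
    intro τ hτ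
    obtain ⟨σ, rfl⟩ := hsurj τ
    rw [hχ'] at hτ
    have : σ ∈ (AlgEquiv.restrictNormalHom E : (Ω ≃ₐ[K] Ω) →* _).ker := by rw [hkerr]; exact hτ
    exact this
  refine ⟨hGal, ?_, Monoid.exponent_dvd_of_forall_pow_eq_one fun τ => ?_⟩
  · exact isCyclic_of_injective_ringHom ((Units.coeHom Ω).comp χ')
      (Units.val_injective.comp hinj)
  · apply hinj
    obtain ⟨σ, rfl⟩ := hsurj τ
    rw [map_pow, hχ', map_one]
    exact hroot σ

/-- **Kummer theory**: a cyclic extension of `K` of exponent dividing `ℓ^m` is generated by an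
`ℓ^m`-th root of an element of `K`. -/
theorem CyclotomicGenerator.exists_kummer_generator (D : CyclotomicGenerator ℓ m g)
    (E : IntermediateField K Ω) [IsGalois K E] [IsCyclic (E ≃ₐ[K] E)]
    (hexp : Monoid.exponent (E ≃ₐ[K] E) ∣ ℓ ^ m) :
    ∃ (a : K) (y : Ωˣ), (y : Ω) ^ ℓ ^ m = algebraMap K Ω a ∧ (y : Ω) ∈ E ∧
      ∀ σ : Ω ≃ₐ[K] Ω, σ y = y → ∀ z ∈ E, σ z = z := by
  obtain ⟨ζ, hζ⟩ := D.exists_root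
  obtain ⟨ζ, rfl⟩ := hζ.isUnit (NeZero.ne _)
  have hζ' : IsPrimitiveRoot ζ (ℓ ^ m) := IsPrimitiveRoot.coe_units_iff.1 hζ
  obtain ⟨c, hc⟩ := hexp
  rw [IsCyclic.exponent_eq_card] at hc
  have hcard : Nat.card (E ≃ₐ[K] E) ≠ 0 := fun h0 => NeZero.ne (ℓ ^ m) (by rw [hc, h0, zero_mul])
  have hfin : Finite (E ≃ₐ[K] E) := Nat.finite_of_card_ne_zero hcard
  have hζc : IsPrimitiveRoot (ζ ^ c) (Nat.card (E ≃ₐ[K] E)) :=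
    hζ'.pow (NeZero.pos _) (by rw [hc, mul_comm])
  let e : (E ≃ₐ[K] E) ≃* Subgroup.zpowers (ζ ^ c) :=
    mulEquivOfCyclicCardEq (by rw [Nat.card_zpowers, ← hζc.eq_orderOf])
  let r : (Ω ≃ₐ[K] Ω) →* (E ≃ₐ[K] E) := AlgEquiv.restrictNormalHom E
  let χ : (Ω ≃ₐ[K] Ω) →* Kˣ := (Subgroup.zpowers (ζ ^ c)).subtype.comp (e.toMonoidHom.comp r)
  have hχ : ∀ σ, χ σ = 1 ↔ σ ∈ E.fixingSubgroup := by
    intro σ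
    rw [← IntermediateField.restrictNormalHom_ker, MonoidHom.mem_ker]
    change ((e (r σ) : Subgroup.zpowers (ζ ^ c)) : Kˣ) = 1 ↔ r σ = 1
    rw [OneMemClass.coe_eq_one, map_eq_one_iff e e.injective]
  have hopen : IsOpen (E.fixingSubgroup : Set (Ω ≃ₐ[K] Ω)) := by
    have hfi : E.fixingSubgroup.FiniteIndex := by
      rw [← IntermediateField.restrictNormalHom_ker]
      infer_instance
    exact Subgroup.isOpen_of_isClosed_of_finiteIndex _
      (InfiniteGalois.fixingSubgroup_isClosed E)
  obtain ⟨s, hs⟩ := exists_stabilizer_subset hopen (one_mem E.fixingSubgroup)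
  obtain ⟨y, hy⟩ := exists_apply_eq_character_mul χ s fun σ hσ => (hχ σ).2 (hs σ hσ)
  have hχm : ∀ σ, χ σ ^ ℓ ^ m = 1 := by
    intro σ
    obtain ⟨i, hi⟩ := (e (r σ)).2
    change ((e (r σ) : Subgroup.zpowers (ζ ^ c)) : Kˣ) ^ ℓ ^ m = 1
    rw [← hi]
    change ((ζ ^ c) ^ i) ^ ℓ ^ m = 1
    rw [← zpow_natCast, ← zpow_mul, mul_comm, zpow_mul, zpow_natCast, ← pow_mul, mul_comm c,
      pow_mul, hζ'.pow_eq_one, one_pow, one_zpow]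
  obtain ⟨a, ha⟩ := (InfiniteGalois.mem_range_algebraMap_iff_fixed (k := K) ((y : Ω) ^ ℓ ^ m)).2
    fun σ => by
      rw [map_pow, hy, mul_pow, ← map_pow, ← Units.val_pow_eq_pow_val, hχm, Units.val_one, map_one,
        one_mul]
  refine ⟨a, y, ha.symm, ?_, fun σ hσ z hz => ?_⟩
  · rw [← InfiniteGalois.fixedField_fixingSubgroup E, IntermediateField.mem_fixedField_iff]
    intro σ hσ
    rw [hy, (hχ σ).2 hσ, Units.val_one, map_one, one_mul]
  · refine (IntermediateField.mem_fixingSubgroup_iff _ _).1 ((hχ σ).1 ?_) z hz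
    have h1 := hy σ
    rw [hσ, eq_comm, mul_eq_right₀ y.ne_zero, map_eq_one_iff _ (algebraMap K Ω).injective] at h1
    exact Units.ext h1

theorem CyclotomicGenerator.Kinf_le_embeddableCompositum (D : CyclotomicGenerator ℓ m g) :
    Kinf ℓ K Ω ≤ embeddableCompositum ℓ m K Ω := by
  obtain ⟨E, hE, -⟩ := D.exists_isZlExtension_Kinf_le
  have h1 := D.isCyclic_adjoin_root (a := 1) (y := 1) (by simp)
  refine le_trans le_sup_right (le_sSup ⟨_, h1.1, h1.2.1, h1.2.2, ⟨E, hE, ?_⟩, rfl⟩)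
  rw [IntermediateField.adjoin_simple_le_iff]
  exact one_mem E

/-- The radical attached to `Z` maps into the radical of the compositum of the cyclic extensions
that embed into `ℤ_ℓ`-extensions. -/
theorem CyclotomicGenerator.mem_embeddableCompositum (D : CyclotomicGenerator ℓ m g)
    {L : Additive Ωˣ →+ QmodZ ℓ} (hL : IsLogarithm L) {a : K} {y : Ωˣ}
    (hy : (y : Ω) ^ ℓ ^ m = algebraMap K Ω a) (hZ : (y : Ω) ∈ ZlCompositum ℓ K Ω) :
    (y : Ω) ∈ embeddableCompositum ℓ m K Ω := by
  obtain ⟨ρ, hρ, hρy⟩ := D.exists_lift_of_mem_ZlCompositum (L := L) hy hZ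
  obtain ⟨E, hE, hyE⟩ := D.exists_isZlExtension_mem ρ hρ (y := y) fun σ hσ => by
    have h1 := hρy σ
    rw [hσ, zero_smul] at h1
    exact smul_units_eq_iff.1 (div_eq_one.1 (hL m _ (smul_div_pow_eq_one hy (σ.commutes a)) h1))
  obtain ⟨h1, h2, h3⟩ := D.isCyclic_adjoin_root hy
  have h4 : IntermediateField.adjoin K {(y : Ω)} ⊔ Kinf ℓ K Ω ≤ embeddableCompositum ℓ m K Ω :=
    le_sSup ⟨_, h1, h2, h3, ⟨E, hE, IntermediateField.adjoin_simple_le_iff.2 hyE⟩, rfl⟩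
  exact h4 (le_sup_left (a := IntermediateField.adjoin K {(y : Ω)})
    (IntermediateField.mem_adjoin_simple_self K _))

end EmbeddableExtensions

section Duality

variable {ℓ : ℕ} [Fact ℓ.Prime]

/-- A homomorphism to `ℚ_ℓ / ℤ_ℓ` that vanishes on the kernel of another homomorphism factors
through it. -/
theorem QmodZ.exists_factor {A B : Type*} [AddGroup A] [AddCommGroup B] (R : A →+ B)
    (ψ : A →+ QmodZ ℓ) (h : ∀ a, R a = 0 → ψ a = 0) : ∃ f : B →+ QmodZ ℓ, ∀ a, f (R a) = ψ a := by
  obtain ⟨f, hf⟩ := QmodZ.exists_extension R.range.subtype Subtype.val_injective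
    ((QuotientAddGroup.lift R.ker ψ fun a ha => h a ha).comp
      (QuotientAddGroup.quotientKerEquivRange R).symm.toAddMonoidHom)
  refine ⟨f, fun a => (hf (R.rangeRestrict a)).trans ?_⟩
  have h1 : (QuotientAddGroup.quotientKerEquivRange R).symm (R.rangeRestrict a) =
      (a : A ⧸ R.ker) := (AddEquiv.symm_apply_eq _).2 rfl
  exact (congrArg (QuotientAddGroup.lift R.ker ψ fun a ha => h a ha) h1).trans rfl

/-- A character that is trivial on the common kernel of finitely many characters of exponent
`ℓ^m` is a combination of them. -/
theorem QmodZ.exists_combination {A I : Type*} [AddGroup A] [Fintype I] (d : I → A →+ QmodZ ℓ)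
    (m : ℕ) (hd : ∀ i a, (ℓ : ℤ_[ℓ]) ^ m • d i a = 0) (ψ : A →+ QmodZ ℓ)
    (h : ∀ a, (∀ i, d i a = 0) → ψ a = 0) : ∃ n : I → ℕ, ∀ a, ψ a = ∑ i, n i • d i a := by
  classical
  let R : A →+ (I → QmodZ ℓ) := AddMonoidHom.mk' (fun a i => d i a)
    fun a b => by ext i; exact map_add _ _ _
  obtain ⟨f, hf⟩ := QmodZ.exists_factor R ψ fun a ha => h a fun i => congrFun ha i
  have htors : ∀ i, (ℓ : ℤ_[ℓ]) ^ m • f (Pi.single i (frac ℓ m)) = 0 := by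
    intro i
    rw [← Nat.cast_pow, Nat.cast_smul_eq_nsmul, ← map_nsmul, ← Pi.single_smul,
      ← Nat.cast_smul_eq_nsmul ℤ_[ℓ], Nat.cast_pow, pow_smul_frac_self, Pi.single_zero, map_zero]
  choose n hn using fun i => exists_smul_frac_of_pow_smul_eq_zero (htors i)
  refine ⟨n, fun a => ?_⟩
  rw [← hf, ← Finset.univ_sum_single (R a), map_sum]
  refine Finset.sum_congr rfl fun i _ => ?_
  obtain ⟨k, hk⟩ := exists_smul_frac_of_pow_smul_eq_zero (hd i a)
  change f (Pi.single i (d i a)) = n i • d i a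
  rw [hk, Pi.single_smul, map_nsmul, hn, smul_comm]

end Duality

section KummerRadical

variable {ℓ : ℕ} {m : ℕ} {K Ω : Type*} [Field K] [Field Ω] [Algebra K Ω] [IsGalois K Ω]
  [Fact ℓ.Prime] [IsAlgClosed Ω] [CharZero Ω] {g : Ω ≃ₐ[K] Ω}

theorem CyclotomicGenerator.Kinf_le_ZlCompositum (D : CyclotomicGenerator ℓ m g) :
    Kinf ℓ K Ω ≤ ZlCompositum ℓ K Ω := by
  obtain ⟨E, hE, h⟩ := D.exists_isZlExtension_Kinf_le
  exact h.trans (le_sSup hE)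

/-- The compositum of the embeddable cyclic extensions is generated over `K_∞` by the `ℓ^m`-th
roots, of elements of `K`, that lie in `Z`. -/
theorem CyclotomicGenerator.apply_embeddableCompositum (D : CyclotomicGenerator ℓ m g)
    {σ : Ω ≃ₐ[K] Ω} (hσ : σ ∈ (Kinf ℓ K Ω).fixingSubgroup)
    (h : ∀ (a : K) (y : Ωˣ), (y : Ω) ^ ℓ ^ m = algebraMap K Ω a → (y : Ω) ∈ ZlCompositum ℓ K Ω →
      σ y = y) {t : Ω} (ht : t ∈ embeddableCompositum ℓ m K Ω) : σ t = t := by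
  refine apply_eq_of_mem_sSup ?_ ht
  rintro _ ⟨E, hE, hcyc, hexp, ⟨E', hE', hEE'⟩, rfl⟩
  obtain ⟨a, y, hy, hyE, hyσ⟩ := D.exists_kummer_generator E hexp
  have hfix := hyσ σ (h a y hy (le_sSup (a := E') hE' (hEE' hyE)))
  intro z hz
  rw [← sSup_pair] at hz
  refine apply_eq_of_mem_sSup ?_ hz
  rintro F (rfl | rfl)
  · exact hfix
  · exact fun x hx => apply_Kinf hσ ⟨x, hx⟩

/-- An element of the Kummer radical of the compositum of the embeddable cyclic extensions comes
from an `ℓ^m`-th root, of an element of `K`, that lies in `Z`: its Kummer character is a combination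
of finitely many characters of such roots. -/
theorem CyclotomicGenerator.exists_mem_ZlCompositum (D : CyclotomicGenerator ℓ m g)
    {L : Additive Ωˣ →+ QmodZ ℓ} (hL : IsLogarithm L) {k : ℕ} {x : (Kinf ℓ K Ω)ˣ} {t : Ωˣ}
    (ht : (t : Ω) ^ ℓ ^ k = (x : Kinf ℓ K Ω)) (htE : (t : Ω) ∈ embeddableCompositum ℓ m K Ω) :
    ∃ (a : Kˣ) (y : Ωˣ), (y : Ω) ^ ℓ ^ m = algebraMap K Ω a ∧ (y : Ω) ∈ ZlCompositum ℓ K Ω ∧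
      radMk ℓ k x = radMk ℓ m (unitsToKinf ℓ K Ω a) := by
  let S := {p : Kˣ × Ωˣ // ((p.2 : Ωˣ) : Ω) ^ ℓ ^ m = algebraMap K Ω p.1 ∧
    ((p.2 : Ωˣ) : Ω) ∈ ZlCompositum ℓ K Ω}
  have hstab : ∀ y : Ω, IsClosed {σ : Ω ≃ₐ[K] Ω | σ y = y} := fun y =>
    Subgroup.isClosed_of_isOpen (MulAction.stabilizer (Ω ≃ₐ[K] Ω) y)
      (stabilizer_isOpen_of_isIntegral y)
  -- by compactness, `t` is generated by finitely many of these roots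
  obtain ⟨s, hs⟩ := (((InfiniteGalois.fixingSubgroup_isClosed (Kinf ℓ K Ω)).inter
      (stabilizer_isOpen_of_isIntegral (K := K) (t : Ω)).isClosed_compl).isCompact
    ).elim_finite_subfamily_closed (fun p : S => {σ : Ω ≃ₐ[K] Ω | σ (p.1.2 : Ω) = p.1.2})
    (fun p => hstab _) (by
      rw [Set.eq_empty_iff_forall_notMem]
      rintro σ ⟨⟨hσ, hσt⟩, hσ'⟩
      refine hσt (D.apply_embeddableCompositum hσ (fun a y hy hyZ => ?_) htE)
      have ha : a ≠ 0 := by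
        rintro rfl
        rw [map_zero] at hy
        exact pow_ne_zero _ y.ne_zero hy
      exact Set.mem_iInter.1 hσ' ⟨(Units.mk0 a ha, y), hy, hyZ⟩)
  let H := (Kinf ℓ K Ω).fixingSubgroup
  have hrootk : ∀ σ : H, (σ.1 • t / t) ^ ℓ ^ k = 1 := fun σ =>
    smul_div_pow_eq_one ht (apply_Kinf σ.2 _)
  have hrootm : ∀ (p : S) (σ : Ω ≃ₐ[K] Ω), (σ • p.1.2 / p.1.2) ^ ℓ ^ m = 1 := fun p σ =>
    smul_div_pow_eq_one p.2.1 (σ.commutes _)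
  let ψ : Additive H →+ QmodZ ℓ := AddMonoidHom.mk' (fun σ => L (.ofMul (σ.toMul.1 • t / t)))
    fun σ τ => by
      rw [← map_add, ← ofMul_mul, ← smul_mul_div _ _ _ (smul_root_eq (hrootk _)
        (mem_fixingSubgroup_Kinf.1 σ.toMul.2 _))]
      rfl
  let d : s → Additive H →+ QmodZ ℓ := fun p =>
    AddMonoidHom.mk' (fun σ => L (.ofMul (σ.toMul.1 • p.1.1.2 / p.1.1.2))) fun σ τ => by
      rw [← map_add, ← ofMul_mul, ← smul_mul_div _ _ _ (smul_root_eq (hrootm _ _)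
        (mem_fixingSubgroup_Kinf.1 σ.toMul.2 _))]
      rfl
  have hd : ∀ (p : s) (σ : Additive H), (ℓ : ℤ_[ℓ]) ^ m • d p σ = 0 := by
    intro p σ
    change (ℓ : ℤ_[ℓ]) ^ m • L (.ofMul (σ.toMul.1 • p.1.1.2 / p.1.1.2)) = 0
    rw [← Nat.cast_pow, Nat.cast_smul_eq_nsmul, ← map_nsmul, ← ofMul_pow, hrootm, ofMul_one,
      map_zero]
  have hψ : ∀ σ : Additive H, (∀ p, d p σ = 0) → ψ σ = 0 := by
    intro σ hσ
    have h1 : σ.toMul.1 (t : Ω) = t := by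
      by_contra hne
      rw [Set.eq_empty_iff_forall_notMem] at hs
      refine hs σ.toMul.1 ⟨⟨σ.toMul.2, hne⟩, Set.mem_iInter₂.2 fun p hp => ?_⟩
      exact smul_units_eq_iff.1 (div_eq_one.1 (hL m _ (hrootm p _) (hσ ⟨p, hp⟩)))
    change L (.ofMul (σ.toMul.1 • t / t)) = 0
    rw [smul_units_eq_iff.2 h1, div_self', ofMul_one, map_zero]
  obtain ⟨n, hn⟩ := QmodZ.exists_combination d m hd ψ hψ
  have hpow : ((∏ p : s, p.1.1.2 ^ n p : Ωˣ) : Ω) ^ ℓ ^ m =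
      algebraMap K Ω ((∏ p : s, p.1.1.1 ^ n p : Kˣ) : K) := by
    rw [Units.coe_prod, Units.coe_prod, map_prod, ← Finset.prod_pow]
    refine Finset.prod_congr rfl fun p _ => ?_
    rw [Units.val_pow_eq_pow_val, Units.val_pow_eq_pow_val, ← pow_mul, mul_comm, pow_mul, p.1.2.1,
      map_pow]
  refine ⟨∏ p : s, p.1.1.1 ^ n p, ∏ p : s, p.1.1.2 ^ n p, hpow, ?_, ?_⟩
  · rw [Units.coe_prod]
    refine prod_mem fun p _ => ?_
    rw [Units.val_pow_eq_pow_val]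
    exact pow_mem p.1.2.2 _
  · refine hL.radMk_eq ht hpow fun σ hσ => ?_
    refine (hn (.ofMul ⟨σ, hσ⟩)).trans ?_
    rw [Finset.smul_prod', ← Finset.prod_div_distrib, ofMul_prod, map_sum]
    refine Finset.sum_congr rfl fun p _ => ?_
    rw [smul_pow', ← div_pow, ofMul_pow, map_nsmul]
    rfl

/-- The image of the initial radical in the radical of `K_∞` is the Kummer radical of the compositum
of the cyclic extensions that embed into `ℤ_ℓ`-extensions. -/
theorem CyclotomicGenerator.image_initialRadical (D : CyclotomicGenerator ℓ m g)
    {L : Additive Ωˣ →+ QmodZ ℓ} (hL : IsLogarithm L) :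
    radMap ℓ (unitsToKinf ℓ K Ω) '' initialRadical ℓ m K Ω =
      kummerRadical ℓ K Ω (embeddableCompositum ℓ m K Ω) := by
  ext r
  constructor
  · rintro ⟨_, ⟨x, rfl, hx⟩, rfl⟩
    obtain ⟨y, hy⟩ := exists_units_pow_eq (ℓ := ℓ) m
      ((unitsToKinf ℓ K Ω x : Kinf ℓ K Ω) : Ω) (by simp)
    rw [kummerExt_le_iff hy] at hx
    exact ⟨m, unitsToKinf ℓ K Ω x, rfl, (kummerExt_le_iff hy _).2
      ⟨D.Kinf_le_embeddableCompositum, D.mem_embeddableCompositum hL hy hx.2⟩⟩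
  · rintro ⟨k, x, rfl, hx⟩
    obtain ⟨t, ht⟩ := exists_units_pow_eq (ℓ := ℓ) k ((x : Kinf ℓ K Ω) : Ω) (by simp)
    rw [kummerExt_le_iff ht] at hx
    obtain ⟨a, y, hy, hyZ, heq⟩ := D.exists_mem_ZlCompositum hL ht hx.2
    exact ⟨radMk ℓ m a, ⟨a, rfl, (kummerExt_le_iff (x := unitsToKinf ℓ K Ω a) hy _).2
      ⟨D.Kinf_le_ZlCompositum, hyZ⟩⟩, heq.symm⟩

end KummerRadical

/-! ### From the initial radical to norm-compatible systems -/

section NormCompatible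

variable {ℓ : ℕ} {m : ℕ} {K Ω : Type*} [Field K] [Field Ω] [Algebra K Ω] [IsGalois K Ω]
  [Fact ℓ.Prime] [IsAlgClosed Ω] [CharZero Ω] {g : Ω ≃ₐ[K] Ω}

theorem isOpen_smul_frac_eq_zero {ρ : Additive (Ω ≃ₐ[K] Ω) →+ ℤ_[ℓ]}
    (hρ : Continuous fun σ : Ω ≃ₐ[K] Ω => ρ (.ofMul σ)) (N : ℕ) :
    IsOpen {σ : Ω ≃ₐ[K] Ω | ρ (.ofMul σ) • frac ℓ N = 0} := by
  have h1 : {σ : Ω ≃ₐ[K] Ω | ρ (.ofMul σ) • frac ℓ N = 0} =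
      (fun σ : Ω ≃ₐ[K] Ω => ρ (.ofMul σ)) ⁻¹' Metric.closedBall 0 ((ℓ : ℝ) ^ (-N : ℤ)) := by
    ext σ
    rw [Set.mem_ofPred_eq, smul_frac_eq_zero_iff, Set.mem_preimage, mem_closedBall_zero_iff,
      PadicInt.norm_le_pow_iff_mem_span_pow, Ideal.mem_span_singleton]
  rw [h1]
  refine (IsUltrametricDist.isOpen_closedBall _ (zpow_pos ?_ _).ne').preimage hρ
  exact_mod_cast (Fact.out : ℓ.Prime).pos

/-- By Hilbert's Theorem 90, the reduction modulo `ℓ^N` of a homomorphism to `ℤ_ℓ` becomes a Kummer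
character over the field of the `ℓ^N`-th roots of unity. -/
theorem IsLogarithm.exists_kummer_generator {L : Additive Ωˣ →+ QmodZ ℓ} (hL : IsLogarithm L)
    {ρ : Additive (Ω ≃ₐ[K] Ω) →+ ℤ_[ℓ]} (hρ : Continuous fun σ : Ω ≃ₐ[K] Ω => ρ (.ofMul σ))
    (N : ℕ) : ∃ y : Ωˣ, ∀ σ ∈ rootFixer ℓ K Ω N,
      (σ • y / y) ^ ℓ ^ N = 1 ∧ L (.ofMul (σ • y / y)) = ρ (.ofMul σ) • frac ℓ N := by
  obtain ⟨ζ, hζ⟩ := exists_primitiveRoot_pow (ℓ := ℓ) (Ω := Ω) N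
  have hξ : ∀ σ : Ω ≃ₐ[K] Ω, ∃ ξ : Ωˣ, ξ ^ ℓ ^ N = 1 ∧
      L (.ofMul ξ) = ρ (.ofMul σ) • frac ℓ N := fun σ =>
    hL.exists_root_of_unity hζ (by rw [smul_comm, pow_smul_frac_self, smul_zero])
  choose ξ hξ hξL using hξ
  let F := IntermediateField.adjoin K {ζ : Ω | ζ ^ ℓ ^ N = 1}
  have hmemF : ∀ σ, (ξ σ : Ω) ∈ F := fun σ =>
    IntermediateField.subset_adjoin K _ (by
      rw [Set.mem_ofPred_eq, ← Units.val_pow_eq_pow_val, hξ, Units.val_one])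
  let χ : (Ω ≃ₐ[F] Ω) →* Fˣ := MonoidHom.mk'
    (fun τ => Units.mk0 ⟨ξ (τ.restrictScalars K), hmemF _⟩ fun h0 =>
      (ξ (τ.restrictScalars K)).ne_zero (congrArg Subtype.val h0)) fun σ τ => by
    apply Units.ext
    apply Subtype.ext
    change ((ξ _ : Ωˣ) : Ω) = (ξ (σ.restrictScalars K) : Ω) * ξ (τ.restrictScalars K)
    rw [← Units.val_mul]
    congr 1
    refine hL.injOn (hξ _) (k := N) ?_ ?_
    · rw [mul_pow, hξ, hξ, one_mul]
    · rw [ofMul_mul, map_add, hξL, hξL, hξL, ← add_smul, ← map_add]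
      rfl
  obtain ⟨s, hs⟩ := exists_stabilizer_subset (isOpen_smul_frac_eq_zero hρ N) (by simp)
  obtain ⟨y, hy⟩ := exists_apply_eq_character_mul χ s fun τ hτ => by
    have h1 := hs (τ.restrictScalars K) hτ
    rw [Set.mem_ofPred_eq, ← hξL] at h1
    apply Units.ext
    apply Subtype.ext
    change ((ξ (τ.restrictScalars K) : Ωˣ) : Ω) = 1
    rw [hL N _ (hξ _) h1, Units.val_one]
  refine ⟨y, fun σ hσ => ?_⟩
  have hσF : σ ∈ F.fixingSubgroup := by
    rw [IntermediateField.mem_fixingSubgroup_iff]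
    exact fun z hz => (mem_adjoin_iff_fixed _ z).1 hz σ hσ
  have h1 : σ • y / y = ξ σ := by
    rw [div_eq_iff_eq_mul]
    exact Units.ext (hy (IntermediateField.fixingSubgroupEquiv F ⟨σ, hσF⟩))
  rw [h1]
  exact ⟨hξ σ, hξL σ⟩

variable {γ : Kinf ℓ K Ω ≃ₐ[K] Kinf ℓ K Ω}

theorem conj_mem_fixingSubgroup_Kinf {σ : Ω ≃ₐ[K] Ω} (hσ : σ ∈ (Kinf ℓ K Ω).fixingSubgroup)
    (τ : Ω ≃ₐ[K] Ω) : τ * σ * τ⁻¹ ∈ (Kinf ℓ K Ω).fixingSubgroup := by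
  rw [mem_fixingSubgroup_Kinf] at hσ ⊢
  exact fun n => (inferInstance : (rootFixer ℓ K Ω n).Normal).conj_mem _ (hσ n) τ

theorem CyclotomicGenerator.smul_root (D : CyclotomicGenerator ℓ m g) {ξ : Ωˣ} {k : ℕ}
    (hξ : ξ ^ ℓ ^ k = 1) : g • ξ = ξ ^ (1 + ℓ ^ m) := by
  apply Units.ext
  rw [coe_smul_units, Units.val_pow_eq_pow_val]
  exact D.apply_root ξ k (by rw [← Units.val_pow_eq_pow_val, hξ, Units.val_one])

/-- The Kummer pairing is compatible with the action of `g`: an element of the radical of `K_∞`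
whose Kummer character is invariant under conjugation by `g` is invariant under `Γ*`. -/
theorem CyclotomicGenerator.galInf_radMk (D : CyclotomicGenerator ℓ m g)
    (hg : ∀ x : Kinf ℓ K Ω, g (x : Ω) = γ x) {L : Additive Ωˣ →+ QmodZ ℓ} (hL : IsLogarithm L)
    {k : ℕ} {x : (Kinf ℓ K Ω)ˣ} {t : Ωˣ} (ht : (t : Ω) ^ ℓ ^ k = (x : Kinf ℓ K Ω))
    (h : ∀ σ ∈ (Kinf ℓ K Ω).fixingSubgroup,
      L (.ofMul ((g⁻¹ * σ * g) • t / t)) = L (.ofMul (σ • t / t))) :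
    galInf γ (radMk ℓ k x) = (1 + (ℓ : ℤ_[ℓ]) ^ m) • radMk ℓ k x := by
  have h1 : (1 + (ℓ : ℤ_[ℓ]) ^ m) • radMk ℓ k x = radMk ℓ k (x ^ (1 + ℓ ^ m)) := by
    rw [radMk_pow, ← Nat.cast_smul_eq_nsmul ℤ_[ℓ]]
    push_cast
    rfl
  rw [h1, galInf, radMap_radMk]
  refine hL.radMk_eq (t := g • t) (s := t ^ (1 + ℓ ^ m)) ?_ ?_ fun σ hσ => ?_
  · rw [coe_smul_units, ← map_pow, ht, hg]
    rfl
  · rw [Units.val_pow_eq_pow_val, ← pow_mul, mul_comm, pow_mul, ht]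
    simp
  · have hτ : g⁻¹ * σ * g ∈ (Kinf ℓ K Ω).fixingSubgroup := by
      simpa using conj_mem_fixingSubgroup_Kinf hσ g⁻¹
    have h2 : σ • g • t / g • t = g • ((g⁻¹ * σ * g) • t / t) := by
      rw [smul_div', ← mul_smul, ← mul_smul]
      congr 2
      group
    rw [h2, D.smul_root (smul_div_pow_eq_one ht (apply_Kinf hτ _)), smul_pow', ← div_pow, ofMul_pow,
      ofMul_pow, map_nsmul, map_nsmul, h σ hσ]

/-- An element of the radical of `K_n` whose Kummer character over `K_∞` is the reduction modulo
`ℓ^(m+n)` of a given homomorphism to `ℤ_ℓ`. -/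
theorem CyclotomicGenerator.exists_layer_radical (D : CyclotomicGenerator ℓ m g)
    (hg : ∀ x : Kinf ℓ K Ω, g (x : Ω) = γ x) {L : Additive Ωˣ →+ QmodZ ℓ} (hL : IsLogarithm L)
    {ρ : Additive (Ω ≃ₐ[K] Ω) →+ ℤ_[ℓ]} (hρ : Continuous fun σ : Ω ≃ₐ[K] Ω => ρ (.ofMul σ))
    (n : ℕ) : ∃ (w : (layer ℓ m K Ω n)ˣ) (y : Ωˣ),
      (y : Ω) ^ ℓ ^ (m + n) = (layerUnits ℓ m K Ω n w : Kinf ℓ K Ω) ∧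
      (∀ σ ∈ (Kinf ℓ K Ω).fixingSubgroup,
        L (.ofMul (σ • y / y)) = ρ (.ofMul σ) • frac ℓ (m + n)) ∧
      radMk ℓ (m + n) w ∈ gammaStarInvariants ℓ m K Ω n γ := by
  obtain ⟨y, hy⟩ := hL.exists_kummer_generator hρ (m + n)
  have hfix : ∀ σ ∈ rootFixer ℓ K Ω (m + n), σ ((y : Ω) ^ ℓ ^ (m + n)) = (y : Ω) ^ ℓ ^ (m + n) := by
    intro σ hσ
    have h1 := (hy σ hσ).1
    rw [div_pow, div_eq_one, ← smul_pow', smul_units_eq_iff] at h1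
    simpa using h1
  have hK : (y : Ω) ^ ℓ ^ (m + n) ∈ Kinf ℓ K Ω :=
    (mem_Kinf_iff _).2 fun σ hσ => hfix σ (hσ _)
  have hlayer : (⟨_, hK⟩ : Kinf ℓ K Ω) ∈ layer ℓ m K Ω n := (mem_layer_iff n _).2 hfix
  have hne : (⟨_, hlayer⟩ : layer ℓ m K Ω n) ≠ 0 := fun h0 =>
    pow_ne_zero (ℓ ^ (m + n)) y.ne_zero
      (congrArg (fun u : layer ℓ m K Ω n => ((u : Kinf ℓ K Ω) : Ω)) h0)
  have hchar : ∀ σ ∈ (Kinf ℓ K Ω).fixingSubgroup,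
      L (.ofMul (σ • y / y)) = ρ (.ofMul σ) • frac ℓ (m + n) := fun σ hσ =>
    (hy σ (mem_fixingSubgroup_Kinf.1 hσ _)).2
  have hw : (y : Ω) ^ ℓ ^ (m + n) =
      (layerUnits ℓ m K Ω n (Units.mk0 _ hne) : Kinf ℓ K Ω) := rfl
  refine ⟨Units.mk0 _ hne, y, hw, hchar, ?_⟩
  rw [mem_gammaStarInvariants]
  apply D.radMap_layerUnits_injective n
  rw [radMap_layerUnits_galAct, map_smul, radMap_radMk]
  refine D.galInf_radMk hg hL hw fun σ hσ => ?_
  rw [hchar σ hσ, hchar _ (by simpa using conj_mem_fixingSubgroup_Kinf hσ g⁻¹), ofMul_mul,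
    ofMul_mul, map_add, map_add, ofMul_inv, map_neg, neg_add_cancel_comm]

/-- The elements of the initial radical are initial terms of norm-compatible systems. -/
theorem CyclotomicGenerator.exists_mem_normLimit (D : CyclotomicGenerator ℓ m g)
    (hg : ∀ x : Kinf ℓ K Ω, g (x : Ω) = γ x) {L : Additive Ωˣ →+ QmodZ ℓ} (hL : IsLogarithm L)
    {x : Kˣ} {y : Ωˣ} (hy : (y : Ω) ^ ℓ ^ m = algebraMap K Ω x)
    (hZ : (y : Ω) ∈ ZlCompositum ℓ K Ω) :
    ∃ u ∈ normLimit ℓ m K Ω γ, u 0 = radMap ℓ (unitsToLayerZero ℓ m K Ω) (radMk ℓ m x) := by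
  obtain ⟨ρ, hρ, hρy⟩ := D.exists_lift_of_mem_ZlCompositum (L := L) hy hZ
  choose w t ht hchar hinv using D.exists_layer_radical hg hL hρ
  choose ε hε using exists_theta_eq (ℓ := ℓ) D.pos D.two_le
  have hsucc : ∀ n, (ℓ : ℤ_[ℓ]) • radMk ℓ (m + (n + 1)) (layerUnits ℓ m K Ω (n + 1) (w (n + 1))) =
      radMk ℓ (m + n) (layerUnits ℓ m K Ω n (w n)) := by
    intro n
    rw [Nat.cast_smul_eq_nsmul, ← radMk_pow]
    refine hL.radMk_eq (t := t (n + 1) ^ ℓ) (s := t n) ?_ (ht n) fun σ hσ => ?_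
    · rw [Units.val_pow_eq_pow_val, ← pow_mul, mul_comm, pow_mul, ht]
      simp
    · rw [smul_pow', ← div_pow, ofMul_pow, map_nsmul, hchar _ σ hσ, hchar _ σ hσ,
        ← Nat.cast_smul_eq_nsmul ℤ_[ℓ], smul_comm, ← add_assoc, smul_frac_succ]
  -- the units `c n` turn multiplication by `ℓ` into multiplication by `theta ℓ m n`, that is, into
  -- the norm
  let c : ℕ → ℤ_[ℓ] := fun n => Nat.rec 1 (fun i a => a * ↑(ε i)⁻¹) n
  have hc : ∀ n, c (n + 1) = c n * ↑(ε n)⁻¹ := fun n => rfl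
  refine ⟨fun n => c n • radMk ℓ (m + n) (w n),
    ⟨fun n => Submodule.smul_mem _ _ (hinv n), fun n => ?_⟩, ?_⟩
  · apply D.radMap_layerUnits_injective n
    rw [map_smul, map_smul, D.radMap_layerUnits_normMap hg (hinv (n + 1)), map_smul, radMap_radMk,
      radMap_radMk, ← hsucc n, smul_smul, smul_smul, hc, hε]
    congr 1
    rw [mul_assoc, mul_comm (ℓ : ℤ_[ℓ]), Units.inv_mul_cancel_left]
  · apply D.radMap_layerUnits_injective 0
    change radMap ℓ _ ((1 : ℤ_[ℓ]) • radMk ℓ (m + 0) (w 0)) = _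
    rw [one_smul, radMap_radMk, radMap_radMk, radMap_radMk]
    exact hL.radMk_eq (t := t 0) (s := y) (ht 0) hy fun σ hσ => by rw [hchar 0 σ hσ, hρy]; rfl

end NormCompatible

/-! ### From norm-compatible systems to the initial radical -/

/-- The `ℓ^m`-torsion of the universal radical consists of the elements `ℓ^{-m} ⊗ b`. -/
theorem exists_radMk_eq_of_pow_smul_eq_zero {ℓ : ℕ} [Fact ℓ.Prime] {F : Type*} [Field F] {m : ℕ}
    {r : Radical ℓ F} (h : (ℓ : ℤ_[ℓ]) ^ m • r = 0) : ∃ b : Fˣ, r = radMk ℓ m b := by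
  obtain ⟨N, hN⟩ := exists_eq_radMk r
  obtain ⟨a, rfl⟩ := hN (m + N) (Nat.le_add_left N m)
  rw [pow_smul_radMk_add] at h
  obtain ⟨j, z, hz⟩ := exists_pow_eq_of_radMk_eq_zero h
  have h1 : (a / z ^ ℓ ^ N) ^ ℓ ^ j = 1 := by rw [div_pow, hz, div_self']
  have h2 := radMk_eq_zero_of_pow_eq_one (ℓ := ℓ) (N + m) h1
  rw [radMk_div, radMk_add_pow, sub_eq_zero, add_comm] at h2
  exact ⟨z, h2⟩

section KummerCharacters

variable {ℓ : ℕ} {m : ℕ} {K Ω : Type*} [Field K] [Field Ω] [Algebra K Ω] [IsGalois K Ω]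
  [Fact ℓ.Prime] [IsAlgClosed Ω] [CharZero Ω] {g : Ω ≃ₐ[K] Ω}
  {γ : Kinf ℓ K Ω ≃ₐ[K] Kinf ℓ K Ω} {L : Additive Ωˣ →+ QmodZ ℓ}

theorem isOpen_ker_of_subset {Q : Type*} [AddCommGroup Q] (d : Additive (Ω ≃ₐ[K] Ω) →+ Q)
    {A : Set (Ω ≃ₐ[K] Ω)} (hA : IsOpen A) (h1 : 1 ∈ A) (h : ∀ σ ∈ A, d (.ofMul σ) = 0) :
    IsOpen {σ : Ω ≃ₐ[K] Ω | d (.ofMul σ) = 0} := by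
  obtain ⟨s, hs⟩ := exists_stabilizer_subset hA h1
  exact isOpen_ker_of_stabilizer d s fun σ hσ => h σ (hs σ hσ)

/-- The Kummer character of an element of the radical of `K_∞` that is invariant under `Γ*` extends
to a character of the whole Galois group: it is invariant under conjugation by `g`. -/
theorem CyclotomicGenerator.exists_isKummerCharacter (D : CyclotomicGenerator ℓ m g)
    (hg : ∀ x : Kinf ℓ K Ω, g (x : Ω) = γ x) {v : Radical ℓ (Kinf ℓ K Ω)}
    (hv : galInf γ v = (1 + (ℓ : ℤ_[ℓ]) ^ m) • v) :
    ∃ d : Additive (Ω ≃ₐ[K] Ω) →+ QmodZ ℓ, IsOpen {σ : Ω ≃ₐ[K] Ω | d (.ofMul σ) = 0} ∧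
      IsKummerCharacter L d v := by
  obtain ⟨N, hN⟩ := exists_eq_radMk v
  obtain ⟨w, rfl⟩ := hN N le_rfl
  obtain ⟨t, ht⟩ := exists_units_pow_eq (ℓ := ℓ) N ((w : Kinf ℓ K Ω) : Ω) (by simp)
  have h1 : radMk ℓ N (Units.map (γ : Kinf ℓ K Ω →* Kinf ℓ K Ω) w) =
      radMk ℓ N (w ^ (1 + ℓ ^ m)) := by
    rw [radMk_pow, ← Nat.cast_smul_eq_nsmul ℤ_[ℓ]]
    push_cast
    exact hv
  have hz : ((g • t : Ωˣ) : Ω) / (t ^ (1 + ℓ ^ m) : Ωˣ) ∈ Kinf ℓ K Ω := by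
    refine apply_div_eq_of_radMk_eq h1 ?_ ?_
    · rw [coe_smul_units, ← map_pow, ht, hg]
      rfl
    · rw [Units.val_pow_eq_pow_val, ← pow_mul, mul_comm, pow_mul, ht]
      simp
  rw [← Units.val_div_eq_div_val] at hz
  obtain ⟨n₁, hn₁⟩ := exists_rootFixer_fixes (ℓ := ℓ) (SetLike.coe_mem (w : Kinf ℓ K Ω))
  obtain ⟨n₂, hn₂⟩ := exists_rootFixer_fixes (ℓ := ℓ) hz
  -- a layer that contains `w` and `g t / t^(1+ℓ^m)`, and enough roots of unity
  obtain ⟨M, hM₁, hM₂, hM₃⟩ : ∃ M, n₁ ≤ m + M ∧ n₂ ≤ m + M ∧ N ≤ m + M :=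
    ⟨n₁ + n₂ + N, by omega, by omega, by omega⟩
  have hroot : ∀ σ ∈ rootFixer ℓ K Ω (m + M), (σ • t / t) ^ ℓ ^ N = 1 := fun σ hσ =>
    smul_div_pow_eq_one ht (hn₁ _ hM₁ σ hσ)
  obtain ⟨e, he⟩ := QmodZ.exists_nsmul_eq (ℓ ^ M) (NeZero.ne _)
    (L (.ofMul ((g ^ ℓ ^ M) • t / t)))
  obtain ⟨d, hd⟩ := exists_character_extension (rootFixer ℓ K Ω (m + M))
    (fun σ => L (.ofMul (σ • t / t))) (fun σ hσ τ hτ => by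
      rw [smul_mul_div _ _ _ (smul_root_eq (hroot τ hτ) (rootFixer_anti hM₃ hσ)), ofMul_mul,
        map_add])
    g (fun σ hσ => by
      have hσ' : g * σ * g⁻¹ ∈ rootFixer ℓ K Ω (m + M) :=
        (inferInstance : (rootFixer ℓ K Ω (m + M)).Normal).conj_mem _ hσ g
      set σ' := g * σ * g⁻¹ with hσ'_def
      -- compute the action of `σ'` on `g t` in two ways
      have h2 : σ' • (g • t) / g • t = (σ • t / t) ^ (1 + ℓ ^ m) := by
        rw [← D.smul_root (hroot σ hσ), smul_div', ← mul_smul, ← mul_smul, hσ'_def,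
          inv_mul_cancel_right]
      have h3 : σ' • (g • t) / g • t = (σ' • t / t) ^ (1 + ℓ ^ m) := by
        have h4 := smul_units_eq_iff.2 (hn₂ _ hM₂ σ' hσ')
        rw [smul_div', div_eq_div_iff_mul_eq_mul, smul_pow'] at h4
        rw [div_pow, div_eq_div_iff_mul_eq_mul, h4, mul_comm]
      rw [h2, ← D.smul_root (hroot σ hσ), ← D.smul_root (hroot σ' hσ')] at h3
      rw [smul_left_cancel g h3])
    (ℓ ^ M) (D.pow_mem_rootFixer_iff M) (D.exists_pow_inv_mul_mem M) e he
  refine ⟨d, isOpen_ker_of_subset d ((isOpen_rootFixer (m + M)).inter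
      (stabilizer_isOpen_of_isIntegral (K := K) (t : Ω))) ⟨one_mem (rootFixer ℓ K Ω (m + M)), rfl⟩
      fun σ hσ => ?_,
    IsKummerCharacter.of_root ht fun σ hσ => hd σ (mem_fixingSubgroup_Kinf.1 hσ _)⟩
  rw [hd σ hσ.1, smul_units_eq_iff.2 hσ.2, div_self', ofMul_one, map_zero]

/-- A character of `Gal(K_∞/K)` is divisible by `ℓ`. -/
theorem CyclotomicGenerator.exists_smul_eq (D : CyclotomicGenerator ℓ m g)
    (φ : Additive (Ω ≃ₐ[K] Ω) →+ QmodZ ℓ) (hopen : IsOpen {σ : Ω ≃ₐ[K] Ω | φ (.ofMul σ) = 0})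
    (hφ : ∀ σ ∈ (Kinf ℓ K Ω).fixingSubgroup, φ (.ofMul σ) = 0) :
    ∃ φ' : Additive (Ω ≃ₐ[K] Ω) →+ QmodZ ℓ, IsOpen {σ : Ω ≃ₐ[K] Ω | φ' (.ofMul σ) = 0} ∧
      (∀ σ ∈ (Kinf ℓ K Ω).fixingSubgroup, φ' (.ofMul σ) = 0) ∧
      ∀ σ, (ℓ : ℤ_[ℓ]) • φ' σ = φ σ := by
  obtain ⟨ρ, hρ, hρ'⟩ := D.exists_cyclotomic_hom
  -- by compactness, the character factors through a finite layer
  obtain ⟨M, hM⟩ : ∃ M, (rootFixer ℓ K Ω (m + M) : Set (Ω ≃ₐ[K] Ω)) ⊆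
      {σ : Ω ≃ₐ[K] Ω | φ (.ofMul σ) = 0} := by
    have hcl : ∀ n, IsClosed (rootFixer ℓ K Ω (m + n) : Set (Ω ≃ₐ[K] Ω)) := fun n =>
      Subgroup.isClosed_of_isOpen _ (isOpen_rootFixer (m + n))
    refine exists_subset_nhds_of_isCompact' (directed_of_isDirected_le fun i j hij => ?_)
      (fun n => (hcl n).isCompact) hcl fun σ hσ => hopen.mem_nhds (hφ σ ?_)
    · exact rootFixer_anti (Nat.add_le_add_left hij m)
    · exact mem_fixingSubgroup_Kinf.2 fun n =>
        rootFixer_anti (Nat.le_add_left n m) (Set.mem_iInter.1 hσ n)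
  have htors : (ℓ : ℤ_[ℓ]) ^ M • φ (.ofMul g) = 0 := by
    rw [← Nat.cast_pow, Nat.cast_smul_eq_nsmul, ← map_nsmul, ← ofMul_pow]
    exact hM ((D.pow_mem_rootFixer_iff M _).2 dvd_rfl)
  obtain ⟨e, he⟩ := QmodZ.exists_nsmul_eq ℓ (Fact.out : ℓ.Prime).ne_zero (φ (.ofMul g))
  rw [← Nat.cast_smul_eq_nsmul ℤ_[ℓ]] at he
  obtain ⟨n, hn⟩ := exists_smul_frac_of_pow_smul_eq_zero (c := e) (k := M + 1)
    (by rw [pow_succ, mul_smul, he, htors])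
  let φ' : Additive (Ω ≃ₐ[K] Ω) →+ QmodZ ℓ :=
    AddMonoidHom.mk' (fun σ => ρ σ • e) fun σ τ => by rw [map_add, add_smul]
  have hφ'0 : ∀ σ : Ω ≃ₐ[K] Ω, ρ (.ofMul σ) • frac ℓ (M + 1) = 0 → φ' (.ofMul σ) = 0 := by
    intro σ hσ
    change ρ (.ofMul σ) • e = 0
    rw [hn, smul_comm, hσ, smul_zero]
  refine ⟨φ', isOpen_ker_of_subset φ' (isOpen_smul_frac_eq_zero hρ (M + 1)) (by simp) hφ'0,
    fun σ hσ => hφ'0 σ ?_, fun σ => ?_⟩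
  · have h1 := (hρ' σ (M + 1) 0).1 (by
      rw [pow_zero, inv_one, one_mul]
      exact mem_fixingSubgroup_Kinf.1 hσ _)
    rw [h1, zero_smul]
  · change (ℓ : ℤ_[ℓ]) • ρ σ • e = φ σ
    obtain ⟨i, hi⟩ := D.exists_pow_inv_mul_mem M σ.toMul
    have h1 := (hρ' σ.toMul M i).1 hi
    rw [← Nat.cast_smul_eq_nsmul ℤ_[ℓ], ← sub_eq_zero, ← sub_smul, smul_frac_eq_zero_iff] at h1
    obtain ⟨a, ha⟩ := h1
    have h2 : φ σ = i • φ (.ofMul g) := by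
      have h3 := hM hi
      rw [Set.mem_ofPred_eq, ofMul_mul, map_add, ofMul_inv, map_neg, ofMul_pow, map_nsmul,
        neg_add_eq_zero] at h3
      exact h3.symm
    rw [smul_comm, he, h2, ← Nat.cast_smul_eq_nsmul ℤ_[ℓ], ← sub_eq_zero, ← sub_smul]
    change (ρ (.ofMul σ.toMul) - (i : ℤ_[ℓ])) • _ = _
    rw [ha, mul_comm, mul_smul, htors, smul_zero]

/-- The Kummer character over `K_∞` is determined by the element of the radical. -/
theorem IsKummerCharacter.apply_eq {v : Radical ℓ (Kinf ℓ K Ω)}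
    {d d' : Additive (Ω ≃ₐ[K] Ω) →+ QmodZ ℓ} (hd : IsKummerCharacter L d v)
    (hd' : IsKummerCharacter L d' v) {σ : Ω ≃ₐ[K] Ω} (hσ : σ ∈ (Kinf ℓ K Ω).fixingSubgroup) :
    d (.ofMul σ) = d' (.ofMul σ) := by
  obtain ⟨N, hN⟩ := exists_eq_radMk v
  obtain ⟨w, hw⟩ := hN N le_rfl
  obtain ⟨t, ht⟩ := exists_units_pow_eq (ℓ := ℓ) N ((w : Kinf ℓ K Ω) : Ω) (by simp)
  rw [hd N w t ht hw σ hσ, hd' N w t ht hw σ hσ]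

theorem IsKummerCharacter.nsmul {v : Radical ℓ (Kinf ℓ K Ω)}
    {d : Additive (Ω ≃ₐ[K] Ω) →+ QmodZ ℓ} (hd : IsKummerCharacter L d v) (n : ℕ) :
    IsKummerCharacter L (n • d) (n • v) := by
  obtain ⟨N, hN⟩ := exists_eq_radMk v
  obtain ⟨w, hw⟩ := hN N le_rfl
  obtain ⟨t, ht⟩ := exists_units_pow_eq (ℓ := ℓ) N ((w : Kinf ℓ K Ω) : Ω) (by simp)
  rw [hw, ← radMk_pow]
  refine IsKummerCharacter.of_root (t := t ^ n) ?_ fun σ hσ => ?_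
  · rw [Units.val_pow_eq_pow_val, ← pow_mul, mul_comm, pow_mul, ht]
    simp
  · rw [AddMonoidHom.nsmul_apply, hd N w t ht hw σ hσ, smul_pow', ← div_pow, ofMul_pow, map_nsmul]

/-- A character that extends a Kummer character is divided by `ℓ` compatibly with a division in the
radical, as long as this takes place in the invariants of `Γ*`. -/
theorem CyclotomicGenerator.exists_division (D : CyclotomicGenerator ℓ m g)
    (hg : ∀ x : Kinf ℓ K Ω, g (x : Ω) = γ x) {v : Radical ℓ (Kinf ℓ K Ω)}
    (hv : galInf γ v = (1 + (ℓ : ℤ_[ℓ]) ^ m) • v) {d : Additive (Ω ≃ₐ[K] Ω) →+ QmodZ ℓ}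
    (hopen : IsOpen {σ : Ω ≃ₐ[K] Ω | d (.ofMul σ) = 0})
    (hd : IsKummerCharacter L d ((ℓ : ℤ_[ℓ]) • v)) :
    ∃ d' : Additive (Ω ≃ₐ[K] Ω) →+ QmodZ ℓ, IsOpen {σ : Ω ≃ₐ[K] Ω | d' (.ofMul σ) = 0} ∧
      IsKummerCharacter L d' v ∧ ∀ σ, (ℓ : ℤ_[ℓ]) • d' σ = d σ := by
  obtain ⟨d₁, hopen₁, hd₁⟩ := D.exists_isKummerCharacter (L := L) hg hv
  rw [Nat.cast_smul_eq_nsmul] at hd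
  obtain ⟨φ, hφ, hφK, hφd⟩ := D.exists_smul_eq (d - ℓ • d₁)
    (isOpen_ker_of_subset _ (hopen.inter hopen₁) ⟨map_zero d, map_zero d₁⟩ fun σ hσ => by
      rw [AddMonoidHom.sub_apply, AddMonoidHom.nsmul_apply, hσ.1, hσ.2, smul_zero, sub_zero])
    fun σ hσ => by rw [AddMonoidHom.sub_apply, hd.apply_eq (hd₁.nsmul ℓ) hσ, sub_self]
  refine ⟨d₁ + φ, isOpen_ker_of_subset _ (hopen₁.inter hφ) ⟨map_zero d₁, map_zero φ⟩
    fun σ hσ => ?_, fun k x t ht hv σ hσ => ?_, fun σ => ?_⟩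
  · rw [AddMonoidHom.add_apply, hσ.1, hσ.2, add_zero]
  · rw [AddMonoidHom.add_apply, hφK σ hσ, add_zero, hd₁ k x t ht hv σ hσ]
  · rw [AddMonoidHom.add_apply, smul_add, hφd, AddMonoidHom.sub_apply, AddMonoidHom.nsmul_apply,
      Nat.cast_smul_eq_nsmul, add_sub_cancel]

/-- If `ℓ^{-m} ⊗ x` is infinitely `ℓ`-divisible within the invariants of `Γ*` in the radical of
`K_∞`, then the `ℓ^m`-th roots of `x` lie in a `ℤ_ℓ`-extension. -/
theorem CyclotomicGenerator.mem_ZlCompositum_of_divisible (D : CyclotomicGenerator ℓ m g)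
    (hg : ∀ x : Kinf ℓ K Ω, g (x : Ω) = γ x) (hL : IsLogarithm L) {x : Kˣ} {y : Ωˣ}
    (hy : (y : Ω) ^ ℓ ^ m = algebraMap K Ω x) (v : ℕ → Radical ℓ (Kinf ℓ K Ω))
    (h0 : v 0 = radMk ℓ m (unitsToKinf ℓ K Ω x)) (hv : ∀ n, (ℓ : ℤ_[ℓ]) • v (n + 1) = v n)
    (hγ : ∀ n, galInf γ (v n) = (1 + (ℓ : ℤ_[ℓ]) ^ m) • v n) :
    (y : Ω) ∈ ZlCompositum ℓ K Ω := by
  obtain ⟨d₀, hd₀, hopen₀, htors₀⟩ := D.exists_kummer_character (L := L) hy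
  -- divide the Kummer character of `x` by `ℓ` successively, along the sequence `v`
  let C : ℕ → Type _ := fun n => {d : Additive (Ω ≃ₐ[K] Ω) →+ QmodZ ℓ //
    IsOpen {σ : Ω ≃ₐ[K] Ω | d (.ofMul σ) = 0} ∧ IsKummerCharacter L d (v n)}
  have hstep : ∀ (n : ℕ) (d : C n), ∃ d' : C (n + 1), ∀ σ, (ℓ : ℤ_[ℓ]) • d'.1 σ = d.1 σ := by
    rintro n ⟨d, hopen, hd⟩
    rw [← hv] at hd
    obtain ⟨d', h1, h2, h3⟩ := D.exists_division hg (hγ (n + 1)) hopen hd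
    exact ⟨⟨d', h1, h2⟩, h3⟩
  choose f hf using hstep
  let d : ∀ n, C n := fun n => Nat.rec ⟨d₀, hopen₀, by
    rw [h0]; exact IsKummerCharacter.of_root hy fun σ _ => hd₀ σ⟩ f n
  have hd : ∀ n σ, (ℓ : ℤ_[ℓ]) • (d (n + 1)).1 σ = (d n).1 σ := fun n => hf n (d n)
  choose ρ hρ using fun σ => exists_padicInt_of_compatible m (fun n => (d n).1 σ) (htors₀ σ)
    fun n => hd n σ
  let ρ' : Additive (Ω ≃ₐ[K] Ω) →+ ℤ_[ℓ] := AddMonoidHom.mk' ρ fun σ τ =>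
    eq_of_forall_smul_frac_eq m fun n => by rw [add_smul, ← hρ, ← hρ, ← hρ, map_add]
  obtain ⟨E, hE, hyE⟩ := D.exists_isZlExtension_mem ρ'
    (continuous_of_smul_frac ρ' fun n => ⟨m + n, Nat.le_add_left n m, by
      change IsOpen {σ : Ω ≃ₐ[K] Ω | ρ (.ofMul σ) • frac ℓ (m + n) = 0}
      simp_rw [← hρ]
      exact (d n).2.1⟩) (y := y) fun σ hσ => by
    have h1 : L (.ofMul (σ • y / y)) = 0 := by
      rw [← hd₀]
      refine (hρ (.ofMul σ) 0).trans ?_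
      rw [show ρ (.ofMul σ) = 0 from hσ, zero_smul]
    exact smul_units_eq_iff.1 (div_eq_one.1 (hL m _ (smul_div_pow_eq_one hy (σ.commutes _)) h1))
  exact le_sSup (a := E) hE hyE

end KummerCharacters

section InitialTerms

variable {ℓ : ℕ} {m : ℕ} {K Ω : Type*} [Field K] [Field Ω] [Algebra K Ω] [IsGalois K Ω]
  [Fact ℓ.Prime] [IsAlgClosed Ω] [CharZero Ω] {g : Ω ≃ₐ[K] Ω}
  {γ : Kinf ℓ K Ω ≃ₐ[K] Kinf ℓ K Ω} {L : Additive Ωˣ →+ QmodZ ℓ}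

/-- The `Γ*`-invariants of the radical of `K_0 = K` are its `ℓ^m`-torsion. -/
theorem CyclotomicGenerator.exists_eq_of_mem_invariants_zero (D : CyclotomicGenerator ℓ m g)
    {r : Radical ℓ (layer ℓ m K Ω 0)} (hr : r ∈ gammaStarInvariants ℓ m K Ω 0 γ) :
    ∃ x : Kˣ, r = radMap ℓ (unitsToLayerZero ℓ m K Ω) (radMk ℓ m x) := by
  have hsurj : ∀ b : (layer ℓ m K Ω 0)ˣ, ∃ a : Kˣ, unitsToLayerZero ℓ m K Ω a = b := by
    intro b
    obtain ⟨a, ha⟩ := D.mem_range_of_mem_layer_zero (b : layer ℓ m K Ω 0)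
    have ha0 : a ≠ 0 := by
      rintro rfl
      rw [map_zero] at ha
      exact b.ne_zero ha.symm
    exact ⟨Units.mk0 a ha0, Units.ext ha⟩
  have hact : galAct ℓ m K Ω 0 γ r = r := by
    obtain ⟨k, hk⟩ := exists_eq_radMk r
    obtain ⟨b, rfl⟩ := hk k le_rfl
    obtain ⟨a, rfl⟩ := hsurj b
    rw [galAct, radMap_radMk]
    congr 1
    exact Units.ext ((restrictLayer ℓ m K Ω 0 γ).commutes (a : K))
  rw [mem_gammaStarInvariants, hact, add_smul, one_smul, left_eq_add] at hr
  obtain ⟨b, rfl⟩ := exists_radMk_eq_of_pow_smul_eq_zero hr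
  obtain ⟨a, rfl⟩ := hsurj b
  exact ⟨a, (radMap_radMk _ _ _).symm⟩

/-- The initial term of a norm-compatible system of invariants of `Γ*` is infinitely `ℓ`-divisible
in the radical of `K_∞`, hence comes from the initial radical. -/
theorem CyclotomicGenerator.mem_ZlCompositum_of_mem_normLimit (D : CyclotomicGenerator ℓ m g)
    (hg : ∀ x : Kinf ℓ K Ω, g (x : Ω) = γ x) (hL : IsLogarithm L) {x : Kˣ} {y : Ωˣ}
    (hy : (y : Ω) ^ ℓ ^ m = algebraMap K Ω x) {u : ∀ n : ℕ, Radical ℓ (layer ℓ m K Ω n)}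
    (hu : u ∈ normLimit ℓ m K Ω γ)
    (h0 : u 0 = radMap ℓ (unitsToLayerZero ℓ m K Ω) (radMk ℓ m x)) :
    (y : Ω) ∈ ZlCompositum ℓ K Ω := by
  obtain ⟨hinv, hnorm⟩ := hu
  choose ε hε using exists_theta_eq (ℓ := ℓ) D.pos D.two_le
  -- the units `c n` turn multiplication by `theta ℓ m n` into multiplication by `ℓ`
  let c : ℕ → ℤ_[ℓ] := fun n => Nat.rec 1 (fun i a => a * ε i) n
  have hc : ∀ n, c (n + 1) = c n * ε n := fun n => rfl
  refine D.mem_ZlCompositum_of_divisible hg hL hy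
    (fun n => c n • radMap ℓ (layerUnits ℓ m K Ω n) (u n)) ?_ (fun n => ?_) fun n => ?_
  · change (1 : ℤ_[ℓ]) • _ = _
    rw [one_smul, h0, radMap_radMap]
    rfl
  · rw [← hnorm n, D.radMap_layerUnits_normMap hg (hinv (n + 1)), smul_smul, smul_smul, hc, hε]
    congr 1
    ring
  · rw [map_smul, galInf_layerUnits (hinv n), smul_comm]

/-- The initial radical is the set of the initial terms of the projective limit. -/
theorem CyclotomicGenerator.image_initialRadical_layer_zero (D : CyclotomicGenerator ℓ m g)
    (hg : ∀ x : Kinf ℓ K Ω, g (x : Ω) = γ x) (hL : IsLogarithm L) :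
    radMap ℓ (unitsToLayerZero ℓ m K Ω) '' initialRadical ℓ m K Ω =
      (fun u : (∀ n : ℕ, Radical ℓ (layer ℓ m K Ω n)) => u 0) ''
        (normLimit ℓ m K Ω γ : Set (∀ n : ℕ, Radical ℓ (layer ℓ m K Ω n))) := by
  have hroot : ∀ x : Kˣ, ∃ y : Ωˣ, (y : Ω) ^ ℓ ^ m = (unitsToKinf ℓ K Ω x : Kinf ℓ K Ω) := fun x =>
    exists_units_pow_eq (ℓ := ℓ) m _ (by simp)
  ext r
  constructor
  · rintro ⟨_, ⟨x, rfl, hx⟩, rfl⟩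
    obtain ⟨y, hy⟩ := hroot x
    exact D.exists_mem_normLimit hg hL hy ((kummerExt_le_iff hy _).1 hx).2
  · rintro ⟨u, hu, rfl⟩
    obtain ⟨x, hx⟩ := D.exists_eq_of_mem_invariants_zero (hu.1 0)
    obtain ⟨y, hy⟩ := hroot x
    exact ⟨_, ⟨x, rfl, (kummerExt_le_iff hy _).2
      ⟨D.Kinf_le_ZlCompositum, D.mem_ZlCompositum_of_mem_normLimit hg hL hy hu hx⟩⟩, hx.symm⟩

end InitialTerms

/-! ### The generator of the Galois group -/

section RootsOfUnity

/-- A finite group of roots of unity of `ℓ`-power order, being cyclic, is generated by a primitive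
root of unity. -/
theorem exists_primitiveRoot_of_card {ℓ m : ℕ} [Fact ℓ.Prime] {K : Type*} [Field K]
    (hm : Nat.card {ζ : K // ∃ k : ℕ, ζ ^ ℓ ^ k = 1} = ℓ ^ m) :
    ∃ ζ : K, IsPrimitiveRoot ζ (ℓ ^ m) ∧ ∀ (ξ : K) (k : ℕ), ξ ^ ℓ ^ k = 1 → ξ ^ ℓ ^ m = 1 := by
  let S : Subgroup Kˣ :=
    { carrier := {u | ∃ k : ℕ, u ^ ℓ ^ k = 1}
      mul_mem' := by
        rintro u v ⟨i, hi⟩ ⟨j, hj⟩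
        exact ⟨i + j, by
          rw [mul_pow, pow_add, pow_mul, hi, one_pow, one_mul, mul_comm, pow_mul, hj, one_pow]⟩
      one_mem' := ⟨0, one_pow _⟩
      inv_mem' := by
        rintro u ⟨i, hi⟩
        exact ⟨i, by rw [inv_pow, hi, inv_one]⟩ }
  have hS : ∀ (ξ : K) (k : ℕ), ξ ^ ℓ ^ k = 1 → ∃ u : S, ((u : Kˣ) : K) = ξ := fun ξ k h =>
    ⟨⟨Units.ofPowEqOne ξ (ℓ ^ k) h (NeZero.ne _), k, Units.ext (by simp)⟩, rfl⟩
  have hcard : Nat.card S = ℓ ^ m := by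
    rw [← hm]
    refine Nat.card_congr (Equiv.ofBijective
      (fun u => ⟨((u : Kˣ) : K), u.2.imp fun k hk => by
        rw [← Units.val_pow_eq_pow_val, hk, Units.val_one]⟩)
      ⟨fun u v h => Subtype.ext (Units.ext (congrArg Subtype.val h)), ?_⟩)
    rintro ⟨ξ, k, h⟩
    obtain ⟨u, hu⟩ := hS ξ k h
    exact ⟨u, Subtype.ext hu⟩
  have hfin : Finite S := Nat.finite_of_card_ne_zero (hcard ▸ NeZero.ne _)
  obtain ⟨u, hu⟩ := IsCyclic.exists_generator (α := S)
  refine ⟨((u : Kˣ) : K), ?_, fun ξ k h => ?_⟩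
  · rw [IsPrimitiveRoot.coe_units_iff, ← hcard, ← orderOf_eq_card_of_forall_mem_zpowers hu,
      ← Subgroup.orderOf_coe]
    exact IsPrimitiveRoot.orderOf _
  · obtain ⟨v, rfl⟩ := hS ξ k h
    have h1 : v ^ ℓ ^ m = 1 := by rw [← hcard, pow_card_eq_one']
    rw [← Units.val_pow_eq_pow_val, ← SubgroupClass.coe_pow, h1, OneMemClass.coe_one, Units.val_one]

/-- A lift to the algebraic closure of the given generator of `Gal(K_∞/K)`. That `m ≥ 1`, and
`m ≥ 2` if `ℓ = 2`, holds because `K` contains the `2ℓ`-th roots of unity. -/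
theorem exists_cyclotomicGenerator {ℓ m : ℕ} [Fact ℓ.Prime] {K Ω : Type*} [Field K] [Field Ω]
    [Algebra K Ω] [IsGalois K Ω] (hK : ∃ ζ : K, IsPrimitiveRoot ζ (2 * ℓ))
    (hm : Nat.card {ζ : K // ∃ k : ℕ, ζ ^ ℓ ^ k = 1} = ℓ ^ m)
    (γ : Kinf ℓ K Ω ≃ₐ[K] Kinf ℓ K Ω)
    (hγ : ∀ (ζ : Kinf ℓ K Ω) (k : ℕ), ζ ^ ℓ ^ k = 1 → γ ζ = ζ ^ (1 + ℓ ^ m)) :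
    ∃ g : Ω ≃ₐ[K] Ω, CyclotomicGenerator ℓ m g ∧ ∀ x : Kinf ℓ K Ω, g (x : Ω) = γ x := by
  have hℓ : ℓ.Prime := Fact.out
  obtain ⟨ζ, hζ⟩ := hK
  obtain ⟨ξ, hξ, hroots⟩ := exists_primitiveRoot_of_card hm
  have hg : ∀ x : Kinf ℓ K Ω, γ.liftNormal Ω (x : Ω) = γ x := fun x => γ.liftNormal_commutes Ω x
  refine ⟨γ.liftNormal Ω, ⟨Nat.pos_of_ne_zero ?_, ?_, ⟨ξ, hξ⟩, fun η k hη => ?_⟩, hg⟩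
  · rintro rfl
    have h1 : IsPrimitiveRoot (ζ ^ 2) ℓ := hζ.pow (Nat.mul_pos two_pos hℓ.pos) rfl
    have h2 := hroots _ 1 (by rw [pow_one]; exact h1.pow_eq_one)
    rw [pow_zero, pow_one] at h2
    exact hℓ.one_lt.ne' ((h1.dvd_of_pow_eq_one 1 (by rw [h2, one_pow])) |> Nat.dvd_one.1)
  · rintro rfl
    have h1 := hζ.dvd_of_pow_eq_one _ (hroots _ 2 hζ.pow_eq_one)
    exact (Nat.pow_dvd_pow_iff_le_right (x := 2) (k := 2) one_lt_two).1 h1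
  · have hmem := root_mem_Kinf (K := K) hη
    rw [show η = ((⟨η, hmem⟩ : Kinf ℓ K Ω) : Ω) from rfl, hg, hγ _ k (Subtype.ext hη)]
    rfl

end RootsOfUnity

end RadZ

end

theorem mainTheorem1 (ℓ : ℕ) [Fact ℓ.Prime]
    (K : Type*) [Field K] [NumberField K]
    (Ω : Type*) [Field Ω] [Algebra K Ω] [IsAlgClosure K Ω]
    (hK : ∃ ζ : K, IsPrimitiveRoot ζ (2 * ℓ))
    (m : ℕ) (hm : Nat.card {ζ : K // ∃ k : ℕ, ζ ^ ℓ ^ k = 1} = ℓ ^ m)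
    (γ : RadZ.Kinf ℓ K Ω ≃ₐ[K] RadZ.Kinf ℓ K Ω)
    (hγ : ∀ (ζ : RadZ.Kinf ℓ K Ω) (k : ℕ), ζ ^ ℓ ^ k = 1 → γ ζ = ζ ^ (1 + ℓ ^ m)) :
    RadZ.radMap ℓ (RadZ.unitsToKinf ℓ K Ω) '' RadZ.initialRadical ℓ m K Ω =
        RadZ.kummerRadical ℓ K Ω (RadZ.embeddableCompositum ℓ m K Ω) ∧
      RadZ.radMap ℓ (RadZ.unitsToLayerZero ℓ m K Ω) '' RadZ.initialRadical ℓ m K Ω =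
        (fun u : (∀ n : ℕ, RadZ.Radical ℓ (RadZ.layer ℓ m K Ω n)) => u 0) ''
          (RadZ.normLimit ℓ m K Ω γ : Set (∀ n : ℕ, RadZ.Radical ℓ (RadZ.layer ℓ m K Ω n))) := by
  have hclosed : IsAlgClosed Ω := IsAlgClosure.isAlgClosed K
  have halg : Algebra.IsAlgebraic K Ω := IsAlgClosure.isAlgebraic
  have hchar : CharZero Ω := charZero_of_injective_algebraMap (algebraMap K Ω).injective
  have hnormal : Normal K Ω := normal_iff.2 fun x =>
    ⟨Algebra.IsIntegral.isIntegral x, IsAlgClosed.splits _⟩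
  have hgal : IsGalois K Ω := {}
  obtain ⟨g, D, hg⟩ := RadZ.exists_cyclotomicGenerator hK hm γ hγ
  obtain ⟨ζ, hζ⟩ := RadZ.exists_primitiveRoot_pow (ℓ := ℓ) (Ω := Ω) 1
  rw [pow_one] at hζ
  obtain ⟨L, hL⟩ := RadZ.exists_logarithm hζ
  exact ⟨D.image_initialRadical hL, D.image_initialRadical_layer_zero hg hL⟩
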